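/- Let $\pi:\mathbb{C}^{n+1}\setminus\{0\}\to\mathbb{C}P^n$ be the projection. Every tangent vector of $\mathbb{C}P^n$ is $\pi_*(\zeta,\xi):=d\pi_\zeta(\xi)$ for some $\zeta\ne 0$ and $\xi$ in $\mathbb{C}^{n+1}$ with $\xi\cdot\bar\zeta=0$, and the pair $(\zeta,\xi)$ is unique up to $(\lambda\zeta,\lambda\xi)$, $\lambda\in\mathbb{C}^*$. The Fubini–Study metric is $g(\pi_*(\zeta,\xi),\pi_*(\zeta,\eta))=\mathrm{Re}(\bar\xi\cdot\eta)/|\zeta|^2$. Szőke's map $\Phi:T\mathbb{C}P^n\to\mathbb{C}P^n\times\mathbb{C}P^n$ sends $\pi_*(\zeta,\xi)$ to $$\Big(\big[\cosh\mu\,\zeta+\mathrm{i}\tfrac{\sinh\mu}{\mu}\,\xi\big],\big[\cosh\mu\,\bar\zeta+\mathrm{i}\tfrac{\sinh\mu}{\mu}\,\bar\xi\big]\Big),\qquad \mu=\frac{|\xi|}{|\zeta|}$$ (with $\tfrac{\sinh\mu}{\mu}\,\xi:=0$ when $\xi=0$). Let $\mathcal{M}\subset\mathbb{C}P^n\times\mathbb{C}P^n$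 be the open set $\sum_j z_jw_j\neq0$, and equip it with the Stenzel Kähler form $\Omega=\mathrm{i}\,\partial\bar\partial f(\mathcal{N})$, where $\mathcal{N}=\sum_{j,k}|z_jw_k|^2\big/\big|\sum_jz_jw_j\big|^2$ and $f(\mathcal N)=2\sqrt{\mathcal{N}}$ (so that $f'=\mathcal{N}^{-1/2}$). Proposition 1. The map $\Phi$ is a bijection of $T\mathbb{C}P^n$ onto $\mathcal{M}$. Let $M$ be a smooth manifold of real dimension $k$ and let $\varphi:M\to\mathbb{C}P^n$ be an arbitrary smooth immersion. Let $NM=\{(x,\nu): x\in M,\ \nu\in T_{\varphi(x)}\mathbb{C}P^n,\ \nu\perp d\varphi(T_xM)\}$ be its normal bundle with respect to the Fubini–Study metric, topologized as a subspace of $\varphi^*T\mathbb{C}P^n$. Then $\Phi(NM)$ is an immersed Lagrangian submanifold of $(\mathcal{M},\Omega)$. That is, $NM$ carries a smooth structure of real dimension $2n=\tfrac12\dim_{\mathbb{R}}\mathcal{M}$, compatible with its topology, for which $\Phi|_{NM}:NM\to\mathcal{M}$, $(x,\nu)\mapsto\Phi(\nu)$, is a smooth immersion with $(\Phi|_{NM})^*\Omega=0$.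 Moreover, if $\varphi$ is injective, so is $\Phi|_{NM}$, and if $\varphi$ is a topological embedding, so is $\Phi|_{NM}$. -/

import Mathlib

open scoped Manifold ContDiff LinearAlgebra.Projectivization Bundle

namespace StenzelCP

/-- Homogeneous coordinate vectors: `ℂ^{n+1}` with its standard Hermitian norm. -/
abbrev HomVec (n : ℕ) := EuclideanSpace ℂ (Fin (n + 1))

/-- Affine coordinates `ℂ^n`. -/
abbrev Aff (n : ℕ) := Fin n → ℂ

/-- Complex projective space `ℂP^n`. -/
abbrev CP (n : ℕ) := ℙ ℂ (HomVec n)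

/-- The quotient topology on `ℂP^n`. -/
instance (n : ℕ) : TopologicalSpace (CP n) :=
  inferInstanceAs (TopologicalSpace (Quotient (projectivizationSetoid ℂ (HomVec n))))

theorem isQuotientMap_mk' (n : ℕ) :
    Topology.IsQuotientMap (Projectivization.mk' ℂ : {v : HomVec n // v ≠ 0} → CP n) :=
  isQuotientMap_quotient_mk'

/-- The homogeneous vector `(Z_0, …, 1, …, Z_{n-1})` with `1` inserted in place `i`. -/
noncomputable def homogenize {n : ℕ} (i : Fin (n + 1)) (Z : Aff n) : HomVec n :=
  WithLp.toLp 2 (i.insertNth (1 : ℂ) Z)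

@[simp] theorem homogenize_same {n : ℕ} (i : Fin (n + 1)) (Z : Aff n) : homogenize i Z i = 1 := by
  simp [homogenize]

@[simp] theorem homogenize_succAbove {n : ℕ} (i : Fin (n + 1)) (Z : Aff n) (j : Fin n) :
    homogenize i Z (i.succAbove j) = Z j := by
  simp [homogenize]

theorem homogenize_ne_zero {n : ℕ} (i : Fin (n + 1)) (Z : Aff n) : homogenize i Z ≠ 0 := fun h => by
  have := congrArg (fun v : HomVec n => v i) h
  simp at this

theorem contDiff_homogenize {𝕜 : Type*} [NontriviallyNormedField 𝕜] [NormedAlgebra 𝕜 ℂ]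
    {n : ℕ} (i j : Fin (n + 1)) :
    ContDiff 𝕜 ω (fun Z : Aff n => homogenize i Z j) := by
  rcases Fin.eq_self_or_eq_succAbove i j with rfl | ⟨k, rfl⟩
  · simpa using contDiff_const
  · simpa using contDiff_apply 𝕜 ℂ k

/-- The affine coordinates `z_j / z_i`, `j ≠ i`, of a point of `ℂP^n`. -/
noncomputable def affineCoord {n : ℕ} (i : Fin (n + 1)) (p : CP n) : Aff n :=
  Projectivization.lift
    (fun (v : {v : HomVec n // v ≠ 0}) (j : Fin n) => v.1 (i.succAbove j) / v.1 i) (by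
    rintro ⟨a, ha⟩ ⟨b, hb⟩ t rfl
    have ht : t ≠ 0 := by rintro rfl; simp at ha
    funext j
    simp [mul_div_mul_left _ _ ht]) p

@[simp] theorem affineCoord_mk {n : ℕ} (i : Fin (n + 1)) (v : HomVec n) (hv : v ≠ 0) :
    affineCoord i (Projectivization.mk ℂ v hv) = fun j => v (i.succAbove j) / v i := rfl

/-- The open set `z_i ≠ 0` of `ℂP^n`. -/
def affineDomain {n : ℕ} (i : Fin (n + 1)) : Set (CP n) := {p | p.rep i ≠ 0}

theorem mk_mem_affineDomain {n : ℕ} (i : Fin (n + 1)) (v : HomVec n) (hv : v ≠ 0) :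
    Projectivization.mk ℂ v hv ∈ affineDomain i ↔ v i ≠ 0 := by
  obtain ⟨a, ha⟩ := Projectivization.exists_smul_eq_mk_rep ℂ v hv
  change (Projectivization.mk ℂ v hv).rep i ≠ 0 ↔ _
  rw [← ha]
  simp [Units.smul_def]

theorem isOpen_affineDomain {n : ℕ} (i : Fin (n + 1)) : IsOpen (affineDomain i : Set (CP n)) := by
  rw [← (isQuotientMap_mk' n).isOpen_preimage]
  have : (Projectivization.mk' ℂ ⁻¹' affineDomain i : Set {v : HomVec n // v ≠ 0})
      = {v | v.1 i ≠ 0} := by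
    ext v
    exact mk_mem_affineDomain i v.1 v.2
  rw [this]
  exact isOpen_ne_fun (by fun_prop) continuous_const

/-- The affine chart `[z] ↦ (z_j / z_i)_{j ≠ i}` of `ℂP^n`. -/
noncomputable def affineChart {n : ℕ} (i : Fin (n + 1)) : OpenPartialHomeomorph (CP n) (Aff n) where
  toFun := affineCoord i
  invFun Z := Projectivization.mk ℂ (homogenize i Z) (homogenize_ne_zero i Z)
  source := affineDomain i
  target := Set.univ
  map_source' _ _ := Set.mem_univ _
  map_target' Z _ := by
    rw [mk_mem_affineDomain]; simp
  left_inv' p hp := by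
    induction p using Projectivization.ind with
    | h v hv =>
      rw [mk_mem_affineDomain] at hp
      rw [Projectivization.mk_eq_mk_iff']
      refine ⟨(v i)⁻¹, ?_⟩
      ext j
      rcases Fin.eq_self_or_eq_succAbove i j with rfl | ⟨k, rfl⟩
      · simp [hp]
      · simp [div_eq_inv_mul]
  right_inv' Z _ := by
    funext j; simp
  open_source := isOpen_affineDomain i
  open_target := isOpen_univ
  continuousOn_toFun := by
    refine ((isQuotientMap_mk' n).continuousOn_isOpen_iff (isOpen_affineDomain i)).2 ?_
    have : ContinuousOn (fun v : {v : HomVec n // v ≠ 0} => fun j => v.1 (i.succAbove j) / v.1 i)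
        {v | v.1 i ≠ 0} := by
      refine continuousOn_pi.2 fun j => ContinuousOn.div ?_ ?_ fun v hv => hv
      · fun_prop
      · fun_prop
    refine this.mono fun v hv => ?_
    exact (mk_mem_affineDomain i v.1 v.2).1 hv
  continuousOn_invFun := by
    refine Continuous.continuousOn ?_
    refine (isQuotientMap_mk' n).continuous.comp (g := Projectivization.mk' ℂ)
      (f := fun Z : Aff n => (⟨homogenize i Z, homogenize_ne_zero i Z⟩ : {v : HomVec n // v ≠ 0})) ?_
    refine Continuous.subtype_mk ?_ _
    refine (PiLp.continuous_toLp 2 _).comp (continuous_pi fun j => ?_)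
    exact (contDiff_homogenize (𝕜 := ℂ) i j).continuous

theorem exists_mem_affineDomain {n : ℕ} (p : CP n) : ∃ i, p ∈ affineDomain i := by
  by_contra! h
  refine p.rep_nonzero ?_
  ext i
  simpa [affineDomain] using h i

/-- The index of an affine chart around `p`. -/
noncomputable def chartIndex {n : ℕ} (p : CP n) : Fin (n + 1) := (exists_mem_affineDomain p).choose

theorem mem_affineDomain_chartIndex {n : ℕ} (p : CP n) : p ∈ affineDomain (chartIndex p) :=
  (exists_mem_affineDomain p).choose_spec

/-- `ℂP^n` is charted on `ℂ^n` by the `n + 1` affine charts. -/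
noncomputable instance (n : ℕ) : ChartedSpace (Aff n) (CP n) where
  atlas := Set.range affineChart
  chartAt p := affineChart (chartIndex p)
  mem_chart_source p := mem_affineDomain_chartIndex p
  chart_mem_atlas _ := Set.mem_range_self _

theorem contDiffOn_affineChart_trans {n : ℕ} (i j : Fin (n + 1)) :
    ContDiffOn ℂ ω ((affineChart i).symm.trans (affineChart j) : Aff n → Aff n)
      ((affineChart i).symm.trans (affineChart j)).source := by
  refine contDiffOn_pi.2 fun k => ?_
  refine ContDiffOn.div (contDiff_homogenize i _).contDiffOn (contDiff_homogenize i j).contDiffOn ?_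
  intro Z hZ
  exact (mk_mem_affineDomain j _ _).1 hZ.2

/-- The complex manifold structure of `ℂP^n`. -/
instance (n : ℕ) : IsManifold 𝓘(ℂ, Aff n) ω (CP n) := by
  refine isManifold_of_contDiffOn _ _ _ ?_
  rintro _ _ ⟨i, rfl⟩ ⟨j, rfl⟩
  simpa using contDiffOn_affineChart_trans i j

/-- The underlying real manifold structure of `ℂP^n`. -/
instance (n : ℕ) : IsManifold 𝓘(ℝ, Aff n) ω (CP n) := by
  refine isManifold_of_contDiffOn _ _ _ ?_
  rintro _ _ ⟨i, rfl⟩ ⟨j, rfl⟩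
  simpa using (contDiffOn_affineChart_trans i j).restrict_scalars ℝ

/-- The projection `π : ℂ^{n+1} ∖ {0} → ℂP^n`; its value at `0` is irrelevant. -/
noncomputable def toCP {n : ℕ} (v : HomVec n) : CP n :=
  open scoped Classical in
  if h : v = 0 then Projectivization.mk ℂ (homogenize 0 0) (homogenize_ne_zero 0 0)
  else Projectivization.mk ℂ v h

theorem toCP_of_ne_zero {n : ℕ} {v : HomVec n} (hv : v ≠ 0) :
    toCP v = Projectivization.mk ℂ v hv := dif_neg hv

@[simp] theorem toCP_rep {n : ℕ} (p : CP n) : toCP p.rep = p := by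
  rw [toCP_of_ne_zero p.rep_nonzero, Projectivization.mk_rep]

theorem toCP_smul {n : ℕ} (c : ℂ) (hc : c ≠ 0) (v : HomVec n) : toCP (c • v) = toCP v := by
  by_cases hv : v = 0
  · simp [hv]
  · rw [toCP_of_ne_zero hv, toCP_of_ne_zero (smul_ne_zero hc hv), Projectivization.mk_eq_mk_iff']
    exact ⟨c, rfl⟩

theorem toCP_eq_iff {n : ℕ} {v w : HomVec n} (hv : v ≠ 0) (hw : w ≠ 0) :
    toCP v = toCP w ↔ ∃ c : ℂ, c ≠ 0 ∧ c • w = v := by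
  rw [toCP_of_ne_zero hv, toCP_of_ne_zero hw, Projectivization.mk_eq_mk_iff']
  refine ⟨fun ⟨c, h⟩ => ⟨c, ?_, h⟩, fun ⟨c, _, h⟩ => ⟨c, h⟩⟩
  rintro rfl
  exact hv (by simpa using h.symm)

theorem toCP_mem_affineDomain {n : ℕ} {v : HomVec n} (hv : v ≠ 0) (i : Fin (n + 1)) :
    toCP v ∈ affineDomain i ↔ v i ≠ 0 := by
  rw [toCP_of_ne_zero hv, mk_mem_affineDomain]

theorem affineCoord_toCP {n : ℕ} {v : HomVec n} (hv : v ≠ 0) (i : Fin (n + 1)) (j : Fin n) :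
    affineCoord i (toCP v) j = v (i.succAbove j) / v i := by
  rw [toCP_of_ne_zero hv, affineCoord_mk]

theorem continuousOn_toCP (n : ℕ) : ContinuousOn (toCP : HomVec n → CP n) {v | v ≠ 0} := by
  rw [continuousOn_iff_continuous_domRestrict]
  exact (isQuotientMap_mk' n).continuous.congr fun v => (toCP_of_ne_zero v.2).symm

/-- The differential of `π` at `ζ`, evaluated on `ξ`, in the affine coordinates `z_j / z_i`. -/
noncomputable def dCoord {n : ℕ} (i : Fin (n + 1)) (ζ ξ : HomVec n) : Aff n :=
  fun j => (ξ (i.succAbove j) * ζ i - ζ (i.succAbove j) * ξ i) / ζ i ^ 2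

theorem mfderiv_toCP {n : ℕ} {ζ : HomVec n} (hζ : ζ ≠ 0) (ξ : HomVec n) :
    mfderiv 𝓘(ℝ, HomVec n) 𝓘(ℝ, Aff n) toCP ζ ξ = dCoord (chartIndex (toCP ζ)) ζ ξ := by
  have hi : ζ (chartIndex (toCP ζ)) ≠ 0 :=
    (toCP_mem_affineDomain hζ _).1 (mem_affineDomain_chartIndex _)
  set i := chartIndex (toCP ζ) with hidef
  have hcoord : ∀ k : Fin (n + 1), HasFDerivAt (𝕜 := ℂ) (fun v : HomVec n => v k)
      (EuclideanSpace.proj k : HomVec n →L[ℂ] ℂ) ζ := fun k =>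
    (EuclideanSpace.proj k : HomVec n →L[ℂ] ℂ).hasFDerivAt
  have hq := fun j : Fin n => (hcoord (i.succAbove j)).mul
    ((hasDerivAt_inv hi).comp_hasFDerivAt ζ (hcoord i))
  have hd := (hasFDerivAt_pi.2 hq).restrictScalars ℝ
  have hev : writtenInExtChartAt 𝓘(ℝ, HomVec n) 𝓘(ℝ, Aff n) ζ toCP =ᶠ[nhds ζ]
      fun v j => v (i.succAbove j) * (v i)⁻¹ := by
    filter_upwards [isOpen_ne.mem_nhds hζ] with v hv
    funext j
    exact (affineCoord_toCP hv i j).trans (div_eq_mul_inv _ _)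
  have hm : HasMFDerivAt 𝓘(ℝ, HomVec n) 𝓘(ℝ, Aff n) toCP ζ _ :=
    ⟨(continuousOn_toCP n).continuousAt (isOpen_ne.mem_nhds hζ),
      (hd.congr_of_eventuallyEq hev).hasFDerivWithinAt⟩
  rw [hm.mfderiv]
  funext j
  change ζ (i.succAbove j) * (-(ζ i ^ 2)⁻¹ * ξ i) + (ζ i)⁻¹ * ξ (i.succAbove j) =
    (ξ (i.succAbove j) * ζ i - ζ (i.succAbove j) * ξ i) / ζ i ^ 2
  field_simp
  ring

/-- The tangent bundle of `ℂP^n` (as a real manifold). -/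
abbrev TCP (n : ℕ) := TangentBundle 𝓘(ℝ, Aff n) (CP n)

/-- The pair `(ζ, ξ)` represents the tangent vector `τ` of `ℂP^n`: `ζ ≠ 0`, `ξ · conj ζ = 0`, and
`τ` is the image of the tangent vector `ξ` at `ζ` under the differential of `π`. -/
def IsHorizontalLift {n : ℕ} (ζ ξ : HomVec n) (τ : TCP n) : Prop :=
  ζ ≠ 0 ∧ inner ℂ ζ ξ = 0 ∧ tangentMap 𝓘(ℝ, HomVec n) 𝓘(ℝ, Aff n) toCP ⟨ζ, ξ⟩ = τ

theorem tangentMap_toCP {n : ℕ} {ζ : HomVec n} (hζ : ζ ≠ 0) (ξ : HomVec n) :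
    tangentMap 𝓘(ℝ, HomVec n) 𝓘(ℝ, Aff n) toCP ⟨ζ, ξ⟩ =
      (⟨toCP ζ, dCoord (chartIndex (toCP ζ)) ζ ξ⟩ : TCP n) := by
  rw [← mfderiv_toCP hζ]; rfl

theorem dCoord_smul {n : ℕ} (i : Fin (n + 1)) {c : ℂ} (hc : c ≠ 0) (ζ ξ : HomVec n) :
    dCoord i (c • ζ) (c • ξ) = dCoord i ζ ξ := by
  funext j
  simp only [dCoord, PiLp.smul_apply, smul_eq_mul]
  rw [← mul_div_mul_left _ (ζ i ^ 2) (pow_ne_zero 2 hc)]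
  ring

theorem IsHorizontalLift.smul {n : ℕ} {ζ ξ : HomVec n} {τ : TCP n} (h : IsHorizontalLift ζ ξ τ)
    {c : ℂ} (hc : c ≠ 0) : IsHorizontalLift (c • ζ) (c • ξ) τ := by
  obtain ⟨hζ, ho, rfl⟩ := h
  refine ⟨smul_ne_zero hc hζ, by simp [ho], ?_⟩
  rw [tangentMap_toCP (smul_ne_zero hc hζ), tangentMap_toCP hζ, toCP_smul c hc, dCoord_smul _ hc]

/-- Every tangent vector at `π(ζ)` has exactly one horizontal lift at `ζ`. -/
theorem existsUnique_isHorizontalLift {n : ℕ} {ζ : HomVec n} (hζ : ζ ≠ 0) {τ : TCP n}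
    (h : toCP ζ = τ.proj) : ∃! ξ, IsHorizontalLift ζ ξ τ := by
  obtain ⟨p, v⟩ := τ
  change toCP ζ = p at h
  subst h
  have hi : ζ (chartIndex (toCP ζ)) ≠ 0 :=
    (toCP_mem_affineDomain hζ _).1 (mem_affineDomain_chartIndex _)
  have hz : inner ℂ ζ ζ ≠ 0 := inner_self_ne_zero.2 hζ
  have key : ∀ ξ : HomVec n, tangentMap 𝓘(ℝ, HomVec n) 𝓘(ℝ, Aff n) toCP ⟨ζ, ξ⟩ =
      (⟨toCP ζ, v⟩ : TCP n) ↔ dCoord (chartIndex (toCP ζ)) ζ ξ = v := by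
    intro ξ
    rw [tangentMap_toCP hζ]
    exact ⟨fun h => eq_of_heq (Bundle.TotalSpace.mk.inj h).2, fun h => congrArg _ h⟩
  unfold IsHorizontalLift
  simp only [key]
  generalize chartIndex (toCP ζ) = i at *
  change Aff n at v
  let ξ₀ : HomVec n := WithLp.toLp 2 (i.insertNth (0 : ℂ) (fun j => ζ i * v j))
  have h₀ : ξ₀ i = 0 := by simp [ξ₀]
  have h₁ : ∀ j, ξ₀ (i.succAbove j) = ζ i * v j := by simp [ξ₀]
  refine ⟨ξ₀ - (inner ℂ ζ ξ₀ / inner ℂ ζ ζ) • ζ, ⟨hζ, ?_, ?_⟩, ?_⟩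
  · rw [inner_sub_right, inner_smul_right, div_mul_cancel₀ _ hz, sub_self]
  · funext j
    simp only [dCoord, PiLp.sub_apply, PiLp.smul_apply, smul_eq_mul, h₀, h₁]
    field_simp
    ring
  · rintro ξ ⟨-, ho, hv⟩
    set ξ' := ξ₀ - (inner ℂ ζ ξ₀ / inner ℂ ζ ζ) • ζ with hξ'
    have ho' : inner ℂ ζ ξ' = 0 := by
      rw [hξ', inner_sub_right, inner_smul_right, div_mul_cancel₀ _ hz, sub_self]
    have hpar : ξ - ξ₀ = (ξ i / ζ i) • ζ := by
      ext k
      rcases Fin.eq_self_or_eq_succAbove i k with rfl | ⟨j, rfl⟩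
      · simp [h₀, hi]
      · have := congrFun hv j
        simp only [dCoord] at this
        simp only [PiLp.sub_apply, PiLp.smul_apply, smul_eq_mul, h₁, ← this]
        field_simp
        ring
    have hsub : ξ - ξ' = (ξ i / ζ i + inner ℂ ζ ξ₀ / inner ℂ ζ ζ) • ζ := by
      rw [hξ', add_smul, ← hpar]; abel
    have hc : (ξ i / ζ i + inner ℂ ζ ξ₀ / inner ℂ ζ ζ) * inner ℂ ζ ζ = 0 := by
      rw [← inner_smul_right, ← hsub, inner_sub_right, ho, ho', sub_self]
    rw [← sub_eq_zero, hsub, (mul_eq_zero.1 hc).resolve_right hz, zero_smul]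

/-- The horizontal lift of a tangent vector of `ℂP^n` at the chosen representative of its base
point. -/
noncomputable def horizontalLift {n : ℕ} (τ : TCP n) : HomVec n :=
  (existsUnique_isHorizontalLift τ.proj.rep_nonzero (toCP_rep τ.proj)).choose

theorem isHorizontalLift_horizontalLift {n : ℕ} (τ : TCP n) :
    IsHorizontalLift τ.proj.rep (horizontalLift τ) τ :=
  (existsUnique_isHorizontalLift τ.proj.rep_nonzero (toCP_rep τ.proj)).choose_spec.1

/-- Two representatives of a tangent vector differ by the diagonal action of `ℂ^*`. -/
theorem IsHorizontalLift.exists_smul {n : ℕ} {ζ ξ : HomVec n} {τ : TCP n}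
    (h : IsHorizontalLift ζ ξ τ) :
    ∃ c : ℂ, c ≠ 0 ∧ τ.proj.rep = c • ζ ∧ horizontalLift τ = c • ξ := by
  have hp : toCP ζ = τ.proj := congrArg Bundle.TotalSpace.proj h.2.2
  obtain ⟨c, hc, hcz⟩ := (toCP_eq_iff τ.proj.rep_nonzero h.1).1 ((toCP_rep _).trans hp.symm)
  refine ⟨c, hc, hcz.symm, ?_⟩
  have h1 := isHorizontalLift_horizontalLift τ
  have h2 := h.smul hc
  rw [hcz] at h2
  exact (existsUnique_isHorizontalLift τ.proj.rep_nonzero (toCP_rep τ.proj)).unique h1 h2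

/-- The Fubini–Study metric: `g(π_* ξ, π_* η) = Re⟨ξ, η⟩ / |ζ|²` for horizontal `ξ`, `η` at `ζ`. -/
noncomputable def fubiniStudy {n : ℕ} (p : CP n) (v w : TangentSpace 𝓘(ℝ, Aff n) p) : ℝ :=
  (inner ℂ (horizontalLift ⟨p, v⟩) (horizontalLift ⟨p, w⟩)).re / ‖p.rep‖ ^ 2

theorem fubiniStudy_eq {n : ℕ} {ζ ξ η : HomVec n} {p : CP n} {v w : TangentSpace 𝓘(ℝ, Aff n) p}
    (hv : IsHorizontalLift ζ ξ ⟨p, v⟩) (hw : IsHorizontalLift ζ η ⟨p, w⟩) :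
    fubiniStudy p v w = (inner ℂ ξ η).re / ‖ζ‖ ^ 2 := by
  obtain ⟨c, hc, h1, h2⟩ := hv.exists_smul
  obtain ⟨d, hd, h3, h4⟩ := hw.exists_smul
  change p.rep = _ at h1 h3
  have hcd : d = c := smul_left_injective ℂ hv.1 (h3.symm.trans h1)
  subst hcd
  have hd2 : ‖d‖ ^ 2 ≠ 0 := pow_ne_zero 2 (norm_ne_zero_iff.2 hd)
  rw [fubiniStudy, h1, h2, h4, inner_smul_left, inner_smul_right, norm_smul, ← mul_assoc,
    Complex.conj_mul', mul_pow, ← Complex.ofReal_pow, Complex.re_ofReal_mul,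
    mul_div_mul_left _ _ hd2]

/-- The normal bundle `NM` of a map `φ : M → ℂP^n`: all `(x, ν)` with `ν ∈ T_{φ(x)} ℂP^n`
orthogonal to `dφ(T_x M)`. It is a subset of the pullback bundle `φ^* TℂP^n`, with the subspace
topology. -/
def NormalBundle {n : ℕ} (k : ℕ) {M : Type*} [TopologicalSpace M]
    [ChartedSpace (EuclideanSpace ℝ (Fin k)) M] (φ : M → CP n) :
    Set (Bundle.TotalSpace (Aff n) (φ *ᵖ (TangentSpace 𝓘(ℝ, Aff n) : CP n → Type))) :=
  {x | ∀ u : TangentSpace 𝓘(ℝ, EuclideanSpace ℝ (Fin k)) x.proj,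
    fubiniStudy (φ x.proj) x.snd
      (mfderiv 𝓘(ℝ, EuclideanSpace ℝ (Fin k)) 𝓘(ℝ, Aff n) φ x.proj u) = 0}

/-- Entrywise complex conjugation. -/
noncomputable def conjVec {n : ℕ} (v : HomVec n) : HomVec n :=
  WithLp.toLp 2 (fun j => (starRingEnd ℂ) (v j))

/-- The map `(ζ, ξ) ↦ (cosh μ · ζ + i (sinh μ / μ) ξ; cosh μ · conj ζ + i (sinh μ / μ) conj ξ)` with
`μ = |ξ| / |ζ|`; for `ξ = 0` its value is `(ζ; conj ζ)`. -/
noncomputable def szokeHat {n : ℕ} (ζ ξ : HomVec n) : HomVec n × HomVec n :=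
  let μ : ℝ := ‖ξ‖ / ‖ζ‖
  ((Real.cosh μ : ℂ) • ζ + (Complex.I * (Real.sinh μ / μ : ℝ)) • ξ,
    (Real.cosh μ : ℂ) • conjVec ζ + (Complex.I * (Real.sinh μ / μ : ℝ)) • conjVec ξ)

/-- Szőke's map `Φ : TℂP^n → ℂP^n × ℂP^n`, covered by `szokeHat`. -/
noncomputable def szoke {n : ℕ} (τ : TCP n) : CP n × CP n :=
  (toCP (szokeHat τ.proj.rep (horizontalLift τ)).1, toCP (szokeHat τ.proj.rep (horizontalLift τ)).2)

theorem szokeHat_smul {n : ℕ} {c : ℂ} (hc : c ≠ 0) (ζ ξ : HomVec n) :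
    szokeHat (c • ζ) (c • ξ) =
      (c • (szokeHat ζ ξ).1, (starRingEnd ℂ) c • (szokeHat ζ ξ).2) := by
  have hconj : ∀ v : HomVec n, conjVec (c • v) = (starRingEnd ℂ) c • conjVec v := fun v => by
    ext j; simp [conjVec]
  simp only [szokeHat, norm_smul, mul_div_mul_left _ _ (norm_ne_zero_iff.2 hc), hconj, smul_add,
    smul_comm c, smul_comm ((starRingEnd ℂ) c)]

/-- `Φ` may be computed from any representative `(ζ, ξ)`. -/
theorem szoke_eq {n : ℕ} {ζ ξ : HomVec n} {τ : TCP n} (h : IsHorizontalLift ζ ξ τ) :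
    szoke τ = (toCP (szokeHat ζ ξ).1, toCP (szokeHat ζ ξ).2) := by
  obtain ⟨c, hc, h1, h2⟩ := h.exists_smul
  rw [szoke, h1, h2, szokeHat_smul hc]
  simp only [toCP_smul c hc, toCP_smul _ ((map_ne_zero (starRingEnd ℂ)).2 hc)]

/-- The open subset `𝓜 = {∑ z_i w_i ≠ 0}` of `ℂP^n × ℂP^n`. -/
def stenzelDomain (n : ℕ) : Set (CP n × CP n) := {q | ∑ i, q.1.rep i * q.2.rep i ≠ 0}

theorem mem_stenzelDomain_iff {n : ℕ} {z w : HomVec n} (hz : z ≠ 0) (hw : w ≠ 0) :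
    (toCP z, toCP w) ∈ stenzelDomain n ↔ ∑ i, z i * w i ≠ 0 := by
  obtain ⟨c, hc, h1⟩ := (toCP_eq_iff (toCP z).rep_nonzero hz).1 (toCP_rep _)
  obtain ⟨d, hd, h2⟩ := (toCP_eq_iff (toCP w).rep_nonzero hw).1 (toCP_rep _)
  change ∑ i, (toCP z).rep i * (toCP w).rep i ≠ 0 ↔ _
  rw [← h1, ← h2]
  have : ∑ i, (c • z) i * (d • w) i = (c * d) * ∑ i, z i * w i := by
    rw [Finset.mul_sum]
    refine Finset.sum_congr rfl fun i _ => ?_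
    simp only [PiLp.smul_apply, smul_eq_mul]; ring
  rw [this]
  simp [hc, hd]

/-- The exhaustion function `∑_{j,k} |z_j w_k|² / |∑_j z_j w_j|²` in homogeneous coordinates. -/
noncomputable def exhaustionHom {n : ℕ} (z w : HomVec n) : ℝ :=
  (∑ j, ∑ k, ‖z j * w k‖ ^ 2) / ‖∑ j, z j * w j‖ ^ 2

/-- The exhaustion function on `ℂP^n × ℂP^n` (of interest on `𝓜`). -/
noncomputable def exhaustion {n : ℕ} (q : CP n × CP n) : ℝ := exhaustionHom q.1.rep q.2.rep

theorem exhaustionHom_smul {n : ℕ} {c d : ℂ} (hc : c ≠ 0) (hd : d ≠ 0) (z w : HomVec n) :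
    exhaustionHom (c • z) (d • w) = exhaustionHom z w := by
  have h1 : ∑ j, ∑ k, ‖(c • z) j * (d • w) k‖ ^ 2 = ‖c * d‖ ^ 2 * ∑ j, ∑ k, ‖z j * w k‖ ^ 2 := by
    simp only [Finset.mul_sum, PiLp.smul_apply, smul_eq_mul, norm_mul]
    refine Finset.sum_congr rfl fun j _ => Finset.sum_congr rfl fun k _ => ?_
    ring
  have h2 : ∑ j, (c • z) j * (d • w) j = (c * d) * ∑ j, z j * w j := by
    simp only [Finset.mul_sum, PiLp.smul_apply, smul_eq_mul]
    refine Finset.sum_congr rfl fun j _ => ?_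
    ring
  have h3 : ‖c * d‖ ^ 2 ≠ 0 := pow_ne_zero 2 (norm_ne_zero_iff.2 (mul_ne_zero hc hd))
  rw [exhaustionHom, h1, h2, norm_mul (c * d), mul_pow, mul_div_mul_left _ _ h3, exhaustionHom]

theorem exhaustion_toCP {n : ℕ} {z w : HomVec n} (hz : z ≠ 0) (hw : w ≠ 0) :
    exhaustion (toCP z, toCP w) = exhaustionHom z w := by
  obtain ⟨c, hc, h1⟩ := (toCP_eq_iff (toCP z).rep_nonzero hz).1 (toCP_rep _)
  obtain ⟨d, hd, h2⟩ := (toCP_eq_iff (toCP w).rep_nonzero hw).1 (toCP_rep _)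
  change exhaustionHom (toCP z).rep (toCP w).rep = _
  rw [← h1, ← h2, exhaustionHom_smul hc hd]

/-- The Kähler potential `f(𝓝)` with `f' = 𝓝^{-1/2}`, that is `f(𝓝) = 2 √𝓝`. -/
noncomputable def stenzelPotential {n : ℕ} (q : CP n × CP n) : ℝ := 2 * √(exhaustion q)

/-- The real one-form `d^c u = i (∂̄ - ∂) u = -du ∘ J` of a real function `u` on a complex vector
space. -/
noncomputable def dcForm {E : Type*} [NormedAddCommGroup E] [NormedSpace ℂ E] (u : E → ℝ)
    (x v : E) : ℝ :=
  -(fderiv ℝ u x (Complex.I • v))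

/-- The real two-form `i ∂ ∂̄ u = ½ d d^c u` of a real function `u` on a complex vector space. -/
noncomputable def iDelDelbar {E : Type*} [NormedAddCommGroup E] [NormedSpace ℂ E] (u : E → ℝ)
    (x v w : E) : ℝ :=
  (1 / 2) * (fderiv ℝ (fun y => dcForm u y w) x v - fderiv ℝ (fun y => dcForm u y v) x w)

/-- The Stenzel Kähler form `Ω = i ∂ ∂̄ f(𝓝)` at a point `q` of `𝓜`, on tangent vectors at `q`:
computed in the holomorphic product chart around `q`, through which Mathlib identifies the tangent
space at `q` with `ℂ^n × ℂ^n`. -/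
noncomputable def stenzelForm {n : ℕ} (q : CP n × CP n)
    (v w : TangentSpace (𝓘(ℝ, Aff n).prod 𝓘(ℝ, Aff n)) q) : ℝ :=
  iDelDelbar (E := Aff n × Aff n)
    (stenzelPotential ∘ (extChartAt (𝓘(ℝ, Aff n).prod 𝓘(ℝ, Aff n)) q).symm)
    (extChartAt (𝓘(ℝ, Aff n).prod 𝓘(ℝ, Aff n)) q q) v w

/-- `F : L → 𝓜` is a Lagrangian immersion: a smooth immersion of a manifold `L` of real dimension
`2 n`, half that of `𝓜`, along which the Stenzel Kähler form pulls back to zero. -/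
structure IsLagrangianImmersion {n : ℕ} {L : Type*} [TopologicalSpace L]
    [ChartedSpace (EuclideanSpace ℝ (Fin (2 * n))) L] (F : L → CP n × CP n) : Prop where
  mem_domain : ∀ x, F x ∈ stenzelDomain n
  smooth : ContMDiff 𝓘(ℝ, EuclideanSpace ℝ (Fin (2 * n))) (𝓘(ℝ, Aff n).prod 𝓘(ℝ, Aff n)) ∞ F
  injective_mfderiv : ∀ x, Function.Injective
    (mfderiv 𝓘(ℝ, EuclideanSpace ℝ (Fin (2 * n))) (𝓘(ℝ, Aff n).prod 𝓘(ℝ, Aff n)) F x)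
  isotropic : ∀ x (u v : TangentSpace 𝓘(ℝ, EuclideanSpace ℝ (Fin (2 * n))) x),
    stenzelForm (F x)
      (mfderiv 𝓘(ℝ, EuclideanSpace ℝ (Fin (2 * n))) (𝓘(ℝ, Aff n).prod 𝓘(ℝ, Aff n)) F x u)
      (mfderiv 𝓘(ℝ, EuclideanSpace ℝ (Fin (2 * n))) (𝓘(ℝ, Aff n).prod 𝓘(ℝ, Aff n)) F x v) = 0

/-- The restriction of `Φ` to the normal bundle of `φ : M → ℂP^n`. -/
noncomputable def szokeNormal {n : ℕ} (k : ℕ) {M : Type*} [TopologicalSpace M]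
    [ChartedSpace (EuclideanSpace ℝ (Fin k)) M] (φ : M → CP n) (x : NormalBundle k φ) :
    CP n × CP n :=
  szoke (Bundle.Pullback.lift φ x.1)

end StenzelCP

open StenzelCP

/-!
Szőke's map `Φ` has an explicit inverse. In homogeneous coordinates, put
`(z, w) = szokeHat (ζ, ξ)` for `ξ` orthogonal to `ζ`. Then `z + w̄ = 2 cosh μ ζ` and
`z - w̄ = 2 i (sinh μ / μ) ξ`, and orthogonality gives `|z| = |w|` and `z · w = |ζ|²`. So a pair of
lines in the domain `𝓜` has representatives with `|z| = |w|` and `z · w > 0`, unique up to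
`(λ z, λ̄ w)`, and `cosh 2μ = |z| |w| / |z · w|` recovers `μ`. Written as functions of `μ²`, the
coefficients `cosh μ`, `sinh μ / μ` and the inverse of `sinh² μ` are smooth up to `μ² = 0`, so both
`Φ` and `Φ⁻¹` are smooth (`contMDiff_szoke`, `contMDiffAt_szokeInv`). Hence `Φ` is a bijection onto
`𝓜`, a topological embedding and an immersion, and the claims on injectivity and embeddings for
the restriction to `NM` follow from the fact that `NM → M × TℂP^n` is an embedding.

For the smooth structure on `NM`, let `ζ` be a local lift of `φ` to homogeneous coordinates. The
normal vectors at `x` are the `ξ` orthogonal, for the real inner product, to `ℂ ζ + dζ(T_x M)`, a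
space of real dimension `k + 2` because `φ` is an immersion. They form the kernels of a smooth
family of surjective linear maps, which is parametrized smoothly by a fixed vector space of
dimension `2n - k` (`exists_smooth_kernel_param`). This gives local parametrizations of `NM` inside
`M × TℂP^n` by open subsets of `ℝ^{2n}`, with inverses that extend smoothly to the ambient manifold
(`nonempty_localParam_normalIncl`), from which the charts and the immersion property are read off.

For the vanishing of `Ω`, let `u = 2 √𝓝`, so that `Ω = ½ d d^c u`. Since exterior differentiation
commutes with pullback, it is enough that the one-form `d^c u` pulls back to zero on `NM`
(`iDelDelbar_eq_zero_of_pullback`). At `szokeHat (ζ, ξ)` the pullback of `d^c u` is a multiple of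
`Re ⟨ξ, dζ⟩`: multiplying a velocity by `i` gives a direction in which `|z · w|` is
stationary, because `z · w` is real along the family, while the variation of `|z|² + |w|²` is a
multiple of `Im ⟨i ξ, dζ⟩` (`fderiv_potentialHom_szokeHat`). On the normal bundle `dζ` is the lift of
a vector tangent to `φ(M)`, to which `ξ` is orthogonal.
-/

namespace StenzelCP

/-! ### The functions `sinh √s / √s`, `cosh √s` and `arsinh² √σ` -/

/-- The entire function `s ↦ sinh √s / √s = ∑ sᵏ / (2k+1)!`, written as a power series in `s` so
that its smoothness across `s = 0` is visible. -/
noncomputable def sinhcSqrt : ℝ → ℝ :=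
  FormalMultilinearSeries.ofScalarsSum (fun k : ℕ => (((2 * k + 1).factorial : ℝ))⁻¹)

/-- The entire function `s ↦ cosh √s`, obtained from `sinhcSqrt` by `cosh x = 1 + 2 sinh² (x/2)`. -/
noncomputable def coshSqrt (s : ℝ) : ℝ := 1 + s / 2 * sinhcSqrt (s / 4) ^ 2

theorem contDiff_sinhcSqrt : ContDiff ℝ ω sinhcSqrt := by
  set c : ℕ → ℝ := fun k => (((2 * k + 1).factorial : ℝ))⁻¹ with hc
  have hr : (FormalMultilinearSeries.ofScalars ℝ c).radius = ⊤ := by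
    refine FormalMultilinearSeries.ofScalars_radius_eq_top_of_tendsto ℝ c
      (Filter.Eventually.of_forall fun k => by simp [hc, Nat.factorial_ne_zero]) ?_
    have h : ∀ k : ℕ, ‖c k.succ‖ / ‖c k‖ ≤ ((k : ℝ) + 1)⁻¹ := by
      intro k
      have e : (2 * k.succ + 1).factorial = (2 * k + 3) * ((2 * k + 2) * (2 * k + 1).factorial) := by
        rw [show 2 * k.succ + 1 = (2 * k + 2) + 1 by omega, Nat.factorial_succ,
          show 2 * k + 2 = (2 * k + 1) + 1 by omega, Nat.factorial_succ]
      have hf : (0 : ℝ) < ((2 * k + 1).factorial : ℝ) := by exact_mod_cast Nat.factorial_pos _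
      simp only [hc, e, norm_inv, Real.norm_natCast]
      push_cast
      rw [div_eq_mul_inv, inv_inv, ← div_eq_inv_mul, inv_eq_one_div,
        div_le_div_iff₀ (by positivity) (by positivity)]
      nlinarith [mul_nonneg (Nat.cast_nonneg (α := ℝ) k) hf.le,
        mul_nonneg (mul_nonneg (Nat.cast_nonneg (α := ℝ) k) (Nat.cast_nonneg (α := ℝ) k)) hf.le]
    refine squeeze_zero (fun k => by positivity) h ?_
    simpa [one_div] using tendsto_one_div_add_atTop_nhds_zero_nat (𝕜 := ℝ)
  have hp := (FormalMultilinearSeries.ofScalars ℝ c).hasFPowerSeriesOnBall (by rw [hr]; simp)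
  refine AnalyticOnNhd.contDiff fun x _ => ?_
  exact hp.analyticAt_of_mem (by simp [hr])

theorem mul_sinhcSqrt_sq (x : ℝ) : x * sinhcSqrt (x ^ 2) = Real.sinh x := by
  rw [sinhcSqrt, FormalMultilinearSeries.ofScalars_sum_eq, ← (Real.hasSum_sinh x).tsum_eq,
    ← tsum_mul_left]
  refine tsum_congr fun k => ?_
  rw [smul_eq_mul, ← pow_mul, pow_succ]
  ring

theorem sinhcSqrt_zero : sinhcSqrt 0 = 1 := by
  simp [sinhcSqrt]

theorem sinhcSqrt_sq_pos (x : ℝ) : 0 < sinhcSqrt (x ^ 2) := by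
  rcases lt_trichotomy x 0 with hx | rfl | hx
  · have := mul_sinhcSqrt_sq x
    have h := Real.sinh_neg_iff.2 hx
    rw [← this] at h
    exact pos_of_mul_neg_right h hx.le
  · simp [sinhcSqrt_zero]
  · have h := Real.sinh_pos_iff.2 hx
    rw [← mul_sinhcSqrt_sq x] at h
    exact pos_of_mul_pos_right h hx.le

theorem sinhcSqrt_pos {s : ℝ} (hs : 0 ≤ s) : 0 < sinhcSqrt s := by
  simpa [Real.sq_sqrt hs] using sinhcSqrt_sq_pos (√s)

theorem contDiff_coshSqrt : ContDiff ℝ ω coshSqrt := by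
  have := contDiff_sinhcSqrt
  unfold coshSqrt
  fun_prop

theorem coshSqrt_sq (x : ℝ) : coshSqrt (x ^ 2) = Real.cosh x := by
  have h := mul_sinhcSqrt_sq (x / 2)
  have h2 := Real.cosh_two_mul (x / 2)
  rw [mul_div_cancel₀ x two_ne_zero, Real.cosh_sq, ← h] at h2
  rw [h2, coshSqrt, show x ^ 2 / 4 = (x / 2) ^ 2 by ring]
  ring

theorem coshSqrt_pos {s : ℝ} (hs : 0 ≤ s) : 0 < coshSqrt s := by
  unfold coshSqrt
  positivity

theorem coshSqrt_sq_sub {s : ℝ} (hs : 0 ≤ s) :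
    coshSqrt s ^ 2 - s * sinhcSqrt s ^ 2 = 1 := by
  have h1 := coshSqrt_sq (√s)
  have h2 := mul_sinhcSqrt_sq (√s)
  rw [Real.sq_sqrt hs] at h1 h2
  have h3 : s * sinhcSqrt s ^ 2 = Real.sinh √s ^ 2 := by
    rw [← h2, mul_pow, Real.sq_sqrt hs]
  rw [h1, h3, Real.cosh_sq]
  ring

/-- The inverse `σ ↦ arsinh² √σ` of `s ↦ sinh² √s` on `[0, ∞)`. -/
noncomputable def arsinhSqrtSq (σ : ℝ) : ℝ := Real.arsinh √σ ^ 2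

theorem arsinhSqrtSq_nonneg (σ : ℝ) : 0 ≤ arsinhSqrtSq σ := sq_nonneg _

theorem arsinhSqrtSq_mul_sinhcSqrt_sq {σ : ℝ} (hσ : 0 ≤ σ) :
    arsinhSqrtSq σ * sinhcSqrt (arsinhSqrtSq σ) ^ 2 = σ := by
  have := mul_sinhcSqrt_sq (Real.arsinh √σ)
  rw [Real.sinh_arsinh] at this
  rw [arsinhSqrtSq, ← mul_pow, this, Real.sq_sqrt hσ]

/-- The derivative of `s ↦ sinh² √s` does not vanish on `[0, ∞)`. -/
theorem hasDerivAt_mul_sinhcSqrt_sq {s : ℝ} (hs : 0 ≤ s) :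
    ∃ d : ℝ, d ≠ 0 ∧ HasDerivAt (fun s => s * sinhcSqrt s ^ 2) d s := by
  have hd : DifferentiableAt ℝ sinhcSqrt s :=
    (contDiff_sinhcSqrt.differentiable (by simp)).differentiableAt
  rcases hs.eq_or_lt with rfl | hs
  · refine ⟨1, one_ne_zero, ?_⟩
    simpa [sinhcSqrt_zero] using (hasDerivAt_id' (0 : ℝ)).fun_mul (hd.hasDerivAt.fun_pow 2)
  · refine ⟨2 * Real.sinh √s * (Real.cosh √s * (1 / (2 * √s))), ?_, ?_⟩
    · have h1 := Real.sinh_pos_iff.2 (Real.sqrt_pos.2 hs)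
      have h2 := Real.cosh_pos √s
      have h3 := Real.sqrt_pos.2 hs
      positivity
    · have h := ((Real.hasDerivAt_sqrt hs.ne').sinh).fun_pow 2
      have h' : HasDerivAt (fun s => Real.sinh √s ^ 2)
          (2 * Real.sinh √s * (Real.cosh √s * (1 / (2 * √s)))) s := by simpa using h
      refine h'.congr_of_eventuallyEq ?_
      filter_upwards [lt_mem_nhds hs] with t ht
      rw [← mul_sinhcSqrt_sq, Real.sq_sqrt ht.le, mul_pow, Real.sq_sqrt ht.le]

/-- Smoothness up to the boundary point `0` comes from the inverse function theorem, applied to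
`s ↦ s · sinhcSqrt s ^ 2`, which is smooth on all of `ℝ`. -/
theorem contDiffOn_arsinhSqrtSq : ContDiffOn ℝ ∞ arsinhSqrtSq (Set.Ici 0) := by
  intro σ hσ
  set q : ℝ → ℝ := fun s => s * sinhcSqrt s ^ 2 with hq
  have hqs : ContDiff ℝ ∞ q := by
    have : ContDiff ℝ ∞ sinhcSqrt := contDiff_sinhcSqrt.of_le le_top
    fun_prop
  obtain ⟨d, hd, hder⟩ := hasDerivAt_mul_sinhcSqrt_sq (arsinhSqrtSq_nonneg σ)
  have hder' := hder.hasFDerivAt_equiv hd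
  have hcd := hqs.contDiffAt (x := arsinhSqrtSq σ)
  have hinf : (∞ : WithTop ℕ∞) ≠ 0 := by simp
  have hloc := hcd.to_localInverse hder' hinf
  have e1 : q (arsinhSqrtSq σ) = σ := arsinhSqrtSq_mul_sinhcSqrt_sq hσ
  rw [e1] at hloc
  refine (hloc.contDiffWithinAt (s := Set.Ici 0)).congr_of_eventuallyEq ?_ ?_
  · have hleft := (hcd.hasStrictFDerivAt' hder' hinf).eventually_left_inverse
    have hcont : Filter.Tendsto arsinhSqrtSq (nhdsWithin σ (Set.Ici 0)) (nhds (arsinhSqrtSq σ)) := by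
      have : Continuous arsinhSqrtSq := (Real.continuous_arsinh.comp Real.continuous_sqrt).pow 2
      exact this.continuousAt.mono_left nhdsWithin_le_nhds
    filter_upwards [hcont.eventually hleft, self_mem_nhdsWithin] with τ hτ hτ0
    have e2 : q (arsinhSqrtSq τ) = τ := arsinhSqrtSq_mul_sinhcSqrt_sq hτ0
    rw [e2] at hτ
    exact hτ.symm
  · have := hcd.localInverse_apply_image hder' hinf
    rw [e1] at this
    exact this.symm

/-! ### Smooth local lifts to homogeneous coordinates -/

section
variable {n : ℕ}

theorem contDiffAt_div_complex {E : Type*} [NormedAddCommGroup E] [NormedSpace ℝ E]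
    {m : WithTop ℕ∞} {f g : E → ℂ} {x : E} (hf : ContDiffAt ℝ m f x) (hg : ContDiffAt ℝ m g x)
    (h : g x ≠ 0) : ContDiffAt ℝ m (fun y => f y / g y) x := by
  simp only [div_eq_mul_inv]
  exact hf.mul (hg.inv h)

theorem contMDiffOn_toCP (n : ℕ) :
    ContMDiffOn 𝓘(ℝ, HomVec n) 𝓘(ℝ, Aff n) ω (toCP : HomVec n → CP n) {v | v ≠ 0} := by
  intro ζ hζ
  refine ContMDiffAt.contMDiffWithinAt ?_
  have hi : ζ (chartIndex (toCP ζ)) ≠ 0 :=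
    (toCP_mem_affineDomain hζ _).1 (mem_affineDomain_chartIndex _)
  set i := chartIndex (toCP ζ) with hidef
  refine contMDiffAt_iff_target.2
    ⟨(continuousOn_toCP n).continuousAt (isOpen_ne.mem_nhds hζ), ?_⟩
  have hcoord : ∀ k : Fin (n + 1), ContDiff ℝ ω (fun v : HomVec n => v k) := fun k =>
    (EuclideanSpace.proj k : HomVec n →L[ℂ] ℂ).contDiff.restrict_scalars ℝ
  have h : ContDiffAt ℝ ω (fun (v : HomVec n) (j : Fin n) => v (i.succAbove j) / v i) ζ :=
    contDiffAt_pi.2 fun j =>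
      contDiffAt_div_complex (hcoord (i.succAbove j)).contDiffAt (hcoord i).contDiffAt hi
  refine (h.congr_of_eventuallyEq ?_).contMDiffAt
  filter_upwards [isOpen_ne.mem_nhds hζ] with v hv
  funext j
  exact affineCoord_toCP hv i j

theorem contMDiffAt_toCP {ζ : HomVec n} (hζ : ζ ≠ 0) :
    ContMDiffAt 𝓘(ℝ, HomVec n) 𝓘(ℝ, Aff n) ω (toCP : HomVec n → CP n) ζ :=
  (contMDiffOn_toCP n).contMDiffAt (isOpen_ne.mem_nhds hζ)

theorem contDiff_homogenize_vec (i : Fin (n + 1)) :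
    ContDiff ℝ ω (homogenize i : Aff n → HomVec n) :=
  (contDiff_piLp 2).2 fun j => contDiff_homogenize i j

/-- The holomorphic section `[z] ↦ z / z_i` of `toCP` over `z_i ≠ 0`. -/
noncomputable def affineSection (i : Fin (n + 1)) (p : CP n) : HomVec n :=
  homogenize i (affineCoord i p)

theorem affineSection_ne_zero (i : Fin (n + 1)) (p : CP n) : affineSection i p ≠ 0 :=
  homogenize_ne_zero _ _

theorem toCP_affineSection {i : Fin (n + 1)} {p : CP n} (hp : p ∈ affineDomain i) :
    toCP (affineSection i p) = p := by
  rw [toCP_of_ne_zero (affineSection_ne_zero i p)]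
  exact (affineChart i).left_inv hp

theorem contMDiffOn_affineSection (i : Fin (n + 1)) :
    ContMDiffOn 𝓘(ℝ, Aff n) 𝓘(ℝ, HomVec n) ω (affineSection i : CP n → HomVec n)
      (affineDomain i) := by
  have h : ContMDiffOn 𝓘(ℝ, Aff n) 𝓘(ℝ, Aff n) ω (affineChart i : CP n → Aff n)
      (affineChart i).source :=
    contMDiffOn_of_mem_maximalAtlas (IsManifold.subset_maximalAtlas (Set.mem_range_self i))
  exact (contDiff_homogenize_vec i).contMDiff.comp_contMDiffOn h

theorem contMDiffAt_affineSection {i : Fin (n + 1)} {p : CP n} (hp : p ∈ affineDomain i) :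
    ContMDiffAt 𝓘(ℝ, Aff n) 𝓘(ℝ, HomVec n) ω (affineSection i : CP n → HomVec n) p :=
  (contMDiffOn_affineSection i).contMDiffAt ((isOpen_affineDomain i).mem_nhds hp)

/-- The kernel of the differential of `toCP` at `ζ` contains the complex line of `ζ`. -/
theorem mfderiv_toCP_sub_smul {ζ : HomVec n} (hζ : ζ ≠ 0) (ξ : HomVec n) (c : ℂ) :
    mfderiv 𝓘(ℝ, HomVec n) 𝓘(ℝ, Aff n) toCP ζ (ξ - c • ζ : HomVec n) =
      mfderiv 𝓘(ℝ, HomVec n) 𝓘(ℝ, Aff n) toCP ζ ξ := by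
  rw [mfderiv_toCP hζ, mfderiv_toCP hζ]
  funext j
  simp only [dCoord, PiLp.sub_apply, PiLp.smul_apply, smul_eq_mul]
  ring

/-- The component of `ξ` orthogonal to the complex line of `ζ`. -/
noncomputable def horizontalPart (ζ ξ : HomVec n) : HomVec n :=
  ξ - (inner ℂ ζ ξ / inner ℂ ζ ζ) • ζ

theorem inner_horizontalPart {ζ : HomVec n} (hζ : ζ ≠ 0) (ξ : HomVec n) :
    inner ℂ ζ (horizontalPart ζ ξ) = 0 := by
  rw [horizontalPart, inner_sub_right, inner_smul_right,
    div_mul_cancel₀ _ (inner_self_ne_zero.2 hζ), sub_self]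

theorem isHorizontalLift_horizontalPart {ζ : HomVec n} (hζ : ζ ≠ 0) (ξ : HomVec n) :
    IsHorizontalLift ζ (horizontalPart ζ ξ)
      (tangentMap 𝓘(ℝ, HomVec n) 𝓘(ℝ, Aff n) toCP ⟨ζ, ξ⟩) := by
  refine ⟨hζ, inner_horizontalPart hζ ξ, ?_⟩
  exact congrArg (fun v => (⟨toCP ζ, v⟩ : TCP n)) (mfderiv_toCP_sub_smul hζ ξ _)

/-- In the Fubini–Study product with a vector given by a horizontal lift, the second vector may be
given by any lift. -/
theorem fubiniStudy_eq_of_lift {ζ ξ η : HomVec n} {p : CP n} {v w : TangentSpace 𝓘(ℝ, Aff n) p}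
    (hv : IsHorizontalLift ζ ξ ⟨p, v⟩)
    (hw : tangentMap 𝓘(ℝ, HomVec n) 𝓘(ℝ, Aff n) toCP ⟨ζ, η⟩ = ⟨p, w⟩) :
    fubiniStudy p v w = (inner ℂ ξ η).re / ‖ζ‖ ^ 2 := by
  have h := isHorizontalLift_horizontalPart hv.1 η
  rw [hw] at h
  rw [fubiniStudy_eq hv h, horizontalPart, inner_sub_right, inner_smul_right,
    inner_eq_zero_symm.1 hv.2.1, mul_zero, sub_zero]

/-- The horizontal lift of a tangent vector at the representative with `i`-th coordinate `1`. -/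
noncomputable def affineLift (i : Fin (n + 1)) (τ : TCP n) : HomVec n :=
  horizontalPart (affineSection i τ.proj)
    (tangentMap 𝓘(ℝ, Aff n) 𝓘(ℝ, HomVec n) (affineSection i) τ).snd

theorem isHorizontalLift_affineLift {i : Fin (n + 1)} {τ : TCP n}
    (hτ : τ.proj ∈ affineDomain i) :
    IsHorizontalLift (affineSection i τ.proj) (affineLift i τ) τ := by
  have h := isHorizontalLift_horizontalPart (affineSection_ne_zero i τ.proj)
    (tangentMap 𝓘(ℝ, Aff n) 𝓘(ℝ, HomVec n) (affineSection i) τ).snd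
  have e : tangentMap 𝓘(ℝ, HomVec n) 𝓘(ℝ, Aff n) toCP
      (tangentMap 𝓘(ℝ, Aff n) 𝓘(ℝ, HomVec n) (affineSection i) τ) = τ := by
    rw [← tangentMap_comp_at τ
      ((contMDiffAt_toCP (affineSection_ne_zero i τ.proj)).mdifferentiableAt (by simp))
      ((contMDiffAt_affineSection hτ).mdifferentiableAt (by simp))]
    have : toCP ∘ affineSection i =ᶠ[nhds τ.proj] id := by
      filter_upwards [(isOpen_affineDomain i).mem_nhds hτ] with p hp
      exact toCP_affineSection hp
    have e1 : mfderiv 𝓘(ℝ, Aff n) 𝓘(ℝ, Aff n) (toCP ∘ affineSection i) τ.proj =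
        mfderiv 𝓘(ℝ, Aff n) 𝓘(ℝ, Aff n) (id : CP n → CP n) τ.proj := this.mfderiv_eq
    rw [mfderiv_id] at e1
    have e2 : (toCP ∘ affineSection i) τ.proj = τ.proj := this.self_of_nhds
    refine Bundle.TotalSpace.ext e2 (heq_of_eq ?_)
    exact congrArg (fun L : Aff n →L[ℝ] Aff n => L τ.snd) e1
  have e2 : (⟨affineSection i τ.proj,
      (tangentMap 𝓘(ℝ, Aff n) 𝓘(ℝ, HomVec n) (affineSection i) τ).snd⟩ :
        TangentBundle 𝓘(ℝ, HomVec n) (HomVec n)) =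
      tangentMap 𝓘(ℝ, Aff n) 𝓘(ℝ, HomVec n) (affineSection i) τ := rfl
  rw [e2, e] at h
  exact h

theorem contDiffAt_horizontalPart {q : HomVec n × HomVec n} (hq : q.1 ≠ 0) :
    ContDiffAt ℝ ω (fun q : HomVec n × HomVec n => horizontalPart q.1 q.2) q := by
  unfold horizontalPart
  have h1 : ContDiff ℝ ω (fun q : HomVec n × HomVec n => inner ℂ q.1 q.2) :=
    contDiff_fst.inner ℂ contDiff_snd
  have h2 : ContDiff ℝ ω (fun q : HomVec n × HomVec n => inner ℂ q.1 q.1) :=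
    contDiff_fst.inner ℂ contDiff_fst
  exact contDiffAt_snd.sub
    ((contDiffAt_div_complex h1.contDiffAt h2.contDiffAt (inner_self_ne_zero.2 hq)).smul contDiffAt_fst)

theorem contMDiffAt_affineLift {i : Fin (n + 1)} {τ : TCP n} (hτ : τ.proj ∈ affineDomain i) :
    ContMDiffAt 𝓘(ℝ, Aff n).tangent 𝓘(ℝ, HomVec n) ∞ (affineLift i : TCP n → HomVec n) τ := by
  have ho := isOpen_affineDomain (n := n) i
  have hop : IsOpen {τ : TCP n | τ.proj ∈ affineDomain i} :=
    ho.preimage (FiberBundle.continuous_proj _ _)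
  have h1 : ContMDiffAt 𝓘(ℝ, Aff n).tangent 𝓘(ℝ, HomVec n).tangent ∞
      (tangentMap 𝓘(ℝ, Aff n) 𝓘(ℝ, HomVec n) (affineSection i)) τ := by
    have h := ((contMDiffOn_affineSection (n := n) i).contMDiffOn_tangentMapWithin (m := ∞)
      le_top ho.uniqueMDiffOn).contMDiffAt (hop.mem_nhds hτ)
    refine h.congr_of_eventuallyEq ?_
    filter_upwards [hop.mem_nhds hτ] with σ hσ
    exact (tangentMapWithin_eq_tangentMap (ho.uniqueMDiffOn σ.proj hσ)
      ((contMDiffAt_affineSection hσ).mdifferentiableAt (by simp))).symm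
  have h2 := (contMDiff_snd_tangentBundle_modelSpace (n := ∞) (HomVec n)
    𝓘(ℝ, HomVec n)).contMDiffAt.comp τ h1
  have h3 : ContMDiffAt 𝓘(ℝ, Aff n).tangent 𝓘(ℝ, HomVec n) ∞
      (fun τ : TCP n => affineSection i τ.proj) τ :=
    ((contMDiffAt_affineSection hτ).of_le le_top).comp τ
      (Bundle.contMDiff_proj (TangentSpace 𝓘(ℝ, Aff n) : CP n → Type)).contMDiffAt
  have h4 : ContMDiffAt 𝓘(ℝ, HomVec n × HomVec n) 𝓘(ℝ, HomVec n) ∞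
      (fun q : HomVec n × HomVec n => horizontalPart q.1 q.2) (affineSection i τ.proj,
        (tangentMap 𝓘(ℝ, Aff n) 𝓘(ℝ, HomVec n) (affineSection i) τ).snd) :=
    ((contDiffAt_horizontalPart (affineSection_ne_zero i τ.proj)).of_le le_top).contMDiffAt
  exact ContMDiffAt.comp (g := fun q : HomVec n × HomVec n => horizontalPart q.1 q.2)
    (I' := 𝓘(ℝ, HomVec n × HomVec n)) τ h4 (h3.prodMk_space h2)

end

/-! ### Injectivity of Szőke's map -/

section
variable {n : ℕ}

@[simp] theorem conjVec_apply (v : HomVec n) (j : Fin (n + 1)) :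
    conjVec v j = (starRingEnd ℂ) (v j) := rfl

theorem conjVec_conjVec (v : HomVec n) : conjVec (conjVec v) = v := by
  ext j; simp

theorem conjVec_smul (c : ℂ) (v : HomVec n) :
    conjVec (c • v) = (starRingEnd ℂ) c • conjVec v := by
  ext j; simp

theorem conjVec_sub (v w : HomVec n) : conjVec (v - w) = conjVec v - conjVec w := by
  ext j; simp

theorem inner_conjVec_conjVec (v w : HomVec n) :
    inner ℂ (conjVec v) (conjVec w) = inner ℂ w v := by
  simp [PiLp.inner_apply, mul_comm]

theorem norm_conjVec (v : HomVec n) : ‖conjVec v‖ = ‖v‖ := by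
  simp [EuclideanSpace.norm_eq]

theorem sum_mul_eq_inner (z w : HomVec n) : ∑ i, z i * w i = inner ℂ (conjVec w) z := by
  simp [PiLp.inner_apply]

theorem contDiff_conjVec : ContDiff ℝ ω (conjVec : HomVec n → HomVec n) := by
  refine (contDiff_piLp 2).2 fun j => ?_
  exact Complex.conjCLE.contDiff.comp
    ((EuclideanSpace.proj j : HomVec n →L[ℂ] ℂ).contDiff.restrict_scalars ℝ)

theorem norm_sq_add_of_inner_eq_zero {a b : HomVec n} (h : inner ℂ a b = 0) :
    ‖a + b‖ ^ 2 = ‖a‖ ^ 2 + ‖b‖ ^ 2 := by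
  simpa only [sq] using norm_add_sq_eq_norm_sq_add_norm_sq_of_inner_eq_zero a b h

theorem norm_sq_sub_of_inner_eq_zero {a b : HomVec n} (h : inner ℂ a b = 0) :
    ‖a - b‖ ^ 2 = ‖a‖ ^ 2 + ‖b‖ ^ 2 := by
  rw [sub_eq_add_neg, norm_sq_add_of_inner_eq_zero (by simpa using h), norm_neg]

/-- `szokeHat` in terms of functions of `μ²`, which are smooth also at `μ = 0`. -/
theorem szokeHat_eq {ζ : HomVec n} (hζ : ζ ≠ 0) (ξ : HomVec n) {s : ℝ}
    (hs : s = ‖ξ‖ ^ 2 / ‖ζ‖ ^ 2) :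
    szokeHat ζ ξ =
      ((coshSqrt s : ℂ) • ζ + (Complex.I * sinhcSqrt s) • ξ,
        conjVec ((coshSqrt s : ℂ) • ζ - (Complex.I * sinhcSqrt s) • ξ)) := by
  have hs' : s = (‖ξ‖ / ‖ζ‖) ^ 2 := by rw [hs, div_pow]
  have h1 : Real.cosh (‖ξ‖ / ‖ζ‖) = coshSqrt s := by rw [hs', coshSqrt_sq]
  have h2 : (Complex.I * (Real.sinh (‖ξ‖ / ‖ζ‖) / (‖ξ‖ / ‖ζ‖) : ℝ)) • ξ =
      (Complex.I * sinhcSqrt s) • ξ := by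
    by_cases hξ : ξ = 0
    · simp [hξ]
    · have hμ : ‖ξ‖ / ‖ζ‖ ≠ 0 := div_ne_zero (norm_ne_zero_iff.2 hξ) (norm_ne_zero_iff.2 hζ)
      rw [hs', ← mul_sinhcSqrt_sq, mul_div_cancel_left₀ _ hμ]
  have h3 : (Complex.I * (Real.sinh (‖ξ‖ / ‖ζ‖) / (‖ξ‖ / ‖ζ‖) : ℝ)) • conjVec ξ =
      (Complex.I * sinhcSqrt s) • conjVec ξ := by
    have := congrArg conjVec h2
    simp only [conjVec_smul, map_mul, Complex.conj_I, Complex.conj_ofReal, neg_mul, neg_smul,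
      neg_inj] at this
    exact this
  refine Prod.ext ?_ ?_
  · change (Real.cosh (‖ξ‖ / ‖ζ‖) : ℂ) • ζ + _ = _
    rw [h1, h2]
  · change (Real.cosh (‖ξ‖ / ‖ζ‖) : ℂ) • conjVec ζ + _ = _
    rw [h1, h3, conjVec_sub, conjVec_smul, conjVec_smul]
    simp

section orthogonal
variable {ζ ξ : HomVec n} {s : ℝ}

theorem inner_smul_smul_eq_zero (h : inner ℂ ζ ξ = 0) (a b : ℂ) :
    inner ℂ (a • ζ) (b • ξ) = 0 := by
  rw [inner_smul_left, inner_smul_right, h, mul_zero, mul_zero]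

theorem norm_sq_coshSqrt_smul (s : ℝ) (ζ : HomVec n) :
    ‖(coshSqrt s : ℂ) • ζ‖ ^ 2 = coshSqrt s ^ 2 * ‖ζ‖ ^ 2 := by
  simp [norm_smul, mul_pow]

theorem norm_sq_sinhcSqrt_smul (s : ℝ) (ξ : HomVec n) :
    ‖(Complex.I * sinhcSqrt s) • ξ‖ ^ 2 = sinhcSqrt s ^ 2 * ‖ξ‖ ^ 2 := by
  simp [norm_smul, mul_pow]

theorem norm_szokeHat_fst_sq (hζ : ζ ≠ 0) (h : inner ℂ ζ ξ = 0) (hs : s = ‖ξ‖ ^ 2 / ‖ζ‖ ^ 2) :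
    ‖(szokeHat ζ ξ).1‖ ^ 2 = coshSqrt s ^ 2 * ‖ζ‖ ^ 2 + sinhcSqrt s ^ 2 * ‖ξ‖ ^ 2 := by
  rw [szokeHat_eq hζ ξ hs]
  simp only
  rw [norm_sq_add_of_inner_eq_zero (inner_smul_smul_eq_zero h _ _), norm_sq_coshSqrt_smul,
    norm_sq_sinhcSqrt_smul]

theorem norm_szokeHat_snd (hζ : ζ ≠ 0) (h : inner ℂ ζ ξ = 0) :
    ‖(szokeHat ζ ξ).2‖ = ‖(szokeHat ζ ξ).1‖ := by
  have h1 := norm_szokeHat_fst_sq hζ h rfl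
  rw [← sq_eq_sq₀ (norm_nonneg _) (norm_nonneg _), h1, szokeHat_eq hζ ξ rfl]
  simp only
  rw [norm_conjVec, norm_sq_sub_of_inner_eq_zero (inner_smul_smul_eq_zero h _ _),
    norm_sq_coshSqrt_smul, norm_sq_sinhcSqrt_smul]

/-- The identity `z · w = |ζ|²`, from `cosh² - sinh² = 1`. -/
theorem sum_szokeHat (hζ : ζ ≠ 0) (h : inner ℂ ζ ξ = 0) :
    ∑ i, (szokeHat ζ ξ).1 i * (szokeHat ζ ξ).2 i = ((‖ζ‖ ^ 2 : ℝ) : ℂ) := by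
  have hz : ‖ζ‖ ^ 2 ≠ 0 := pow_ne_zero 2 (norm_ne_zero_iff.2 hζ)
  obtain ⟨s, hs⟩ : ∃ s, s = ‖ξ‖ ^ 2 / ‖ζ‖ ^ 2 := ⟨_, rfl⟩
  have hs0 : 0 ≤ s := by rw [hs]; positivity
  have key := coshSqrt_sq_sub hs0
  have hx : ‖ξ‖ ^ 2 = s * ‖ζ‖ ^ 2 := by rw [hs, div_mul_cancel₀ _ hz]
  have hab := inner_smul_smul_eq_zero h (coshSqrt s : ℂ) (Complex.I * sinhcSqrt s)
  rw [sum_mul_eq_inner, szokeHat_eq hζ ξ hs]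
  simp only
  rw [conjVec_conjVec, inner_sub_left, inner_add_right, inner_add_right, hab,
    inner_eq_zero_symm.1 hab, inner_self_eq_norm_sq_to_K, inner_self_eq_norm_sq_to_K]
  simp only [Complex.coe_algebraMap]
  rw [← Complex.ofReal_pow, ← Complex.ofReal_pow, norm_sq_coshSqrt_smul,
    norm_sq_sinhcSqrt_smul, hx, add_zero, zero_add, ← Complex.ofReal_sub]
  congr 1
  linear_combination ‖ζ‖ ^ 2 * key

theorem szokeHat_fst_ne_zero (hζ : ζ ≠ 0) (h : inner ℂ ζ ξ = 0) : (szokeHat ζ ξ).1 ≠ 0 := by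
  intro h0
  have := sum_szokeHat hζ h
  rw [h0] at this
  exact hζ (by simpa using this.symm)

theorem szokeHat_snd_ne_zero (hζ : ζ ≠ 0) (h : inner ℂ ζ ξ = 0) : (szokeHat ζ ξ).2 ≠ 0 := by
  rw [← norm_ne_zero_iff, norm_szokeHat_snd hζ h, norm_ne_zero_iff]
  exact szokeHat_fst_ne_zero hζ h

end orthogonal

theorem szoke_mem_stenzelDomain (τ : TCP n) : szoke τ ∈ stenzelDomain n := by
  have h := isHorizontalLift_horizontalLift τ
  rw [szoke_eq h, mem_stenzelDomain_iff (szokeHat_fst_ne_zero h.1 h.2.1)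
    (szokeHat_snd_ne_zero h.1 h.2.1), sum_szokeHat h.1 h.2.1]
  simpa using h.1

/-- The pair `(ζ, ξ)` is recovered from `z + w̄` and `z - w̄`, up to real factors and `i`. -/
theorem szokeHat_sum_diff {ζ : HomVec n} (hζ : ζ ≠ 0) (ξ : HomVec n) {s : ℝ}
    (hs : s = ‖ξ‖ ^ 2 / ‖ζ‖ ^ 2) :
    (szokeHat ζ ξ).1 + conjVec (szokeHat ζ ξ).2 = (2 * coshSqrt s : ℂ) • ζ ∧
    (szokeHat ζ ξ).1 - conjVec (szokeHat ζ ξ).2 = (2 * (Complex.I * sinhcSqrt s)) • ξ := by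
  rw [szokeHat_eq hζ ξ hs]
  simp only [conjVec_conjVec]
  constructor <;> module

theorem exists_unit_isHorizontalLift (τ : TCP n) :
    ∃ ζ ξ, IsHorizontalLift ζ ξ τ ∧ ‖ζ‖ = 1 := by
  have h := isHorizontalLift_horizontalLift τ
  have h0 : ‖τ.proj.rep‖ ≠ 0 := norm_ne_zero_iff.2 h.1
  refine ⟨_, _, h.smul (c := ((‖τ.proj.rep‖⁻¹ : ℝ) : ℂ)) ?_, ?_⟩
  · simpa using h.1
  · rw [norm_smul]; simp [h0]

theorem szoke_injective : Function.Injective (szoke : TCP n → CP n × CP n) := by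
  intro τ τ' heq
  obtain ⟨ζ, ξ, h, hn⟩ := exists_unit_isHorizontalLift τ
  obtain ⟨ζ', ξ', h', hn'⟩ := exists_unit_isHorizontalLift τ'
  rw [szoke_eq h, szoke_eq h', Prod.mk.injEq] at heq
  -- The representatives differ by scalars `a` and `b`; the normalizations `z · w = 1` and `|z| = |w|`
  -- force `b = ā` and `|a| = 1`.
  obtain ⟨a, ha, ea⟩ := (toCP_eq_iff (szokeHat_fst_ne_zero h'.1 h'.2.1)
    (szokeHat_fst_ne_zero h.1 h.2.1)).1 heq.1.symm
  obtain ⟨b, hb, eb⟩ := (toCP_eq_iff (szokeHat_snd_ne_zero h'.1 h'.2.1)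
    (szokeHat_snd_ne_zero h.1 h.2.1)).1 heq.2.symm
  have hab : a * b = 1 := by
    have h1 := sum_szokeHat h.1 h.2.1
    have h2 := sum_szokeHat h'.1 h'.2.1
    rw [← ea, ← eb, hn'] at h2
    rw [hn] at h1
    have : ∑ i, (a • (szokeHat ζ ξ).1) i * (b • (szokeHat ζ ξ).2) i =
        (a * b) * ∑ i, (szokeHat ζ ξ).1 i * (szokeHat ζ ξ).2 i := by
      rw [Finset.mul_sum]
      refine Finset.sum_congr rfl fun i _ => ?_
      simp only [PiLp.smul_apply, smul_eq_mul]; ring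
    rw [this, h1] at h2
    simpa using h2
  have hnorm : ‖a‖ = ‖b‖ := by
    have h1 := norm_szokeHat_snd h'.1 h'.2.1
    rw [← ea, ← eb, norm_smul, norm_smul, norm_szokeHat_snd h.1 h.2.1] at h1
    exact (mul_right_cancel₀ (norm_ne_zero_iff.2 (szokeHat_fst_ne_zero h.1 h.2.1)) h1).symm
  have ha1 : ‖a‖ = 1 := by
    have := congrArg norm hab
    rw [norm_mul, ← hnorm, norm_one] at this
    nlinarith [norm_nonneg a]
  have hba : (starRingEnd ℂ) b = a := by
    have h1 : a * (starRingEnd ℂ) a = 1 := by rw [Complex.mul_conj']; simp [ha1]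
    have h2 : b = (starRingEnd ℂ) a := mul_left_cancel₀ ha (hab.trans h1.symm)
    rw [h2, Complex.conj_conj]
  obtain ⟨s, hs⟩ : ∃ s, s = ‖ξ‖ ^ 2 / ‖ζ‖ ^ 2 := ⟨_, rfl⟩
  obtain ⟨s', hs'⟩ : ∃ s, s = ‖ξ'‖ ^ 2 / ‖ζ'‖ ^ 2 := ⟨_, rfl⟩
  have hs0 : 0 ≤ s := by rw [hs]; positivity
  have hs0' : 0 ≤ s' := by rw [hs']; positivity
  obtain ⟨e1, e2⟩ := szokeHat_sum_diff h.1 ξ hs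
  obtain ⟨e1', e2'⟩ := szokeHat_sum_diff h'.1 ξ' hs'
  rw [← ea, ← eb, conjVec_smul, hba, ← smul_add, e1, smul_smul] at e1'
  rw [← ea, ← eb, conjVec_smul, hba, ← smul_sub, e2, smul_smul] at e2'
  have hC : coshSqrt s = coshSqrt s' := by
    have := congrArg norm e1'
    simpa [norm_smul, hn, hn', ha1, abs_of_pos (coshSqrt_pos hs0), abs_of_pos (coshSqrt_pos hs0')]
      using this
  have hss : s = s' := by
    -- `cosh` is injective on `[0, ∞)`.
    have h1 : coshSqrt (√s ^ 2) = coshSqrt (√s' ^ 2) := by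
      rw [Real.sq_sqrt hs0, Real.sq_sqrt hs0', hC]
    rw [coshSqrt_sq, coshSqrt_sq] at h1
    have h2 := Real.cosh_injOn (Real.sqrt_nonneg s) (Real.sqrt_nonneg s') h1
    rwa [Real.sqrt_inj hs0 hs0'] at h2
  subst hss
  have hC0 : (2 * coshSqrt s : ℂ) ≠ 0 := by
    have := (coshSqrt_pos hs0).ne'
    simp [this]
  have hS0 : (2 * (Complex.I * sinhcSqrt s)) ≠ 0 := by
    have := (sinhcSqrt_pos hs0).ne'
    simp [this]
  rw [mul_comm, mul_smul, smul_right_inj hC0] at e1'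
  rw [mul_comm, mul_smul, smul_right_inj hS0] at e2'
  have h2 := h.smul ha
  rw [e1', e2'] at h2
  exact h2.2.2.symm.trans h'.2.2

end

/-! ### The inverse of Szőke's map in homogeneous coordinates -/

section
variable {n : ℕ}

/-- The parameter `μ² = arsinh² √((cosh 2μ - 1) / 2)` of the preimage of `([z], [w])` under `szoke`,
from `cosh 2μ = |z| |w| / |z · w|`. -/
noncomputable def szokeParam (z w : HomVec n) : ℝ :=
  arsinhSqrtSq ((‖z‖ * ‖w‖ / ‖inner ℂ (conjVec w) z‖ - 1) / 2)

/-- The multiple of `conjVec w` that has the norm of `z` and positive inner product with `z`. -/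
noncomputable def szokePartner (z w : HomVec n) : HomVec n :=
  (inner ℂ (conjVec w) z * (‖z‖ / (‖inner ℂ (conjVec w) z‖ * ‖w‖) : ℝ) : ℂ) • conjVec w

/-- A representative `(ζ, ξ)` of the preimage of `([z], [w])` under `szoke`. -/
noncomputable def szokeInvHat (z w : HomVec n) : HomVec n × HomVec n :=
  ((((2 * coshSqrt (szokeParam z w))⁻¹ : ℝ) : ℂ) • (z + szokePartner z w),
    (-Complex.I * ((2 * sinhcSqrt (szokeParam z w))⁻¹ : ℝ)) • (z - szokePartner z w))

section inverse
variable {z w : HomVec n}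

theorem ne_zero_of_inner_conjVec (h : inner ℂ (conjVec w) z ≠ 0) : z ≠ 0 ∧ w ≠ 0 := by
  refine ⟨?_, ?_⟩
  · rintro rfl; simp at h
  · rintro rfl
    apply h
    have : conjVec (0 : HomVec n) = 0 := by ext j; simp
    simp [this]

theorem one_le_ratio (h : inner ℂ (conjVec w) z ≠ 0) :
    1 ≤ ‖z‖ * ‖w‖ / ‖inner ℂ (conjVec w) z‖ := by
  rw [one_le_div (norm_pos_iff.2 h), mul_comm ‖z‖, ← norm_conjVec w]
  exact norm_inner_le_norm _ _

theorem norm_szokePartner (h : inner ℂ (conjVec w) z ≠ 0) : ‖szokePartner z w‖ = ‖z‖ := by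
  have hw := norm_ne_zero_iff.2 (ne_zero_of_inner_conjVec h).2
  have hp := norm_ne_zero_iff.2 h
  rw [szokePartner, norm_smul, norm_mul, norm_conjVec, Complex.norm_real, Real.norm_of_nonneg
    (by positivity)]
  field_simp

theorem inner_szokePartner (h : inner ℂ (conjVec w) z ≠ 0) :
    inner ℂ (szokePartner z w) z =
      ((‖z‖ ^ 2 / (‖z‖ * ‖w‖ / ‖inner ℂ (conjVec w) z‖) : ℝ) : ℂ) := by
  have hz := norm_ne_zero_iff.2 (ne_zero_of_inner_conjVec h).1
  have hw := norm_ne_zero_iff.2 (ne_zero_of_inner_conjVec h).2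
  have hp := norm_ne_zero_iff.2 h
  rw [szokePartner, inner_smul_left, map_mul, Complex.conj_ofReal, mul_right_comm,
    Complex.conj_mul', ← Complex.ofReal_pow, ← Complex.ofReal_mul]
  congr 1
  field_simp

/-- `szokeInvHat` inverts `szokeHat` up to the choice of the representative of `[w]`, which becomes
the one with `|w| = |z|` and `z · w > 0`. -/
theorem szokeHat_szokeInvHat (h : inner ℂ (conjVec w) z ≠ 0) :
    (szokeInvHat z w).1 ≠ 0 ∧ inner ℂ (szokeInvHat z w).1 (szokeInvHat z w).2 = 0 ∧
      szokeHat (szokeInvHat z w).1 (szokeInvHat z w).2 = (z, conjVec (szokePartner z w)) := by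
  have hz := norm_pos_iff.2 (ne_zero_of_inner_conjVec h).1
  have ht := one_le_ratio h
  have hy := norm_szokePartner h
  have hyz := inner_szokePartner h
  have hzy := inner_conj_symm (𝕜 := ℂ) z (szokePartner z w)
  rw [hyz, Complex.conj_ofReal] at hzy
  set t := ‖z‖ * ‖w‖ / ‖inner ℂ (conjVec w) z‖ with htdef
  set y := szokePartner z w
  have hs0 : 0 ≤ szokeParam z w := arsinhSqrtSq_nonneg _
  have hsS : szokeParam z w * sinhcSqrt (szokeParam z w) ^ 2 = (t - 1) / 2 :=
    arsinhSqrtSq_mul_sinhcSqrt_sq (by linarith)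
  have hCS := coshSqrt_sq_sub hs0
  have hC := coshSqrt_pos hs0
  have hS := sinhcSqrt_pos hs0
  set s := szokeParam z w with hsdef
  have hadd : ‖z + y‖ ^ 2 = 2 * ‖z‖ ^ 2 * (1 + 1 / t) := by
    have := norm_add_sq (𝕜 := ℂ) z y
    rw [this, ← hzy, hy]
    simp only [RCLike.re_to_complex, Complex.ofReal_re]
    ring
  have hsub : ‖z - y‖ ^ 2 = 2 * ‖z‖ ^ 2 * (1 - 1 / t) := by
    have := norm_sub_sq (𝕜 := ℂ) z y
    rw [this, ← hzy, hy]
    simp only [RCLike.re_to_complex, Complex.ofReal_re]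
    ring
  have horth : inner ℂ (z + y) (z - y) = 0 := by
    rw [inner_add_left, inner_sub_right, inner_sub_right, hyz, ← hzy,
      inner_self_eq_norm_sq_to_K, inner_self_eq_norm_sq_to_K, hy]
    ring
  have hζ2 : ‖(szokeInvHat z w).1‖ ^ 2 = ‖z‖ ^ 2 / t := by
    change ‖(((2 * coshSqrt s)⁻¹ : ℝ) : ℂ) • (z + y)‖ ^ 2 = _
    rw [norm_smul, mul_pow, hadd, Complex.norm_real, Real.norm_of_nonneg (by positivity), inv_pow,
      mul_pow, show coshSqrt s ^ 2 = (t + 1) / 2 by linarith]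
    field_simp
  have hξ2 : ‖(szokeInvHat z w).2‖ ^ 2 = s * (‖z‖ ^ 2 / t) := by
    change ‖(-Complex.I * ((2 * sinhcSqrt s)⁻¹ : ℝ)) • (z - y)‖ ^ 2 = _
    rw [norm_smul, mul_pow, hsub, norm_mul, Complex.norm_real, norm_neg, Complex.norm_I, one_mul,
      Real.norm_of_nonneg (by positivity), inv_pow, mul_pow]
    have ht0 : t ≠ 0 := by positivity
    have : t - 1 = 2 * (s * sinhcSqrt s ^ 2) := by linarith
    rw [show 1 - 1 / t = (t - 1) / t by field_simp, this]
    field_simp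
  have hζ0 : (szokeInvHat z w).1 ≠ 0 := by
    rw [← norm_ne_zero_iff, ← pow_ne_zero_iff two_ne_zero, hζ2]
    positivity
  refine ⟨hζ0, inner_smul_smul_eq_zero horth _ _, ?_⟩
  rw [szokeHat_eq hζ0 _ (s := s) (by rw [hζ2, hξ2]; field_simp)]
  have e1 : (coshSqrt s : ℂ) • (szokeInvHat z w).1 = (1 / 2 : ℂ) • (z + y) := by
    change (coshSqrt s : ℂ) • (((2 * coshSqrt s)⁻¹ : ℝ) : ℂ) • (z + y) = _
    rw [smul_smul]
    congr 1
    have : (coshSqrt s : ℂ) ≠ 0 := by exact_mod_cast hC.ne'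
    push_cast
    field_simp
  have e2 : (Complex.I * sinhcSqrt s) • (szokeInvHat z w).2 = (1 / 2 : ℂ) • (z - y) := by
    change (Complex.I * sinhcSqrt s) • (-Complex.I * ((2 * sinhcSqrt s)⁻¹ : ℝ)) • (z - y) = _
    rw [smul_smul]
    congr 1
    have : (sinhcSqrt s : ℂ) ≠ 0 := by exact_mod_cast hS.ne'
    push_cast
    field_simp
    simp
  rw [e1, e2]
  refine Prod.ext ?_ (congrArg conjVec ?_)
  · module
  · module

theorem toCP_conjVec_szokePartner (h : inner ℂ (conjVec w) z ≠ 0) :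
    toCP (conjVec (szokePartner z w)) = toCP w := by
  have hz := norm_ne_zero_iff.2 (ne_zero_of_inner_conjVec h).1
  have hw := norm_ne_zero_iff.2 (ne_zero_of_inner_conjVec h).2
  have hp := norm_ne_zero_iff.2 h
  rw [szokePartner, conjVec_smul, conjVec_conjVec, toCP_smul]
  rw [map_ne_zero]
  refine mul_ne_zero h ?_
  have : ‖z‖ / (‖inner ℂ (conjVec w) z‖ * ‖w‖) ≠ 0 := by positivity
  exact_mod_cast this

/-- Smoothness holds also where `μ = 0`: the argument of `arsinhSqrtSq` in `szokeParam` has values in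
`[0, ∞)` by Cauchy–Schwarz, and `arsinhSqrtSq` is smooth up to `0`. -/
theorem contDiffAt_szokeInvHat (h : inner ℂ (conjVec w) z ≠ 0) :
    ContDiffAt ℝ ∞ (fun q : HomVec n × HomVec n => szokeInvHat q.1 q.2) (z, w) := by
  set U : Set (HomVec n × HomVec n) := {q | inner ℂ (conjVec q.2) q.1 ≠ 0} with hU
  have hpair : ContDiff ℝ ∞ (fun q : HomVec n × HomVec n => inner ℂ (conjVec q.2) q.1) :=
    ((contDiff_conjVec.of_le le_top).comp contDiff_snd).inner ℂ contDiff_fst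
  have hUo : IsOpen U := isOpen_ne_fun hpair.continuous continuous_const
  have hN : ContDiffOn ℝ ∞ (fun q : HomVec n × HomVec n => ‖inner ℂ (conjVec q.2) q.1‖) U :=
    hpair.contDiffOn.norm ℂ fun q hq => hq
  have hN0 : ∀ q ∈ U, ‖inner ℂ (conjVec q.2) q.1‖ ≠ 0 := fun q hq => norm_ne_zero_iff.2 hq
  have hz : ContDiffOn ℝ ∞ (fun q : HomVec n × HomVec n => ‖q.1‖) U :=
    contDiff_fst.contDiffOn.norm ℂ fun q hq => (ne_zero_of_inner_conjVec hq).1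
  have hw : ContDiffOn ℝ ∞ (fun q : HomVec n × HomVec n => ‖q.2‖) U :=
    contDiff_snd.contDiffOn.norm ℂ fun q hq => (ne_zero_of_inner_conjVec hq).2
  have hw0 : ∀ q ∈ U, ‖q.2‖ ≠ 0 := fun q hq =>
    norm_ne_zero_iff.2 (ne_zero_of_inner_conjVec hq).2
  have hs : ContDiffOn ℝ ∞ (fun q : HomVec n × HomVec n => szokeParam q.1 q.2) U := by
    refine contDiffOn_arsinhSqrtSq.comp
      ((((hz.mul hw).div hN hN0).sub contDiffOn_const).div_const 2) fun q hq => ?_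
    have := one_le_ratio hq
    rw [Set.mem_Ici]
    linarith
  have hof : ContDiff ℝ ∞ (fun x : ℝ => (x : ℂ)) := Complex.ofRealCLM.contDiff
  have hy : ContDiffOn ℝ ∞ (fun q : HomVec n × HomVec n => szokePartner q.1 q.2) U :=
    (hpair.contDiffOn.mul (hof.comp_contDiffOn (hz.div (hN.mul hw) fun q hq =>
      mul_ne_zero (hN0 q hq) (hw0 q hq)))).smul
      ((contDiff_conjVec.of_le le_top).comp contDiff_snd).contDiffOn
  have hC : ContDiffOn ℝ ∞
      (fun q : HomVec n × HomVec n => (((2 * coshSqrt (szokeParam q.1 q.2))⁻¹ : ℝ) : ℂ)) U :=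
    hof.comp_contDiffOn ((contDiffOn_const.mul
      ((contDiff_coshSqrt.of_le le_top).comp_contDiffOn hs)).inv fun q hq =>
        mul_ne_zero two_ne_zero (coshSqrt_pos (arsinhSqrtSq_nonneg _)).ne')
  have hS : ContDiffOn ℝ ∞
      (fun q : HomVec n × HomVec n => (((2 * sinhcSqrt (szokeParam q.1 q.2))⁻¹ : ℝ) : ℂ)) U :=
    hof.comp_contDiffOn ((contDiffOn_const.mul
      ((contDiff_sinhcSqrt.of_le le_top).comp_contDiffOn hs)).inv fun q hq =>
        mul_ne_zero two_ne_zero (sinhcSqrt_pos (arsinhSqrtSq_nonneg _)).ne')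
  have hall : ContDiffOn ℝ ∞ (fun q : HomVec n × HomVec n => szokeInvHat q.1 q.2) U :=
    (hC.smul (contDiff_fst.contDiffOn.add hy)).prodMk
      ((contDiffOn_const.mul hS).smul (contDiff_fst.contDiffOn.sub hy))
  exact hall.contDiffAt (hUo.mem_nhds h)

end inverse

theorem surjOn_szoke : Set.SurjOn (szoke : TCP n → CP n × CP n) Set.univ (stenzelDomain n) := by
  rintro ⟨p, p'⟩ hq
  have h : inner ℂ (conjVec p'.rep) p.rep ≠ 0 := by
    rw [← sum_mul_eq_inner]; exact hq
  obtain ⟨h1, h2, h3⟩ := szokeHat_szokeInvHat h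
  refine ⟨_, trivial, (szoke_eq ⟨h1, h2, rfl⟩).trans ?_⟩
  rw [h3]
  simp only [toCP_conjVec_szokePartner h, toCP_rep]

theorem bijOn_szoke : Set.BijOn (szoke : TCP n → CP n × CP n) Set.univ (stenzelDomain n) :=
  ⟨fun τ _ => szoke_mem_stenzelDomain τ, szoke_injective.injOn, surjOn_szoke⟩

end

/-! ### Szőke's map is a diffeomorphism onto its image -/

section
variable {n : ℕ}

theorem contDiffAt_szokeHat {q : HomVec n × HomVec n} (hq : q.1 ≠ 0) :
    ContDiffAt ℝ ∞ (fun q : HomVec n × HomVec n => szokeHat q.1 q.2) q := by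
  have hs : ContDiffAt ℝ ∞ (fun q : HomVec n × HomVec n => ‖q.2‖ ^ 2 / ‖q.1‖ ^ 2) q :=
    (contDiff_snd.norm_sq ℂ).contDiffAt.div (contDiff_fst.norm_sq ℂ).contDiffAt
      (pow_ne_zero 2 (norm_ne_zero_iff.2 hq))
  have hof : ContDiff ℝ ∞ (fun x : ℝ => (x : ℂ)) := Complex.ofRealCLM.contDiff
  have hC := hof.contDiffAt.comp q ((contDiff_coshSqrt.of_le le_top).contDiffAt.comp q hs)
  have hS := hof.contDiffAt.comp q ((contDiff_sinhcSqrt.of_le le_top).contDiffAt.comp q hs)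
  have h1 := hC.smul (contDiffAt_fst (𝕜 := ℝ) (p := q))
  have h2 := (contDiffAt_const (c := Complex.I).mul hS).smul (contDiffAt_snd (𝕜 := ℝ) (p := q))
  refine ((h1.add h2).prodMk
    ((contDiff_conjVec.of_le le_top).contDiffAt.comp q (h1.sub h2))).congr_of_eventuallyEq ?_
  filter_upwards [(isOpen_ne.preimage continuous_fst).mem_nhds hq] with p hp
  exact szokeHat_eq hp p.2 rfl

section manifold
variable {E H N : Type*} [NormedAddCommGroup E] [NormedSpace ℝ E] [TopologicalSpace H]
  {I : ModelWithCorners ℝ E H} [TopologicalSpace N] [ChartedSpace H N]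

theorem contMDiffAt_comp_two {V W X : Type*} [NormedAddCommGroup V] [NormedSpace ℝ V]
    [NormedAddCommGroup W] [NormedSpace ℝ W] [NormedAddCommGroup X] [NormedSpace ℝ X]
    {g : V → W → X} {f₁ : N → V} {f₂ : N → W} {x : N}
    (hg : ContDiffAt ℝ ∞ (fun q : V × W => g q.1 q.2) (f₁ x, f₂ x))
    (h₁ : ContMDiffAt I 𝓘(ℝ, V) ∞ f₁ x) (h₂ : ContMDiffAt I 𝓘(ℝ, W) ∞ f₂ x) :
    ContMDiffAt I 𝓘(ℝ, X) ∞ (fun y => g (f₁ y) (f₂ y)) x :=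
  ContMDiffAt.comp (g := fun q : V × W => g q.1 q.2) (I' := 𝓘(ℝ, V × W)) x hg.contMDiffAt
    (h₁.prodMk_space h₂)

theorem ContMDiffAt.toCP_comp {f : N → HomVec n} {x : N}
    (hf : ContMDiffAt I 𝓘(ℝ, HomVec n) ∞ f x) (h0 : f x ≠ 0) :
    ContMDiffAt I 𝓘(ℝ, Aff n) ∞ (fun y => toCP (f y)) x :=
  ((contMDiffAt_toCP h0).of_le le_top).comp x hf

theorem ContMDiffAt.tangentMap_toCP_comp {f g : N → HomVec n} {x : N}
    (hf : ContMDiffAt I 𝓘(ℝ, HomVec n) ∞ f x) (hg : ContMDiffAt I 𝓘(ℝ, HomVec n) ∞ g x)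
    (h0 : f x ≠ 0) :
    ContMDiffAt I 𝓘(ℝ, Aff n).tangent ∞
      (fun y => tangentMap 𝓘(ℝ, HomVec n) 𝓘(ℝ, Aff n) toCP
        (⟨f y, g y⟩ : TangentBundle 𝓘(ℝ, HomVec n) (HomVec n))) x := by
  have ho : IsOpen {v : HomVec n | v ≠ 0} := isOpen_ne
  have hop : IsOpen {τ : TangentBundle 𝓘(ℝ, HomVec n) (HomVec n) | τ.proj ≠ 0} :=
    ho.preimage (FiberBundle.continuous_proj _ _)
  have h1 : ContMDiffAt 𝓘(ℝ, HomVec n).tangent 𝓘(ℝ, Aff n).tangent ∞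
      (tangentMap 𝓘(ℝ, HomVec n) 𝓘(ℝ, Aff n) toCP) ⟨f x, g x⟩ := by
    have h := ((contMDiffOn_toCP n).contMDiffOn_tangentMapWithin (m := ∞)
      le_top ho.uniqueMDiffOn).contMDiffAt (x := ⟨f x, g x⟩) (hop.mem_nhds h0)
    refine h.congr_of_eventuallyEq ?_
    filter_upwards [hop.mem_nhds (x := ⟨f x, g x⟩) h0] with σ hσ
    exact (tangentMapWithin_eq_tangentMap (ho.uniqueMDiffOn σ.proj hσ)
      ((contMDiffAt_toCP hσ).mdifferentiableAt (by simp))).symm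
  have h2 : ContMDiffAt I 𝓘(ℝ, HomVec n).tangent ∞
      (fun y => (⟨f y, g y⟩ : TangentBundle 𝓘(ℝ, HomVec n) (HomVec n))) x := by
    have h := contMDiff_tangentBundleModelSpaceHomeomorph_symm (I := 𝓘(ℝ, HomVec n)) (n := ∞)
    have h' := hf.prodMk hg
    rw [chartedSpaceSelf_prod] at h'
    exact h.contMDiffAt.comp x h'
  exact h1.comp x h2

theorem ContMDiffAt.affineSection_comp {f : N → CP n} {x : N} {i : Fin (n + 1)}
    (hf : ContMDiffAt I 𝓘(ℝ, Aff n) ∞ f x) (hi : f x ∈ affineDomain i) :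
    ContMDiffAt I 𝓘(ℝ, HomVec n) ∞ (fun y => affineSection i (f y)) x :=
  ((contMDiffAt_affineSection hi).of_le le_top).comp x hf

end manifold

theorem contMDiffAt_affineSection_proj {i : Fin (n + 1)} {τ : TCP n}
    (hτ : τ.proj ∈ affineDomain i) :
    ContMDiffAt 𝓘(ℝ, Aff n).tangent 𝓘(ℝ, HomVec n) ∞
      (fun τ : TCP n => affineSection i τ.proj) τ :=
  ContMDiffAt.affineSection_comp
    (Bundle.contMDiff_proj (TangentSpace 𝓘(ℝ, Aff n) : CP n → Type)).contMDiffAt hτ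

theorem isOpen_proj_mem_affineDomain (i : Fin (n + 1)) :
    IsOpen {τ : TCP n | τ.proj ∈ affineDomain i} :=
  (isOpen_affineDomain i).preimage (FiberBundle.continuous_proj _ _)

/-- Over the `i`-th affine domain, `szoke` is computed from the smooth lift `affineLift i`. -/
theorem contMDiffAt_szokeHat_affineLift {i : Fin (n + 1)} {τ : TCP n}
    (hτ : τ.proj ∈ affineDomain i) :
    ContMDiffAt 𝓘(ℝ, Aff n).tangent 𝓘(ℝ, HomVec n × HomVec n) ∞
      (fun τ : TCP n => szokeHat (affineSection i τ.proj) (affineLift i τ)) τ :=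
  contMDiffAt_comp_two (contDiffAt_szokeHat (q := (affineSection i τ.proj, affineLift i τ))
      (affineSection_ne_zero i τ.proj))
    (contMDiffAt_affineSection_proj hτ) (contMDiffAt_affineLift hτ)

theorem contMDiff_szoke :
    ContMDiff 𝓘(ℝ, Aff n).tangent (𝓘(ℝ, Aff n).prod 𝓘(ℝ, Aff n)) ∞
      (szoke : TCP n → CP n × CP n) := by
  intro τ
  obtain ⟨i, hi⟩ := exists_mem_affineDomain τ.proj
  have h := contMDiffAt_szokeHat_affineLift hi
  have hl := isHorizontalLift_affineLift hi
  have h1 : ContMDiffAt 𝓘(ℝ, Aff n).tangent 𝓘(ℝ, HomVec n) ∞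
      (fun τ : TCP n => (szokeHat (affineSection i τ.proj) (affineLift i τ)).1) τ :=
    contDiff_fst.contMDiff.contMDiffAt.comp τ h
  have h2 : ContMDiffAt 𝓘(ℝ, Aff n).tangent 𝓘(ℝ, HomVec n) ∞
      (fun τ : TCP n => (szokeHat (affineSection i τ.proj) (affineLift i τ)).2) τ :=
    contDiff_snd.contMDiff.contMDiffAt.comp τ h
  refine ((ContMDiffAt.toCP_comp h1 (szokeHat_fst_ne_zero hl.1 hl.2.1)).prodMk
    (ContMDiffAt.toCP_comp h2 (szokeHat_snd_ne_zero hl.1 hl.2.1))).congr_of_eventuallyEq ?_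
  filter_upwards [(isOpen_proj_mem_affineDomain i).mem_nhds hi] with σ hσ
  exact szoke_eq (isHorizontalLift_affineLift hσ)

/-- `Function.invFun` needs a default value. -/
instance : Nonempty (TCP n) := ⟨⟨toCP 0, 0⟩⟩

/-- The inverse of Szőke's map on `stenzelDomain n`; its values elsewhere are arbitrary. -/
noncomputable def szokeInv : CP n × CP n → TCP n := Function.invFun szoke

theorem szokeInv_szoke (τ : TCP n) : szokeInv (szoke τ) = τ :=
  Function.leftInverse_invFun szoke_injective τ

theorem szokeInv_eq {q : CP n × CP n} {τ : TCP n} (h : szoke τ = q) : szokeInv q = τ := by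
  rw [← h, szokeInv_szoke]

theorem mem_stenzelDomain_iff_affineSection {q : CP n × CP n} {i j : Fin (n + 1)}
    (hi : q.1 ∈ affineDomain i) (hj : q.2 ∈ affineDomain j) :
    q ∈ stenzelDomain n ↔ inner ℂ (conjVec (affineSection j q.2)) (affineSection i q.1) ≠ 0 := by
  rw [← sum_mul_eq_inner, ← mem_stenzelDomain_iff (affineSection_ne_zero _ _)
    (affineSection_ne_zero _ _), toCP_affineSection hi, toCP_affineSection hj]

theorem contMDiffAt_affineSection_pair {q : CP n × CP n} {i j : Fin (n + 1)}
    (hi : q.1 ∈ affineDomain i) (hj : q.2 ∈ affineDomain j) :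
    ContMDiffAt (𝓘(ℝ, Aff n).prod 𝓘(ℝ, Aff n)) 𝓘(ℝ, HomVec n × HomVec n) ∞
      (fun q : CP n × CP n => (affineSection i q.1, affineSection j q.2)) q :=
  (ContMDiffAt.affineSection_comp contMDiffAt_fst hi).prodMk_space
    (ContMDiffAt.affineSection_comp contMDiffAt_snd hj)

theorem isOpen_stenzelDomain : IsOpen (stenzelDomain n) := by
  rw [isOpen_iff_mem_nhds]
  intro q hq
  obtain ⟨i, hi⟩ := exists_mem_affineDomain q.1
  obtain ⟨j, hj⟩ := exists_mem_affineDomain q.2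
  have h0 := (mem_stenzelDomain_iff_affineSection hi hj).1 hq
  have hpair : Continuous (fun q : HomVec n × HomVec n => inner ℂ (conjVec q.2) q.1) :=
    (contDiff_conjVec.continuous.comp continuous_snd).inner continuous_fst
  have hc := hpair.continuousAt.comp (contMDiffAt_affineSection_pair hi hj).continuousAt
  filter_upwards [hc.eventually_ne h0, ((isOpen_affineDomain i).preimage continuous_fst).mem_nhds hi,
    ((isOpen_affineDomain j).preimage continuous_snd).mem_nhds hj] with p hp hpi hpj
  exact (mem_stenzelDomain_iff_affineSection hpi hpj).2 hp

theorem contMDiffAt_szokeInv {q : CP n × CP n} (hq : q ∈ stenzelDomain n) :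
    ContMDiffAt (𝓘(ℝ, Aff n).prod 𝓘(ℝ, Aff n)) 𝓘(ℝ, Aff n).tangent ∞
      (szokeInv : CP n × CP n → TCP n) q := by
  obtain ⟨i, hi⟩ := exists_mem_affineDomain q.1
  obtain ⟨j, hj⟩ := exists_mem_affineDomain q.2
  have h0 := (mem_stenzelDomain_iff_affineSection hi hj).1 hq
  have h : ContMDiffAt (𝓘(ℝ, Aff n).prod 𝓘(ℝ, Aff n)) 𝓘(ℝ, HomVec n × HomVec n) ∞
      (fun q : CP n × CP n => szokeInvHat (affineSection i q.1) (affineSection j q.2)) q :=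
    contMDiffAt_comp_two (contDiffAt_szokeInvHat h0)
      (ContMDiffAt.affineSection_comp contMDiffAt_fst hi)
      (ContMDiffAt.affineSection_comp contMDiffAt_snd hj)
  have h1 : ContMDiffAt (𝓘(ℝ, Aff n).prod 𝓘(ℝ, Aff n)) 𝓘(ℝ, HomVec n) ∞
      (fun q : CP n × CP n => (szokeInvHat (affineSection i q.1) (affineSection j q.2)).1) q :=
    contDiff_fst.contMDiff.contMDiffAt.comp q h
  have h2 : ContMDiffAt (𝓘(ℝ, Aff n).prod 𝓘(ℝ, Aff n)) 𝓘(ℝ, HomVec n) ∞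
      (fun q : CP n × CP n => (szokeInvHat (affineSection i q.1) (affineSection j q.2)).2) q :=
    contDiff_snd.contMDiff.contMDiffAt.comp q h
  refine (ContMDiffAt.tangentMap_toCP_comp h1 h2
    (szokeHat_szokeInvHat h0).1).congr_of_eventuallyEq ?_
  filter_upwards [isOpen_stenzelDomain.mem_nhds hq,
    ((isOpen_affineDomain i).preimage continuous_fst).mem_nhds hi,
    ((isOpen_affineDomain j).preimage continuous_snd).mem_nhds hj] with p hp hpi hpj
  have hp0 := (mem_stenzelDomain_iff_affineSection hpi hpj).1 hp
  obtain ⟨g1, g2, g3⟩ := szokeHat_szokeInvHat hp0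
  refine szokeInv_eq ((szoke_eq ⟨g1, g2, rfl⟩).trans ?_)
  rw [g3]
  simp only [toCP_conjVec_szokePartner hp0]
  rw [toCP_affineSection hpi, toCP_affineSection hpj]

theorem isEmbedding_szoke : Topology.IsEmbedding (szoke : TCP n → CP n × CP n) := by
  refine ⟨Topology.isInducing_iff_nhds.2 fun τ => le_antisymm ?_ ?_, szoke_injective⟩
  · exact contMDiff_szoke.continuous.continuousAt.le_comap
  · have h := (contMDiffAt_szokeInv (szoke_mem_stenzelDomain τ)).continuousAt
    intro s hs
    have h' : szokeInv ⁻¹' s ∈ nhds (szoke τ) := h (by rwa [szokeInv_szoke])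
    refine ⟨_, h', fun σ hσ => ?_⟩
    simpa [szokeInv_szoke] using hσ

theorem injective_mfderiv_szoke (τ : TCP n) :
    Function.Injective (mfderiv 𝓘(ℝ, Aff n).tangent (𝓘(ℝ, Aff n).prod 𝓘(ℝ, Aff n))
      (szoke : TCP n → CP n × CP n) τ) := by
  have h1 := (contMDiffAt_szokeInv (szoke_mem_stenzelDomain τ)).mdifferentiableAt (by simp)
  have h2 := (contMDiff_szoke.contMDiffAt (x := τ)).mdifferentiableAt (by simp)
  have h3 := mfderiv_comp τ h1 h2
  have h4 : szokeInv ∘ szoke = (id : TCP n → TCP n) := funext szokeInv_szoke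
  rw [h4, mfderiv_id] at h3
  refine Function.LeftInverse.injective (g := mfderiv (𝓘(ℝ, Aff n).prod 𝓘(ℝ, Aff n))
    𝓘(ℝ, Aff n).tangent (szokeInv : CP n × CP n → TCP n) (szoke τ)) fun v => ?_
  exact (congrArg (fun L : (Aff n × Aff n) →L[ℝ] (Aff n × Aff n) => L v) h3).symm

end

/-! ### Smooth structures from local parametrizations -/

/-- A smooth local parametrization by the vector space `E` of the image of `ι : X → Y`, around
`ι x`, together with a smooth map `coord` of the ambient manifold `Y` that restricts to its
inverse. -/
structure LocalParam {F H X Y : Type*} [NormedAddCommGroup F] [NormedSpace ℝ F]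
    [TopologicalSpace H] (I : ModelWithCorners ℝ F H) [TopologicalSpace X] [TopologicalSpace Y]
    [ChartedSpace H Y] (E : Type*) [NormedAddCommGroup E] [NormedSpace ℝ E] (ι : X → Y) (x : X) where
  /-- The open subset of `Y` on which `coord` is used. -/
  dom : Set Y
  /-- The open subset of `E` on which `param` is used. -/
  tgt : Set E
  /-- The coordinate map. -/
  coord : Y → E
  /-- The parametrization. -/
  param : E → Y
  isOpen_dom : IsOpen dom
  isOpen_tgt : IsOpen tgt
  mem_dom : ι x ∈ dom
  smooth_coord : ContMDiffOn I 𝓘(ℝ, E) ∞ coord dom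
  smooth_param : ContMDiffOn 𝓘(ℝ, E) I ∞ param tgt
  param_mem_range : ∀ t ∈ tgt, param t ∈ Set.range ι
  param_mem_dom : ∀ t ∈ tgt, param t ∈ dom
  coord_param : ∀ t ∈ tgt, coord (param t) = t
  coord_mem : ∀ y, ι y ∈ dom → coord (ι y) ∈ tgt
  param_coord : ∀ y, ι y ∈ dom → param (coord (ι y)) = ι y

section
variable {F H X Y : Type*} [NormedAddCommGroup F] [NormedSpace ℝ F]
    [TopologicalSpace H] {I : ModelWithCorners ℝ F H} [TopologicalSpace X] [TopologicalSpace Y]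
    [ChartedSpace H Y] {E : Type*} [NormedAddCommGroup E] [NormedSpace ℝ E] {ι : X → Y}

namespace LocalParam

theorem apply_invFun {x : X} (P : LocalParam I E ι x) [Nonempty X] {t : E} (ht : t ∈ P.tgt) :
    ι (Function.invFun ι (P.param t)) = P.param t :=
  Function.invFun_eq (P.param_mem_range t ht)

/-- The chart of `X` given by a local parametrization of an embedding `ι : X → Y`. -/
noncomputable def chart {x : X} (P : LocalParam I E ι x) (hι : Topology.IsEmbedding ι) :
    OpenPartialHomeomorph X E where
  toFun y := P.coord (ι y)
  invFun t := haveI : Nonempty X := ⟨x⟩; Function.invFun ι (P.param t)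
  source := ι ⁻¹' P.dom
  target := P.tgt
  map_source' y hy := P.coord_mem y hy
  map_target' t ht := by
    have : Nonempty X := ⟨x⟩
    change ι _ ∈ P.dom
    rw [P.apply_invFun ht]
    exact P.param_mem_dom t ht
  left_inv' y hy := by
    have : Nonempty X := ⟨x⟩
    rw [P.param_coord y hy]
    exact Function.leftInverse_invFun hι.injective y
  right_inv' t ht := by
    have : Nonempty X := ⟨x⟩
    rw [P.apply_invFun ht, P.coord_param t ht]
  open_source := P.isOpen_dom.preimage hι.continuous
  open_target := P.isOpen_tgt
  continuousOn_toFun :=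
    P.smooth_coord.continuousOn.comp hι.continuous.continuousOn fun _ h => h
  continuousOn_invFun := by
    have : Nonempty X := ⟨x⟩
    rw [hι.isInducing.continuousOn_iff]
    exact P.smooth_param.continuousOn.congr fun t ht => P.apply_invFun ht

theorem apply_chart_symm {x : X} (P : LocalParam I E ι x) (hι : Topology.IsEmbedding ι) {t : E}
    (ht : t ∈ P.tgt) : ι ((P.chart hι).symm t) = P.param t :=
  have : Nonempty X := ⟨x⟩
  P.apply_invFun ht

end LocalParam

/-- The charted space structure on `X` given by local parametrizations of an embedding around every
point. -/
@[reducible] noncomputable def chartedSpaceOfLocalParam (P : ∀ x, LocalParam I E ι x)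
    (hι : Topology.IsEmbedding ι) : ChartedSpace E X where
  atlas := Set.range fun x => (P x).chart hι
  chartAt x := (P x).chart hι
  mem_chart_source x := (P x).mem_dom
  chart_mem_atlas x := Set.mem_range_self x

theorem isManifold_of_localParam (P : ∀ x, LocalParam I E ι x) (hι : Topology.IsEmbedding ι) :
    letI := chartedSpaceOfLocalParam P hι
    IsManifold 𝓘(ℝ, E) ∞ X := by
  let := chartedSpaceOfLocalParam P hι
  refine isManifold_of_contDiffOn _ _ _ ?_
  rintro _ _ ⟨x, rfl⟩ ⟨y, rfl⟩
  have key : ContDiffOn ℝ ∞ (((P x).chart hι).symm.trans ((P y).chart hι) : E → E)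
      (((P x).chart hι).symm.trans ((P y).chart hι)).source := by
    have hsub : ∀ t ∈ (((P x).chart hι).symm.trans ((P y).chart hι)).source,
        t ∈ (P x).tgt ∧ (P x).param t ∈ (P y).dom := by
      rintro t ⟨h1, h2⟩
      refine ⟨h1, ?_⟩
      have h3 : ι (((P x).chart hι).symm t) ∈ (P y).dom := h2
      rwa [(P x).apply_chart_symm hι h1] at h3
    rw [← contMDiffOn_iff_contDiffOn]
    refine (((P y).smooth_coord.comp ((P x).smooth_param.mono fun t ht => (hsub t ht).1)
      fun t ht => (hsub t ht).2)).congr fun t ht => ?_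
    exact congrArg (P y).coord ((P x).apply_chart_symm hι (hsub t ht).1)
  simpa using key

theorem contMDiff_of_localParam (P : ∀ x, LocalParam I E ι x) (hι : Topology.IsEmbedding ι) :
    letI := chartedSpaceOfLocalParam P hι
    ContMDiff 𝓘(ℝ, E) I ∞ ι := by
  let := chartedSpaceOfLocalParam P hι
  have := isManifold_of_localParam P hι
  intro x
  have h1 : ContMDiffAt 𝓘(ℝ, E) 𝓘(ℝ, E) ∞ (extChartAt 𝓘(ℝ, E) x) x := contMDiffAt_extChartAt
  have hx : extChartAt 𝓘(ℝ, E) x x ∈ (P x).tgt := (P x).coord_mem x (P x).mem_dom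
  have h2 := ((P x).smooth_param.contMDiffAt ((P x).isOpen_tgt.mem_nhds hx)).comp x h1
  refine h2.congr_of_eventuallyEq ?_
  filter_upwards [((P x).isOpen_dom.preimage hι.continuous).mem_nhds (P x).mem_dom] with y hy
  exact ((P x).param_coord y hy).symm

/-- The inclusion has the smooth local left inverse `chart⁻¹ ∘ coord`. -/
theorem injective_mfderiv_of_localParam (P : ∀ x, LocalParam I E ι x)
    (hι : Topology.IsEmbedding ι) (x : X) :
    letI := chartedSpaceOfLocalParam P hι
    Function.Injective (mfderiv 𝓘(ℝ, E) I ι x) := by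
  let := chartedSpaceOfLocalParam P hι
  have := isManifold_of_localParam P hι
  have hx : (P x).coord (ι x) ∈ (P x).tgt := (P x).coord_mem x (P x).mem_dom
  have h1 : ContMDiffAt I 𝓘(ℝ, E) ∞ (P x).coord (ι x) :=
    (P x).smooth_coord.contMDiffAt ((P x).isOpen_dom.mem_nhds (P x).mem_dom)
  have h2 : ContMDiffAt 𝓘(ℝ, E) 𝓘(ℝ, E) ∞ (extChartAt 𝓘(ℝ, E) x).symm ((P x).coord (ι x)) := by
    refine (contMDiffOn_extChartAt_symm x).contMDiffAt ?_
    exact extChartAt_target_mem_nhds (I := 𝓘(ℝ, E)) x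
  have h3 := h2.comp (ι x) h1
  have h4 := mfderiv_comp x (h3.mdifferentiableAt (by simp))
    ((contMDiff_of_localParam P hι x).mdifferentiableAt (by simp))
  have h5 : ((extChartAt 𝓘(ℝ, E) x).symm ∘ (P x).coord) ∘ ι =ᶠ[nhds x] id := by
    filter_upwards [((P x).isOpen_dom.preimage hι.continuous).mem_nhds (P x).mem_dom] with y hy
    exact ((P x).chart hι).left_inv hy
  have h6 := h5.mfderiv_eq (I := 𝓘(ℝ, E)) (I' := 𝓘(ℝ, E))
  refine Function.LeftInverse.injective (g := mfderiv I 𝓘(ℝ, E)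
    ((extChartAt 𝓘(ℝ, E) x).symm ∘ (P x).coord) (ι x)) fun v => ?_
  have h7 := congrArg (fun L : E →L[ℝ] E => L v) (h4.symm.trans h6)
  refine h7.trans ?_
  simp only [mfderiv_id]
  rfl

end

/-! ### Kernels of smooth families of surjective linear maps -/

/-- The kernels of a smooth family of surjective linear maps are parametrized smoothly by a fixed
vector space `W`; the inverse parametrization is the restriction of a fixed linear map `p`. -/
theorem exists_smooth_kernel_param {P V D W : Type*} [NormedAddCommGroup P] [NormedSpace ℝ P]
    [NormedAddCommGroup V] [NormedSpace ℝ V] [FiniteDimensional ℝ V]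
    [NormedAddCommGroup D] [NormedSpace ℝ D] [FiniteDimensional ℝ D]
    [NormedAddCommGroup W] [NormedSpace ℝ W] [FiniteDimensional ℝ W]
    (hdim : Module.finrank ℝ D + Module.finrank ℝ W = Module.finrank ℝ V)
    {A : P → V →L[ℝ] D} {O : Set P} (hO : IsOpen O) (hA : ContDiffOn ℝ ∞ A O) {u₀ : P}
    (hu₀ : u₀ ∈ O) (hsurj : Function.Surjective (A u₀)) :
    ∃ (p : V →L[ℝ] W) (O' : Set P) (G : P → W →L[ℝ] V), IsOpen O' ∧ u₀ ∈ O' ∧ O' ⊆ O ∧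
      ContDiffOn ℝ ∞ G O' ∧ ∀ u ∈ O', (∀ κ, A u (G u κ) = 0) ∧ (∀ κ, p (G u κ) = κ) ∧
        ∀ v, A u v = 0 → G u (p v) = v := by
  have hker : Module.finrank ℝ (LinearMap.ker (A u₀ : V →ₗ[ℝ] D)) = Module.finrank ℝ W := by
    have h1 := (A u₀ : V →ₗ[ℝ] D).finrank_range_add_finrank_ker
    rw [LinearMap.range_eq_top.2 hsurj, finrank_top] at h1
    omega
  obtain ⟨q, hq⟩ := (LinearMap.ker (A u₀ : V →ₗ[ℝ] D)).subtype.exists_leftInverse_of_injective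
    (Submodule.ker_subtype _)
  let e := LinearEquiv.ofFinrankEq _ _ hker
  let p : V →L[ℝ] W := LinearMap.toContinuousLinearMap (e.toLinearMap ∘ₗ q)
  have hp : ∀ v, A u₀ v = 0 → p v = 0 → v = 0 := by
    intro v hv hpv
    have h1 : q v = ⟨v, hv⟩ := LinearMap.congr_fun hq ⟨v, hv⟩
    have h2 : e (q v) = 0 := hpv
    rw [h1, e.map_eq_zero_iff] at h2
    exact congrArg Subtype.val h2
  -- Completed by a projection `p` onto the kernel at `u₀`, `A u` becomes invertible for `u` near `u₀`;
  -- its kernel is then the image of `0 × W` under the inverse.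
  let B : P → V →L[ℝ] D × W := fun u => (A u).prod p
  have hB0 : ∃ b : V ≃L[ℝ] D × W, (b : V →L[ℝ] D × W) = B u₀ := by
    have hinj : Function.Injective (B u₀ : V →ₗ[ℝ] D × W) := by
      rw [injective_iff_map_eq_zero]
      intro v hv
      exact hp v (congrArg Prod.fst hv) (congrArg Prod.snd hv)
    refine ⟨(LinearMap.linearEquivOfInjective _ hinj
      (by rw [Module.finrank_prod, hdim])).toContinuousLinearEquiv, ?_⟩
    ext v <;> rfl
  have hBs : ContDiffOn ℝ ∞ B O := by
    have h : B = fun u => (ContinuousLinearMap.inl ℝ D W).comp (A u) +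
        (ContinuousLinearMap.inr ℝ D W).comp p := by
      funext u
      ext v <;> simp [B]
    rw [h]
    exact (contDiffOn_const.clm_comp hA).add contDiffOn_const
  let R : Set (V →L[ℝ] D × W) := Set.range ((↑) : (V ≃L[ℝ] D × W) → V →L[ℝ] D × W)
  have hR : IsOpen R := ContinuousLinearEquiv.isOpen
  refine ⟨p, O ∩ B ⁻¹' R, fun u => (B u).inverse.comp (ContinuousLinearMap.inr ℝ D W),
    hBs.continuousOn.isOpen_inter_preimage hO hR, ⟨hu₀, hB0⟩, Set.inter_subset_left, ?_, ?_⟩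
  · refine ContDiffOn.clm_comp ?_ contDiffOn_const
    rintro u ⟨hu, b, hb⟩
    have h1 : ContDiffAt ℝ ∞ ContinuousLinearMap.inverse (B u) := by
      rw [← hb]
      exact contDiffAt_map_inverse b
    exact h1.comp_contDiffWithinAt u ((hBs u hu).mono Set.inter_subset_left)
  · rintro u ⟨hu, b, hb⟩
    have hbv : ∀ v, b v = (A u v, p v) := fun v => congrArg (fun L : V →L[ℝ] D × W => L v) hb
    have hG : ∀ κ, (B u).inverse.comp (ContinuousLinearMap.inr ℝ D W) κ = b.symm (0, κ) := by
      intro κ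
      rw [← hb, ContinuousLinearMap.inverse_equiv]
      rfl
    have h3 : ∀ κ, (A u (b.symm (0, κ)), p (b.symm (0, κ))) = (0, κ) := fun κ => by
      rw [← hbv, b.apply_symm_apply]
    refine ⟨fun κ => ?_, fun κ => ?_, fun v hv => ?_⟩
    · rw [hG]; exact congrArg Prod.fst (h3 κ)
    · rw [hG]; exact congrArg Prod.snd (h3 κ)
    · rw [hG, b.symm_apply_eq, hbv, hv]

/-- The pairings with the vectors `T d`, as a linear map of the vector paired. -/
noncomputable def pairing {V D : Type*} [NormedAddCommGroup V] [InnerProductSpace ℝ V]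
    [NormedAddCommGroup D] [NormedSpace ℝ D] (T : D →L[ℝ] V) : V →L[ℝ] (D →L[ℝ] ℝ) :=
  ((ContinuousLinearMap.compL ℝ D V ℝ).flip T).comp
    (isBoundedBilinearMap_inner (𝕜 := ℝ) (E := V)).toContinuousLinearMap

theorem pairing_apply {V D : Type*} [NormedAddCommGroup V] [InnerProductSpace ℝ V]
    [NormedAddCommGroup D] [NormedSpace ℝ D] (T : D →L[ℝ] V) (v : V) (d : D) :
    pairing T v d = inner ℝ v (T d) := rfl

/-- A functional on `D` extends along the injective map `T`, and is then given by a vector. -/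
theorem pairing_surjective {V D : Type*} [NormedAddCommGroup V] [InnerProductSpace ℝ V]
    [FiniteDimensional ℝ V] [NormedAddCommGroup D] [NormedSpace ℝ D] [FiniteDimensional ℝ D]
    {T : D →L[ℝ] V} (hT : Function.Injective T) : Function.Surjective (pairing T) := by
  intro f
  obtain ⟨q, hq⟩ := (T : D →ₗ[ℝ] V).exists_leftInverse_of_injective (LinearMap.ker_eq_bot.2 hT)
  have : CompleteSpace V := FiniteDimensional.complete ℝ V
  refine ⟨(InnerProductSpace.toDual ℝ V).symm (f.comp (LinearMap.toContinuousLinearMap q)), ?_⟩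
  ext d
  rw [pairing_apply, InnerProductSpace.toDual_symm_apply]
  exact congrArg f (LinearMap.congr_fun hq d)

theorem real_inner_homVec {n : ℕ} (v w : HomVec n) : inner ℝ v w = (inner ℂ v w).re := by
  simp [PiLp.inner_apply, Complex.re_sum]

/-! ### The inclusion of the normal bundle in `M × TℂP^n` -/

section
variable {n k : ℕ} {M : Type*} [TopologicalSpace M] [ChartedSpace (EuclideanSpace ℝ (Fin k)) M]
  {φ : M → CP n}

/-- The map `(x, ν) ↦ (x, ν)` of the normal bundle into `M × TℂP^n`. -/
noncomputable def normalIncl (k : ℕ) {M : Type*} [TopologicalSpace M]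
    [ChartedSpace (EuclideanSpace ℝ (Fin k)) M] (φ : M → CP n) (y : NormalBundle k φ) :
    M × TCP n :=
  Bundle.pullbackTotalSpaceEmbedding φ y.1

theorem normalIncl_snd_proj (y : NormalBundle k φ) :
    (normalIncl k φ y).2.proj = φ (normalIncl k φ y).1 := rfl

theorem isEmbedding_normalIncl : Topology.IsEmbedding (normalIncl k φ) := by
  refine ⟨(inducing_pullbackTotalSpaceEmbedding _ _ φ).comp Topology.IsInducing.subtypeVal, ?_⟩
  rintro ⟨⟨x, v⟩, hv⟩ ⟨⟨y, w⟩, hw⟩ h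
  have h1 : x = y := congrArg Prod.fst h
  subst h1
  have h2 : v = w := eq_of_heq (Bundle.TotalSpace.mk.inj (congrArg Prod.snd h)).2
  subst h2
  rfl

variable {i : Fin (n + 1)} {x : M}

theorem contMDiffAt_affineSection_comp
    (hφ : ContMDiff 𝓘(ℝ, EuclideanSpace ℝ (Fin k)) 𝓘(ℝ, Aff n) ∞ φ)
    (hx : φ x ∈ affineDomain i) :
    ContMDiffAt 𝓘(ℝ, EuclideanSpace ℝ (Fin k)) 𝓘(ℝ, HomVec n) ∞
      (fun y => affineSection i (φ y)) x :=
  ContMDiffAt.affineSection_comp hφ.contMDiffAt hx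

/-- The derivative at `x` of the lift `affineSection i ∘ φ` of `φ`. -/
noncomputable def liftDeriv (φ : M → CP n) (i : Fin (n + 1)) (x : M) :
    EuclideanSpace ℝ (Fin k) →L[ℝ] HomVec n :=
  mfderiv 𝓘(ℝ, EuclideanSpace ℝ (Fin k)) 𝓘(ℝ, HomVec n) (fun y => affineSection i (φ y)) x

/-- The derivative of `affineSection i ∘ φ` is a lift of the derivative of `φ`. -/
theorem tangentMap_toCP_mfderiv_affineSection
    (hφ : ContMDiff 𝓘(ℝ, EuclideanSpace ℝ (Fin k)) 𝓘(ℝ, Aff n) ∞ φ)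
    (hx : φ x ∈ affineDomain i)
    (w : EuclideanSpace ℝ (Fin k)) :
    tangentMap 𝓘(ℝ, HomVec n) 𝓘(ℝ, Aff n) toCP ⟨affineSection i (φ x),
      liftDeriv φ i x w⟩ =
      (⟨φ x, mfderiv 𝓘(ℝ, EuclideanSpace ℝ (Fin k)) 𝓘(ℝ, Aff n) φ x w⟩ : TCP n) := by
  have h1 : toCP ∘ (fun y => affineSection i (φ y)) =ᶠ[nhds x] φ := by
    filter_upwards [hφ.continuous.continuousAt.preimage_mem_nhds
      ((isOpen_affineDomain i).mem_nhds hx)] with y hy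
    exact toCP_affineSection hy
  have h2 := h1.mfderiv_eq (I := 𝓘(ℝ, EuclideanSpace ℝ (Fin k))) (I' := 𝓘(ℝ, Aff n))
  rw [mfderiv_comp x ((contMDiffAt_toCP (affineSection_ne_zero i _)).mdifferentiableAt (by simp))
    ((contMDiffAt_affineSection_comp hφ hx).mdifferentiableAt (by simp))] at h2
  refine Bundle.TotalSpace.ext (toCP_affineSection hx) (heq_of_eq ?_)
  exact congrArg (fun L : EuclideanSpace ℝ (Fin k) →L[ℝ] Aff n => L w) h2

/-- Orthogonality for the Fubini–Study metric, in terms of the lift of `φ` given by an affine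
chart. -/
theorem mem_normalBundle_iff
    (hφ : ContMDiff 𝓘(ℝ, EuclideanSpace ℝ (Fin k)) 𝓘(ℝ, Aff n) ∞ φ)
    (hx : φ x ∈ affineDomain i) (v : TangentSpace 𝓘(ℝ, Aff n) (φ x)) :
    (⟨x, v⟩ : Bundle.TotalSpace (Aff n) (φ *ᵖ (TangentSpace 𝓘(ℝ, Aff n) : CP n → Type))) ∈
      NormalBundle k φ ↔
    ∀ w : EuclideanSpace ℝ (Fin k), (inner ℂ (affineLift i ⟨φ x, v⟩)
      (liftDeriv φ i x w)).re = 0 := by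
  refine forall_congr' fun w => ?_
  have h := fubiniStudy_eq_of_lift (isHorizontalLift_affineLift (τ := ⟨φ x, v⟩) hx)
    (tangentMap_toCP_mfderiv_affineSection hφ hx w)
  have h0 : ‖affineSection i (φ x)‖ ^ 2 ≠ 0 :=
    pow_ne_zero 2 (norm_ne_zero_iff.2 (affineSection_ne_zero i _))
  change fubiniStudy (φ x) v _ = 0 ↔ _
  rw [h, div_eq_zero_iff]
  simp only [h0, or_false]

end

/-! ### The normal bundle as a family of orthogonal complements -/

section
variable {n k : ℕ} {M : Type*} [TopologicalSpace M] [ChartedSpace (EuclideanSpace ℝ (Fin k)) M]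
  {φ : M → CP n}

/-- The lift `affineSection i ∘ φ` of `φ`, in the chart of `M` around `x₀`. -/
noncomputable def chartSection (φ : M → CP n) (i : Fin (n + 1)) (x₀ : M)
    (u : EuclideanSpace ℝ (Fin k)) : HomVec n :=
  affineSection i (φ ((extChartAt 𝓘(ℝ, EuclideanSpace ℝ (Fin k)) x₀).symm u))

/-- The open set on which `chartSection` is used. -/
def chartSectionDomain (φ : M → CP n) (i : Fin (n + 1)) (x₀ : M) :
    Set (EuclideanSpace ℝ (Fin k)) :=
  (extChartAt 𝓘(ℝ, EuclideanSpace ℝ (Fin k)) x₀).target ∩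
    (extChartAt 𝓘(ℝ, EuclideanSpace ℝ (Fin k)) x₀).symm ⁻¹' (φ ⁻¹' affineDomain i)

/-- The map `(a, e) ↦ a ζ + dζ(e)`, for `ζ` the lift of `φ` in a chart. The fibre of the normal
bundle is the orthogonal complement of its range. -/
noncomputable def liftFrame (φ : M → CP n) (i : Fin (n + 1)) (x₀ : M)
    (u : EuclideanSpace ℝ (Fin k)) : ℂ × EuclideanSpace ℝ (Fin k) →L[ℝ] HomVec n :=
  ((ContinuousLinearMap.lsmul ℝ ℂ).flip (chartSection φ i x₀ u)).comp
      (ContinuousLinearMap.fst ℝ ℂ (EuclideanSpace ℝ (Fin k))) +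
    (fderiv ℝ (chartSection φ i x₀) u).comp
      (ContinuousLinearMap.snd ℝ ℂ (EuclideanSpace ℝ (Fin k)))

theorem liftFrame_apply (φ : M → CP n) (i : Fin (n + 1)) (x₀ : M)
    (u : EuclideanSpace ℝ (Fin k)) (d : ℂ × EuclideanSpace ℝ (Fin k)) :
    liftFrame φ i x₀ u d =
      d.1 • chartSection φ i x₀ u + fderiv ℝ (chartSection φ i x₀) u d.2 := rfl

variable {i : Fin (n + 1)} {x₀ : M} {u : EuclideanSpace ℝ (Fin k)}

theorem isOpen_chartSectionDomain
    (hφ : ContMDiff 𝓘(ℝ, EuclideanSpace ℝ (Fin k)) 𝓘(ℝ, Aff n) ∞ φ) :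
    IsOpen (chartSectionDomain φ i x₀ : Set (EuclideanSpace ℝ (Fin k))) :=
  (continuousOn_extChartAt_symm x₀).isOpen_inter_preimage (isOpen_extChartAt_target x₀)
    ((isOpen_affineDomain i).preimage hφ.continuous)

variable [IsManifold 𝓘(ℝ, EuclideanSpace ℝ (Fin k)) ∞ M]

theorem contMDiffAt_extChartAt_symm_of_mem (hu : u ∈ chartSectionDomain φ i x₀) :
    ContMDiffAt 𝓘(ℝ, EuclideanSpace ℝ (Fin k)) 𝓘(ℝ, EuclideanSpace ℝ (Fin k)) ∞
      (extChartAt 𝓘(ℝ, EuclideanSpace ℝ (Fin k)) x₀).symm u :=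
  (contMDiffOn_extChartAt_symm x₀).contMDiffAt ((isOpen_extChartAt_target x₀).mem_nhds hu.1)

theorem contDiffOn_chartSection
    (hφ : ContMDiff 𝓘(ℝ, EuclideanSpace ℝ (Fin k)) 𝓘(ℝ, Aff n) ∞ φ) :
    ContDiffOn ℝ ∞ (chartSection φ i x₀)
      (chartSectionDomain φ i x₀ : Set (EuclideanSpace ℝ (Fin k))) := by
  intro u hu
  have h := (contMDiffAt_affineSection_comp hφ hu.2).comp u (contMDiffAt_extChartAt_symm_of_mem hu)
  exact h.contDiffAt.contDiffWithinAt

/-- The range of the derivative of the lift does not depend on the chart of `M`. -/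
theorem exists_fderiv_chartSection
    (hφ : ContMDiff 𝓘(ℝ, EuclideanSpace ℝ (Fin k)) 𝓘(ℝ, Aff n) ∞ φ)
    (hu : u ∈ chartSectionDomain φ i x₀) :
    ∃ L : EuclideanSpace ℝ (Fin k) → EuclideanSpace ℝ (Fin k), Function.Bijective L ∧ L 0 = 0 ∧
      ∀ e, fderiv ℝ (chartSection φ i x₀) u e =
        liftDeriv φ i ((extChartAt 𝓘(ℝ, EuclideanSpace ℝ (Fin k)) x₀).symm u) (L e) := by
  have h1 := mfderiv_comp u
    ((contMDiffAt_affineSection_comp hφ hu.2).mdifferentiableAt (by simp))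
    ((contMDiffAt_extChartAt_symm_of_mem hu).mdifferentiableAt (by simp))
  have h2 := isInvertible_mfderivWithin_extChartAt_symm
    (I := 𝓘(ℝ, EuclideanSpace ℝ (Fin k))) hu.1
  rw [modelWithCornersSelf_coe, Set.range_id, mfderivWithin_univ] at h2
  refine ⟨mfderiv 𝓘(ℝ, EuclideanSpace ℝ (Fin k)) 𝓘(ℝ, EuclideanSpace ℝ (Fin k))
    (extChartAt 𝓘(ℝ, EuclideanSpace ℝ (Fin k)) x₀).symm u, h2.bijective, map_zero _, fun e => ?_⟩
  rw [← mfderiv_eq_fderiv]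
  exact congrArg (fun L : EuclideanSpace ℝ (Fin k) →L[ℝ] HomVec n => L e) h1

theorem contDiffOn_liftFrame
    (hφ : ContMDiff 𝓘(ℝ, EuclideanSpace ℝ (Fin k)) 𝓘(ℝ, Aff n) ∞ φ) :
    ContDiffOn ℝ ∞ (liftFrame φ i x₀)
      (chartSectionDomain φ i x₀ : Set (EuclideanSpace ℝ (Fin k))) := by
  have h := contDiffOn_chartSection (i := i) (x₀ := x₀) hφ
  have h1 : ContDiffOn ℝ ∞ (fderiv ℝ (chartSection φ i x₀)) (chartSectionDomain φ i x₀) :=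
    h.fderiv_of_isOpen (isOpen_chartSectionDomain hφ) (by simp)
  exact (((ContinuousLinearMap.contDiff _).comp_contDiffOn h).clm_comp contDiffOn_const).add
    (h1.clm_comp contDiffOn_const)

/-- If `a ζ + dζ(e) = 0`, then `dφ(e) = 0` by projecting to `ℂP^n`. -/
theorem injective_liftFrame (hφ : ContMDiff 𝓘(ℝ, EuclideanSpace ℝ (Fin k)) 𝓘(ℝ, Aff n) ∞ φ)
    (himm : ∀ x, Function.Injective
      (mfderiv 𝓘(ℝ, EuclideanSpace ℝ (Fin k)) 𝓘(ℝ, Aff n) φ x))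
    (hu : u ∈ chartSectionDomain φ i x₀) : Function.Injective (liftFrame φ i x₀ u) := by
  rw [injective_iff_map_eq_zero]
  rintro ⟨a, e⟩ h
  rw [liftFrame_apply] at h
  obtain ⟨L, hL, hL0, hLe⟩ := exists_fderiv_chartSection hφ hu
  simp only at h
  rw [hLe] at h
  set x := (extChartAt 𝓘(ℝ, EuclideanSpace ℝ (Fin k)) x₀).symm u with hx
  have h0 := affineSection_ne_zero i (φ x)
  have h1 := tangentMap_toCP_mfderiv_affineSection hφ (show φ x ∈ affineDomain i from hu.2) (L e)
  set η : HomVec n := liftDeriv φ i x (L e) with hη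
  have h2 : η = (0 : HomVec n) - a • affineSection i (φ x) := by
    rw [zero_sub, eq_neg_iff_add_eq_zero, add_comm]
    exact h
  have h3 : mfderiv 𝓘(ℝ, HomVec n) 𝓘(ℝ, Aff n) toCP (affineSection i (φ x)) η = 0 := by
    rw [h2, mfderiv_toCP_sub_smul h0]
    exact map_zero _
  have h4 : mfderiv 𝓘(ℝ, EuclideanSpace ℝ (Fin k)) 𝓘(ℝ, Aff n) φ x (L e) = 0 := by
    have h5 : (mfderiv 𝓘(ℝ, HomVec n) 𝓘(ℝ, Aff n) toCP (affineSection i (φ x)) η : Aff n) =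
        mfderiv 𝓘(ℝ, EuclideanSpace ℝ (Fin k)) 𝓘(ℝ, Aff n) φ x (L e) :=
      eq_of_heq (Bundle.TotalSpace.mk.inj h1).2
    exact h5.symm.trans h3
  have h5 : L e = 0 := himm x (h4.trans (map_zero _).symm)
  have h6 : e = 0 := hL.1 (h5.trans hL0.symm)
  have h7 : η = 0 := by rw [hη, h5]; exact map_zero _
  rw [h7] at h2
  have h8 : a • affineSection i (φ x) = 0 := by simpa using h2.symm
  rw [(smul_eq_zero.1 h8).resolve_right h0, h6]
  rfl

/-- Real orthogonality to the complex line of `ζ` is Hermitian orthogonality, so the kernel of the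
pairing consists of the horizontal vectors normal to the image of `φ`. -/
theorem pairing_liftFrame_eq_zero_iff
    (hφ : ContMDiff 𝓘(ℝ, EuclideanSpace ℝ (Fin k)) 𝓘(ℝ, Aff n) ∞ φ)
    (hu : u ∈ chartSectionDomain φ i x₀) (ξ : HomVec n) :
    pairing (liftFrame φ i x₀ u) ξ = 0 ↔ inner ℂ (chartSection φ i x₀ u) ξ = 0 ∧
      ∀ w : EuclideanSpace ℝ (Fin k), (inner ℂ ξ
        (liftDeriv φ i ((extChartAt 𝓘(ℝ, EuclideanSpace ℝ (Fin k)) x₀).symm u) w)).re = 0 := by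
  obtain ⟨L, hL, -, hLe⟩ := exists_fderiv_chartSection hφ hu
  have key : ∀ d, pairing (liftFrame φ i x₀ u) ξ d =
      (d.1 * inner ℂ ξ (chartSection φ i x₀ u)).re + (inner ℂ ξ
        (liftDeriv φ i ((extChartAt 𝓘(ℝ, EuclideanSpace ℝ (Fin k)) x₀).symm u) (L d.2))).re := by
    intro d
    rw [pairing_apply, real_inner_homVec, liftFrame_apply, hLe, inner_add_right,
      inner_smul_right, Complex.add_re]
  constructor
  · intro h
    have h0 : ∀ d, pairing (liftFrame φ i x₀ u) ξ d = 0 := fun d => by rw [h]; rfl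
    have h1 : ∀ w : EuclideanSpace ℝ (Fin k), (inner ℂ ξ (liftDeriv φ i
        ((extChartAt 𝓘(ℝ, EuclideanSpace ℝ (Fin k)) x₀).symm u) w)).re = 0 := by
      intro w
      obtain ⟨e, rfl⟩ := hL.2 w
      have := h0 (0, e)
      rw [key] at this
      simpa using this
    refine ⟨?_, h1⟩
    rw [inner_eq_zero_symm]
    have h2 := h0 ((starRingEnd ℂ) (inner ℂ ξ (chartSection φ i x₀ u)), 0)
    rw [key, h1, add_zero, Complex.conj_mul', ← Complex.ofReal_pow, Complex.ofReal_re] at h2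
    simpa using h2
  · rintro ⟨h1, h2⟩
    refine ContinuousLinearMap.ext fun d => ?_
    rw [key, h2, inner_eq_zero_symm.1 h1]
    simp

end

/-! ### Local parametrizations of the normal bundle -/

section
variable {n k : ℕ} {M : Type*} [TopologicalSpace M] [ChartedSpace (EuclideanSpace ℝ (Fin k)) M]
  {φ : M → CP n}

theorem affineLift_eq_of_isHorizontalLift {i : Fin (n + 1)} {τ : TCP n}
    (hτ : τ.proj ∈ affineDomain i) {ξ : HomVec n}
    (h : IsHorizontalLift (affineSection i τ.proj) ξ τ) : affineLift i τ = ξ :=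
  (existsUnique_isHorizontalLift (affineSection_ne_zero i τ.proj)
    (toCP_affineSection hτ)).unique (isHorizontalLift_affineLift hτ) h

theorem le_of_immersion (x : M)
    (himm : Function.Injective (mfderiv 𝓘(ℝ, EuclideanSpace ℝ (Fin k)) 𝓘(ℝ, Aff n) φ x)) :
    k ≤ 2 * n := by
  let L : EuclideanSpace ℝ (Fin k) →L[ℝ] Aff n :=
    mfderiv 𝓘(ℝ, EuclideanSpace ℝ (Fin k)) 𝓘(ℝ, Aff n) φ x
  have h := LinearMap.finrank_le_finrank_of_injective (f := L.toLinearMap) himm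
  rw [finrank_euclideanSpace_fin, Module.finrank_pi_fintype] at h
  simpa [Complex.finrank_real_complex, mul_comm] using h

theorem mem_range_normalIncl_iff
    (hφ : ContMDiff 𝓘(ℝ, EuclideanSpace ℝ (Fin k)) 𝓘(ℝ, Aff n) ∞ φ)
    {i : Fin (n + 1)} {x : M} {τ : TCP n} (hx : φ x ∈ affineDomain i) (hτ : τ.proj = φ x) :
    (x, τ) ∈ Set.range (normalIncl k φ) ↔
      ∀ w : EuclideanSpace ℝ (Fin k), (inner ℂ (affineLift i τ) (liftDeriv φ i x w)).re = 0 := by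
  obtain ⟨p, v⟩ := τ
  change p = φ x at hτ
  subst hτ
  rw [← mem_normalBundle_iff hφ hx v]
  constructor
  · rintro ⟨⟨⟨y, w⟩, hw⟩, h⟩
    have h1 : y = x := congrArg Prod.fst h
    subst h1
    have h2 : w = v := eq_of_heq (Bundle.TotalSpace.mk.inj (congrArg Prod.snd h)).2
    subst h2
    exact hw
  · intro h
    exact ⟨⟨_, h⟩, rfl⟩

/-- In a chart `c` of `M` and an affine chart of `ℂP^n`, the point `(x, τ)` of the normal bundle has the
coordinates `c x` and those of `affineLift i τ` in the kernel of the pairing with `liftFrame`. -/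
theorem nonempty_localParam_normalIncl [IsManifold 𝓘(ℝ, EuclideanSpace ℝ (Fin k)) ∞ M]
    (hφ : ContMDiff 𝓘(ℝ, EuclideanSpace ℝ (Fin k)) 𝓘(ℝ, Aff n) ∞ φ)
    (himm : ∀ x, Function.Injective
      (mfderiv 𝓘(ℝ, EuclideanSpace ℝ (Fin k)) 𝓘(ℝ, Aff n) φ x)) (y : NormalBundle k φ) :
    Nonempty (LocalParam (𝓘(ℝ, EuclideanSpace ℝ (Fin k)).prod 𝓘(ℝ, Aff n).tangent)
      (EuclideanSpace ℝ (Fin (2 * n))) (normalIncl k φ) y) := by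
  obtain ⟨x₀, hx₀⟩ : ∃ x₀, x₀ = (normalIncl k φ y).1 := ⟨_, rfl⟩
  obtain ⟨i, hi⟩ := exists_mem_affineDomain (φ x₀)
  have hk : k ≤ 2 * n := le_of_immersion x₀ (himm x₀)
  set c := extChartAt 𝓘(ℝ, EuclideanSpace ℝ (Fin k)) x₀ with hc
  set u₀ := c x₀ with hu₀
  have hu₀D : u₀ ∈ chartSectionDomain φ i x₀ := by
    refine ⟨mem_extChartAt_target x₀, ?_⟩
    change φ (c.symm (c x₀)) ∈ affineDomain i
    rwa [hc, extChartAt_to_inv]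
  -- The count `(2 + k) + (2n - k) = 2 (n + 1)`; the subtraction is exact since `k ≤ 2n`.
  have hdim : Module.finrank ℝ (ℂ × EuclideanSpace ℝ (Fin k) →L[ℝ] ℝ) +
      Module.finrank ℝ (EuclideanSpace ℝ (Fin (2 * n - k))) = Module.finrank ℝ (HomVec n) := by
    have h1 : Module.finrank ℝ (ℂ × EuclideanSpace ℝ (Fin k) →L[ℝ] ℝ) =
        Module.finrank ℝ (ℂ × EuclideanSpace ℝ (Fin k)) :=
      (LinearMap.toContinuousLinearMap (𝕜 := ℝ) (E := ℂ × EuclideanSpace ℝ (Fin k))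
        (F' := ℝ)).finrank_eq.symm.trans Subspace.dual_finrank_eq
    have h2 : Module.finrank ℝ (HomVec n) = 2 * (n + 1) := by
      rw [(WithLp.linearEquiv 2 ℝ (Fin (n + 1) → ℂ)).finrank_eq, Module.finrank_pi_fintype]
      simp [Complex.finrank_real_complex, mul_comm]
    rw [h1, h2, Module.finrank_prod, Complex.finrank_real_complex, finrank_euclideanSpace_fin,
      finrank_euclideanSpace_fin]
    omega
  have hA : ContDiffOn ℝ ∞ (fun u => pairing (liftFrame φ i x₀ u)) (chartSectionDomain φ i x₀) :=
    ((ContinuousLinearMap.contDiff _).comp_contDiffOn (contDiffOn_liftFrame hφ)).clm_comp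
      contDiffOn_const
  obtain ⟨p, O, G, hO, hu₀O, hOD, hG, hGp⟩ := exists_smooth_kernel_param
    (W := EuclideanSpace ℝ (Fin (2 * n - k))) hdim (isOpen_chartSectionDomain hφ) hA hu₀D
    (pairing_surjective (injective_liftFrame hφ himm hu₀D))
  have hcoord : Nonempty ((EuclideanSpace ℝ (Fin k) × EuclideanSpace ℝ (Fin (2 * n - k))) ≃L[ℝ]
      EuclideanSpace ℝ (Fin (2 * n))) := by
    refine ⟨ContinuousLinearEquiv.ofFinrankEq ?_⟩
    rw [Module.finrank_prod, finrank_euclideanSpace_fin, finrank_euclideanSpace_fin,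
      finrank_euclideanSpace_fin]
    omega
  obtain ⟨ε⟩ := hcoord
  -- A point `(x, τ)` in the range corresponds to `ξ = affineLift i τ` in the kernel of the pairing.
  have hker : ∀ (x : M) (τ : TCP n), x ∈ c.source → c x ∈ O → τ.proj = φ x →
      ((x, τ) ∈ Set.range (normalIncl k φ) ↔
        pairing (liftFrame φ i x₀ (c x)) (affineLift i τ) = 0) := by
    intro x τ hx hxO hτ
    have h1 := hOD hxO
    have h2 : c.symm (c x) = x := c.left_inv hx
    have h3 : φ x ∈ affineDomain i := by
      have := h1.2
      rwa [Set.mem_preimage, ← hc, h2] at this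
    have h4 : chartSection φ i x₀ (c x) = affineSection i τ.proj := by
      change affineSection i (φ (c.symm (c x))) = _
      rw [h2, hτ]
    rw [pairing_liftFrame_eq_zero_iff hφ h1, ← hc, h2, mem_range_normalIncl_iff hφ h3 hτ, h4]
    exact ⟨fun h => ⟨(isHorizontalLift_affineLift (hτ ▸ h3)).2.1, h⟩, fun h => h.2⟩
  let par : EuclideanSpace ℝ (Fin k) × EuclideanSpace ℝ (Fin (2 * n - k)) → M × TCP n := fun q =>
    (c.symm q.1, tangentMap 𝓘(ℝ, HomVec n) 𝓘(ℝ, Aff n) toCP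
      ⟨chartSection φ i x₀ q.1, G q.1 q.2⟩)
  have hpar : ∀ q : EuclideanSpace ℝ (Fin k) × EuclideanSpace ℝ (Fin (2 * n - k)), q.1 ∈ O →
      (par q).1 ∈ c.source ∧ c (par q).1 = q.1 ∧ (par q).2.proj = φ (par q).1 ∧
        (par q).2.proj ∈ affineDomain i ∧ affineLift i (par q).2 = G q.1 q.2 := by
    intro q hq
    have h1 := hOD hq
    have h2 : (par q).2.proj = φ (par q).1 := toCP_affineSection h1.2
    have h3 : (par q).2.proj ∈ affineDomain i := by rw [h2]; exact h1.2
    refine ⟨c.map_target h1.1, c.right_inv h1.1, h2, h3, ?_⟩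
    refine affineLift_eq_of_isHorizontalLift h3 ?_
    rw [h2]
    exact ⟨affineSection_ne_zero _ _,
      ((pairing_liftFrame_eq_zero_iff hφ h1 _).1 ((hGp _ hq).1 q.2)).1, rfl⟩
  have hparS : ContMDiffOn 𝓘(ℝ, EuclideanSpace ℝ (Fin k) × EuclideanSpace ℝ (Fin (2 * n - k)))
      (𝓘(ℝ, EuclideanSpace ℝ (Fin k)).prod 𝓘(ℝ, Aff n).tangent) ∞ par {q | q.1 ∈ O} := by
    intro q hq
    refine ContMDiffAt.contMDiffWithinAt ?_
    have hfst : ContMDiffAt 𝓘(ℝ, EuclideanSpace ℝ (Fin k) × EuclideanSpace ℝ (Fin (2 * n - k)))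
        𝓘(ℝ, EuclideanSpace ℝ (Fin k)) ∞ Prod.fst q := contDiffAt_fst.contMDiffAt
    have h1 := (contMDiffAt_extChartAt_symm_of_mem (hOD hq)).comp q hfst
    have h2 : ContDiffAt ℝ ∞ (fun q : EuclideanSpace ℝ (Fin k) ×
        EuclideanSpace ℝ (Fin (2 * n - k)) => chartSection φ i x₀ q.1) q :=
      ((contDiffOn_chartSection hφ).contDiffAt
        ((isOpen_chartSectionDomain hφ).mem_nhds (hOD hq))).comp q contDiffAt_fst
    have h3 : ContDiffAt ℝ ∞ (fun q : EuclideanSpace ℝ (Fin k) ×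
        EuclideanSpace ℝ (Fin (2 * n - k)) => G q.1 q.2) q :=
      ((hG.contDiffAt (hO.mem_nhds hq)).comp q contDiffAt_fst).clm_apply contDiffAt_snd
    exact h1.prodMk (ContMDiffAt.tangentMap_toCP_comp h2.contMDiffAt h3.contMDiffAt
      (affineSection_ne_zero _ _))
  refine ⟨{
    dom := {q | q.1 ∈ c.source ∩ c ⁻¹' O ∧ q.2.proj ∈ affineDomain i}
    tgt := ε.symm ⁻¹' {q | q.1 ∈ O}
    coord := fun q => ε (c q.1, p (affineLift i q.2))
    param := fun t => par (ε.symm t)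
    isOpen_dom := ?_
    isOpen_tgt := ?_
    mem_dom := ?_
    smooth_coord := ?_
    smooth_param := ?_
    param_mem_range := ?_
    param_mem_dom := ?_
    coord_param := ?_
    coord_mem := ?_
    param_coord := ?_ }⟩
  · exact (((continuousOn_extChartAt x₀).isOpen_inter_preimage
      (isOpen_extChartAt_source x₀) hO).preimage continuous_fst).inter
      ((isOpen_proj_mem_affineDomain i).preimage continuous_snd)
  · exact (hO.preimage continuous_fst).preimage ε.symm.continuous
  · refine ⟨?_, ?_⟩
    · rw [← hx₀]
      exact ⟨mem_extChartAt_source x₀, hu₀O⟩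
    · rw [normalIncl_snd_proj, ← hx₀]
      exact hi
  · rintro q ⟨⟨hq1, hq2⟩, hq3⟩
    refine ContMDiffAt.contMDiffWithinAt ?_
    have h1 : ContMDiffAt (𝓘(ℝ, EuclideanSpace ℝ (Fin k)).prod 𝓘(ℝ, Aff n).tangent)
        𝓘(ℝ, EuclideanSpace ℝ (Fin k)) ∞ (fun q : M × TCP n => c q.1) q := by
      refine ContMDiffAt.comp (g := c) q (contMDiffAt_extChartAt' ?_) contMDiffAt_fst
      rwa [← extChartAt_source 𝓘(ℝ, EuclideanSpace ℝ (Fin k))]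
    have h2 : ContMDiffAt (𝓘(ℝ, EuclideanSpace ℝ (Fin k)).prod 𝓘(ℝ, Aff n).tangent)
        𝓘(ℝ, EuclideanSpace ℝ (Fin (2 * n - k))) ∞
        (fun q : M × TCP n => p (affineLift i q.2)) q :=
      p.contDiff.contMDiff.contMDiffAt.comp q ((contMDiffAt_affineLift hq3).comp q contMDiffAt_snd)
    exact ε.contDiff.contMDiff.contMDiffAt.comp q (h1.prodMk_space h2)
  · exact hparS.comp ε.symm.contDiff.contMDiff.contMDiffOn fun t ht => ht
  · intro t ht
    obtain ⟨g1, g2, g3, g4, g5⟩ := hpar _ ht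
    have h1 : c (par (ε.symm t)).1 ∈ O := by rw [g2]; exact ht
    refine (hker _ _ g1 h1 g3).2 ?_
    rw [g2, g5]
    exact (hGp _ ht).1 _
  · intro t ht
    obtain ⟨g1, g2, g3, g4, g5⟩ := hpar _ ht
    refine ⟨⟨g1, ?_⟩, g4⟩
    rw [Set.mem_preimage, g2]
    exact ht
  · intro t ht
    obtain ⟨g1, g2, g3, g4, g5⟩ := hpar _ ht
    rw [g2, g5, (hGp _ ht).2.1, Prod.mk.eta, ε.apply_symm_apply]
  · rintro z ⟨⟨h1, h2⟩, h3⟩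
    rw [Set.mem_preimage, ε.symm_apply_apply]
    exact h2
  · rintro z ⟨⟨h1, h2⟩, h3⟩
    rw [ε.symm_apply_apply]
    have h4 := (hker _ _ h1 h2 (normalIncl_snd_proj z)).1 (Set.mem_range_self z)
    have h5 := (hGp _ h2).2.2 _ h4
    have h6 : c.symm (c (normalIncl k φ z).1) = (normalIncl k φ z).1 := c.left_inv h1
    refine Prod.ext h6 ?_
    change tangentMap 𝓘(ℝ, HomVec n) 𝓘(ℝ, Aff n) toCP
      ⟨affineSection i (φ (c.symm (c (normalIncl k φ z).1))), _⟩ = _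
    rw [h5, h6]
    exact (isHorizontalLift_affineLift h3).2.2

end

/-! ### The `d^c` of the Stenzel potential in homogeneous coordinates -/

section
/-- If the one-form `d^c u` pulls back to zero under `F`, so does the two-form `i ∂ ∂̄ u = ½ d d^c u`:
exterior differentiation commutes with pullback. -/
theorem iDelDelbar_eq_zero_of_pullback {E P : Type*} [NormedAddCommGroup E] [NormedSpace ℂ E]
    [NormedAddCommGroup P] [NormedSpace ℝ P] {u : E → ℝ} {F : P → E} {t : P}
    (hu : ContDiffAt ℝ 2 u (F t)) (hF : ContDiffAt ℝ 2 F t)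
    (h : ∀ᶠ s in nhds t, ∀ e, fderiv ℝ u (F s) (Complex.I • fderiv ℝ F s e) = 0) (a b : P) :
    iDelDelbar u (F t) (fderiv ℝ F t a) (fderiv ℝ F t b) = 0 := by
  have hDu : DifferentiableAt ℝ (fderiv ℝ u) (F t) :=
    (hu.fderiv_right (m := 1) (by norm_num)).differentiableAt (by simp)
  have hDF : DifferentiableAt ℝ (fderiv ℝ F) t :=
    (hF.fderiv_right (m := 1) (by norm_num)).differentiableAt (by simp)
  have hF1 : DifferentiableAt ℝ F t := hF.differentiableAt (by simp)
  have hdc : ∀ v w, fderiv ℝ (fun y => dcForm u y w) (F t) v =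
      -(fderiv ℝ (fderiv ℝ u) (F t) v (Complex.I • w)) := by
    intro v w
    have h1 : HasFDerivAt (fun y => fderiv ℝ u y (Complex.I • w)) _ (F t) :=
      hDu.hasFDerivAt.clm_apply (hasFDerivAt_const (Complex.I • w) (F t))
    have h2 := h1.neg.fderiv
    change fderiv ℝ (fun y => -(fderiv ℝ u y (Complex.I • w))) (F t) v = _
    rw [show (fun y => -(fderiv ℝ u y (Complex.I • w))) =
      -(fun y => fderiv ℝ u y (Complex.I • w)) from rfl, h2]
    simp
  let J : E →L[ℝ] E := (Complex.I • ContinuousLinearMap.id ℂ E).restrictScalars ℝ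
  have hJ : ∀ v, J v = Complex.I • v := fun v => rfl
  -- Differentiating the hypothesis in the direction `v`, for a fixed `e = w`.
  have key : ∀ v w, fderiv ℝ (fderiv ℝ u) (F t) (fderiv ℝ F t v) (Complex.I • fderiv ℝ F t w) =
      -(fderiv ℝ u (F t) (Complex.I • fderiv ℝ (fderiv ℝ F) t v w)) := by
    intro v w
    have h1 : HasFDerivAt (fun s => fderiv ℝ u (F s)) _ t :=
      hDu.hasFDerivAt.comp t hF1.hasFDerivAt
    have h2 : HasFDerivAt (fun s => J (fderiv ℝ F s w)) _ t :=
      J.hasFDerivAt.comp t (hDF.hasFDerivAt.clm_apply (hasFDerivAt_const w t))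
    have h3 := h1.clm_apply h2
    have h4 : (fun s => fderiv ℝ u (F s) (J (fderiv ℝ F s w))) =ᶠ[nhds t] fun _ => 0 := by
      filter_upwards [h] with s hs
      exact hs w
    have h5 := (h3.congr_of_eventuallyEq h4.symm).unique (hasFDerivAt_const (0 : ℝ) t)
    have h6 := congrArg (fun L : P →L[ℝ] ℝ => L v) h5
    simp [hJ] at h6
    linarith
  have hsymm : fderiv ℝ (fderiv ℝ F) t a b = fderiv ℝ (fderiv ℝ F) t b a :=
    (hF.isSymmSndFDerivAt (by simp)).eq a b
  rw [iDelDelbar, hdc, hdc, key, key, hsymm]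
  ring

variable {n : ℕ}

/-- The potential in homogeneous coordinates. -/
noncomputable def potentialHom (q : HomVec n × HomVec n) : ℝ := 2 * √(exhaustionHom q.1 q.2)

theorem exhaustionHom_eq (z w : HomVec n) :
    exhaustionHom z w = ‖z‖ ^ 2 * ‖w‖ ^ 2 / ‖inner ℂ (conjVec w) z‖ ^ 2 := by
  rw [exhaustionHom, sum_mul_eq_inner, EuclideanSpace.norm_sq_eq, EuclideanSpace.norm_sq_eq,
    Finset.sum_mul_sum]
  simp only [norm_mul, mul_pow]

theorem exhaustionHom_pos {z w : HomVec n} (h : inner ℂ (conjVec w) z ≠ 0) :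
    0 < exhaustionHom z w := by
  have hz := norm_pos_iff.2 (ne_zero_of_inner_conjVec h).1
  have hw := norm_pos_iff.2 (ne_zero_of_inner_conjVec h).2
  have hp := norm_pos_iff.2 h
  rw [exhaustionHom_eq]
  positivity

theorem contDiffAt_potentialHom {q : HomVec n × HomVec n} (h : inner ℂ (conjVec q.2) q.1 ≠ 0) :
    ContDiffAt ℝ ∞ potentialHom q := by
  have hpair : ContDiff ℝ ∞ (fun q : HomVec n × HomVec n => inner ℂ (conjVec q.2) q.1) :=
    ((contDiff_conjVec.of_le le_top).comp contDiff_snd).inner ℂ contDiff_fst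
  have h1 : ContDiffAt ℝ ∞ (fun q : HomVec n × HomVec n =>
      ‖q.1‖ ^ 2 * ‖q.2‖ ^ 2 / ‖inner ℂ (conjVec q.2) q.1‖ ^ 2) q :=
    (((contDiff_fst.norm_sq ℂ).mul (contDiff_snd.norm_sq ℂ)).contDiffAt).div
      (hpair.norm_sq ℂ).contDiffAt (pow_ne_zero 2 (norm_ne_zero_iff.2 h))
  have h2 : ContDiffAt ℝ ∞ (fun q : HomVec n × HomVec n => exhaustionHom q.1 q.2) q := by
    simpa only [exhaustionHom_eq] using h1
  exact contDiffAt_const.mul (h2.sqrt (exhaustionHom_pos h).ne')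

/-- Where `|z| = |w|`, a direction `(p, q)` that to first order preserves `|z|² + |w|²` and
`|z · w|` is critical for the potential. -/
theorem fderiv_potentialHom_eq_zero {z w p q : HomVec n} (h : inner ℂ (conjVec w) z ≠ 0)
    (hn : ‖w‖ = ‖z‖) (h1 : (inner ℂ z p).re + (inner ℂ w q).re = 0)
    (h2 : ((starRingEnd ℂ) (inner ℂ (conjVec w) z) *
      (inner ℂ (conjVec w) p + inner ℂ (conjVec q) z)).re = 0) :
    fderiv ℝ potentialHom (z, w) (p, q) = 0 := by
  -- The derivative is computed along the line `s ↦ (z + s p, w + s q)`.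
  have hline : ∀ v d : HomVec n, HasDerivAt (fun s : ℝ => v + s • d) d 0 := fun v d => by
    simpa using ((hasDerivAt_id' (0 : ℝ)).smul_const d).const_add v
  have hz := hline z p
  have hw := hline w q
  have hzn : HasDerivAt (fun s : ℝ => ‖z + s • p‖ ^ 2) (2 * (inner ℂ z p).re) 0 := by
    simpa [real_inner_homVec] using hz.norm_sq
  have hwn : HasDerivAt (fun s : ℝ => ‖w + s • q‖ ^ 2) (2 * (inner ℂ w q).re) 0 := by
    simpa [real_inner_homVec] using hw.norm_sq
  have hcw : HasDerivAt (fun s : ℝ => conjVec (w + s • q)) (conjVec q) 0 := by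
    have e : (fun s : ℝ => conjVec (w + s • q)) = fun s : ℝ => conjVec w + s • conjVec q := by
      funext s
      ext j
      simp
    rw [e]
    exact hline _ _
  have hpr : HasDerivAt (fun s : ℝ => inner ℂ (conjVec (w + s • q)) (z + s • p))
      (inner ℂ (conjVec w) p + inner ℂ (conjVec q) z) 0 := by
    have h3 := hcw.inner ℂ hz
    simp only [zero_smul, add_zero] at h3
    exact h3
  have hpn : HasDerivAt (fun s : ℝ => ‖inner ℂ (conjVec (w + s • q)) (z + s • p)‖ ^ 2) 0 0 := by
    have h3 := hpr.norm_sq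
    rw [Complex.inner] at h3
    simp only [zero_smul, add_zero] at h3
    rw [mul_comm (_ + _), h2, mul_zero] at h3
    exact h3
  have hN : HasDerivAt (fun s : ℝ => exhaustionHom (z + s • p) (w + s • q)) 0 0 := by
    simp only [exhaustionHom_eq]
    have h3 := (hzn.fun_mul hwn).fun_div hpn (by simpa using h)
    convert! h3 using 1
    simp only [zero_smul, add_zero, hn]
    rw [show 2 * (inner ℂ z p).re * ‖z‖ ^ 2 + ‖z‖ ^ 2 * (2 * (inner ℂ w q).re) =
      2 * ‖z‖ ^ 2 * ((inner ℂ z p).re + (inner ℂ w q).re) by ring, h1]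
    simp
  have hU : HasDerivAt (fun s : ℝ => potentialHom (z + s • p, w + s • q)) 0 0 := by
    have h3 := (hN.sqrt (by simpa using (exhaustionHom_pos h).ne')).const_mul 2
    rw [zero_div, mul_zero] at h3
    exact h3
  have hfd := ((contDiffAt_potentialHom (q := (z, w)) h).differentiableAt (by simp)).hasFDerivAt
  have hc : HasDerivAt (fun s : ℝ => (z + s • p, w + s • q)) (p, q) 0 := hz.prodMk hw
  have h4 := HasFDerivAt.comp_hasDerivAt_of_eq (0 : ℝ) hfd hc (by simp)
  exact h4.unique hU

/-- Along a horizontal curve of representatives `(ζ, ξ)` with `Re ⟨ξ, ζ'⟩ = 0`, the velocity of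
`szokeHat (ζ, ξ)`, multiplied by `i`, is annihilated by the differential of the potential. -/
theorem fderiv_potentialHom_szokeHat {ζ ξ : ℝ → HomVec n} {ζ' ξ' : HomVec n}
    (hζ : HasDerivAt ζ ζ' 0) (hξ : HasDerivAt ξ ξ' 0) (h0 : ∀ s, ζ s ≠ 0)
    (horth : ∀ᶠ s in nhds 0, inner ℂ (ζ s) (ξ s) = 0) (hre : (inner ℂ (ξ 0) ζ').re = 0)
    {v : HomVec n × HomVec n} (hv : HasDerivAt (fun s => szokeHat (ζ s) (ξ s)) v 0) :
    fderiv ℝ potentialHom (szokeHat (ζ 0) (ξ 0)) (Complex.I • v) = 0 := by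
  have hn0 : ‖ζ 0‖ ^ 2 ≠ 0 := pow_ne_zero 2 (norm_ne_zero_iff.2 (h0 0))
  let σ : ℝ → ℝ := fun s => ‖ξ s‖ ^ 2 / ‖ζ s‖ ^ 2
  have hσ : DifferentiableAt ℝ σ 0 :=
    (hξ.norm_sq.differentiableAt).div (hζ.norm_sq.differentiableAt) hn0
  have hC : DifferentiableAt ℝ (fun s => (coshSqrt (σ s) : ℂ)) 0 :=
    Complex.ofRealCLM.differentiableAt.comp (0 : ℝ)
      ((contDiff_coshSqrt.differentiable (by simp)).differentiableAt.comp (0 : ℝ) hσ)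
  have hS : DifferentiableAt ℝ (fun s => (Complex.I * sinhcSqrt (σ s) : ℂ)) 0 :=
    (differentiableAt_const _).mul (Complex.ofRealCLM.differentiableAt.comp (0 : ℝ)
      ((contDiff_sinhcSqrt.differentiable (by simp)).differentiableAt.comp (0 : ℝ) hσ))
  set C' := deriv (fun s => (coshSqrt (σ s) : ℂ)) 0
  set S' := deriv (fun s => (Complex.I * sinhcSqrt (σ s) : ℂ)) 0
  have ha : HasDerivAt (fun s => (coshSqrt (σ s) : ℂ) • ζ s)
      ((coshSqrt (σ 0) : ℂ) • ζ' + C' • ζ 0) 0 := hC.hasDerivAt.fun_smul hζ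
  have hb : HasDerivAt (fun s => (Complex.I * sinhcSqrt (σ s)) • ξ s)
      ((Complex.I * sinhcSqrt (σ 0)) • ξ' + S' • ξ 0) 0 := hS.hasDerivAt.fun_smul hξ
  set a : ℝ → HomVec n := fun s => (coshSqrt (σ s) : ℂ) • ζ s with hadef
  set b : ℝ → HomVec n := fun s => (Complex.I * sinhcSqrt (σ s)) • ξ s with hbdef
  set a' := (coshSqrt (σ 0) : ℂ) • ζ' + C' • ζ 0 with ha'
  set b' := (Complex.I * sinhcSqrt (σ 0)) • ξ' + S' • ξ 0
  have hhat : ∀ s, szokeHat (ζ s) (ξ s) = (a s + b s, conjVec (a s - b s)) := fun s =>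
    szokeHat_eq (h0 s) (ξ s) rfl
  have hab : ∀ᶠ s in nhds 0, inner ℂ (a s) (b s) = 0 := by
    filter_upwards [horth] with s hs
    exact inner_smul_smul_eq_zero hs _ _
  -- The derivative of the orthogonality relation `⟨a, b⟩ = 0`.
  have hab' : inner ℂ (a 0) b' + inner ℂ a' (b 0) = 0 := by
    have h1 := ha.inner ℂ hb
    have h2 : (fun s => inner ℂ (a s) (b s)) =ᶠ[nhds 0] fun _ => (0 : ℂ) := hab
    exact (h1.congr_of_eventuallyEq h2.symm).unique (hasDerivAt_const _ _)
  -- As `b` is a real multiple of `i ξ`, this is the hypothesis `Re ⟨ξ, ζ'⟩ = 0`.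
  have hba : (inner ℂ (b 0) a').im = 0 := by
    have h1 : inner ℂ (ξ 0) (ζ 0) = 0 := inner_eq_zero_symm.1 horth.self_of_nhds
    rw [hbdef, ha']
    simp only [inner_add_right, inner_smul_left, inner_smul_right, h1, mul_zero, add_zero, map_mul,
      Complex.conj_I, Complex.conj_ofReal]
    simp [Complex.mul_im, Complex.mul_re, hre]
  have hcv : HasDerivAt (fun s => conjVec (a s - b s)) (conjVec (a' - b')) 0 := by
    let cL : HomVec n →L[ℝ] HomVec n := LinearMap.toContinuousLinearMap
      { toFun := conjVec
        map_add' := fun x y => by ext j; simp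
        map_smul' := fun c x => by ext j; simp }
    exact cL.hasFDerivAt.comp_hasDerivAt (0 : ℝ) (ha.sub hb)
  have hv' : v = (a' + b', conjVec (a' - b')) := by
    refine hv.unique ?_
    simp only [hhat]
    exact (ha.add hb).prodMk hcv
  have hortho0 := horth.self_of_nhds
  have hpair0 : inner ℂ (conjVec (szokeHat (ζ 0) (ξ 0)).2) (szokeHat (ζ 0) (ξ 0)).1 ≠ 0 := by
    rw [← sum_mul_eq_inner, sum_szokeHat (h0 0) hortho0]
    exact_mod_cast hn0
  have hnorm0 := norm_szokeHat_snd (h0 0) hortho0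
  -- The pairing `z · w` stays real along the curve, hence so does its velocity.
  have hpair : inner ℂ (a 0 - b 0) (a' + b') + inner ℂ (a' - b') (a 0 + b 0) =
      (((2 * inner ℝ (ζ 0) ζ' : ℝ)) : ℂ) := by
    have h1 : HasDerivAt (fun s => inner ℂ (a s - b s) (a s + b s))
        (inner ℂ (a 0 - b 0) (a' + b') + inner ℂ (a' - b') (a 0 + b 0)) 0 :=
      (ha.sub hb).inner ℂ (ha.add hb)
    have h2 : HasDerivAt (fun s => ((‖ζ s‖ ^ 2 : ℝ) : ℂ)) _ 0 :=
      hζ.norm_sq.ofReal_comp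
    refine (h1.congr_of_eventuallyEq ?_).unique h2
    filter_upwards [horth] with s hs
    have h3 := sum_szokeHat (h0 s) hs
    rw [sum_mul_eq_inner, hhat] at h3
    simp only [conjVec_conjVec] at h3
    exact h3.symm
  rw [hhat] at hpair0 hnorm0
  rw [hv', hhat]
  simp only [conjVec_conjVec] at hpair0
  refine fderiv_potentialHom_eq_zero (by rwa [conjVec_conjVec]) hnorm0 ?_ ?_
  · have e1 : inner ℂ (conjVec (a 0 - b 0)) (Complex.I • conjVec (a' - b')) =
        Complex.I * inner ℂ (a' - b') (a 0 - b 0) := by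
      rw [inner_smul_right, inner_conjVec_conjVec]
    change (inner ℂ (a 0 + b 0) (Complex.I • (a' + b'))).re +
      (inner ℂ (conjVec (a 0 - b 0)) (Complex.I • conjVec (a' - b'))).re = 0
    have c1 := congrArg Complex.im (inner_conj_symm (𝕜 := ℂ) (a 0) a')
    have c2 := congrArg Complex.im (inner_conj_symm (𝕜 := ℂ) (b 0) b')
    have c3 := congrArg Complex.im (inner_conj_symm (𝕜 := ℂ) (b 0) a')
    have c4 := congrArg Complex.im (inner_conj_symm (𝕜 := ℂ) (a 0) b')
    have c5 := congrArg Complex.im hab'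
    rw [e1, inner_smul_right]
    simp only [inner_add_left, inner_add_right, inner_sub_left, inner_sub_right, Complex.mul_re,
      Complex.I_re, Complex.I_im, Complex.add_im, Complex.sub_im, Complex.conj_im,
      Complex.zero_im] at c1 c2 c3 c4 c5 ⊢
    linarith
  · have e1 : inner ℂ (conjVec (Complex.I • conjVec (a' - b'))) (a 0 + b 0) =
        Complex.I * inner ℂ (a' - b') (a 0 + b 0) := by
      rw [conjVec_smul, conjVec_conjVec, inner_smul_left, Complex.conj_conj]
    change ((starRingEnd ℂ) (inner ℂ (conjVec (conjVec (a 0 - b 0))) (a 0 + b 0)) *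
      (inner ℂ (conjVec (conjVec (a 0 - b 0))) (Complex.I • (a' + b')) +
        inner ℂ (conjVec (Complex.I • conjVec (a' - b'))) (a 0 + b 0))).re = 0
    have h3 := sum_szokeHat (h0 0) hortho0
    rw [sum_mul_eq_inner, hhat] at h3
    simp only at h3
    rw [h3, e1, conjVec_conjVec, inner_smul_right, ← mul_add, hpair, Complex.conj_ofReal,
      Complex.re_ofReal_mul, Complex.I_mul_re, Complex.ofReal_im, neg_zero, mul_zero]

end

/-! ### The Stenzel form on the normal bundle -/

section
variable {n : ℕ}

/-- The affine coordinates `z_j / z_i` on pairs of homogeneous coordinate vectors. -/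
noncomputable def affineRatio (i j : Fin (n + 1)) (q : HomVec n × HomVec n) : Aff n × Aff n :=
  (fun l => q.1 (i.succAbove l) / q.1 i, fun l => q.2 (j.succAbove l) / q.2 j)

theorem differentiableAt_affineRatio {i j : Fin (n + 1)} {q : HomVec n × HomVec n}
    (hi : q.1 i ≠ 0) (hj : q.2 j ≠ 0) : DifferentiableAt ℂ (affineRatio i j) q := by
  have h1 : ∀ l, ContDiffAt ℂ 1 (fun q : HomVec n × HomVec n => q.1 l) q := fun l =>
    ((EuclideanSpace.proj l : HomVec n →L[ℂ] ℂ).comp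
      (ContinuousLinearMap.fst ℂ (HomVec n) (HomVec n))).contDiff.contDiffAt
  have h2 : ∀ l, ContDiffAt ℂ 1 (fun q : HomVec n × HomVec n => q.2 l) q := fun l =>
    ((EuclideanSpace.proj l : HomVec n →L[ℂ] ℂ).comp
      (ContinuousLinearMap.snd ℂ (HomVec n) (HomVec n))).contDiff.contDiffAt
  have h3 : ∀ l, DifferentiableAt ℂ
      (fun q : HomVec n × HomVec n => q.1 (i.succAbove l) / q.1 i) q := fun l =>
    (ContDiffAt.div (𝕜 := ℂ) (h1 (i.succAbove l)) (h1 i) hi).differentiableAt (by simp)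
  have h4 : ∀ l, DifferentiableAt ℂ
      (fun q : HomVec n × HomVec n => q.2 (j.succAbove l) / q.2 j) q := fun l =>
    (ContDiffAt.div (𝕜 := ℂ) (h2 (j.succAbove l)) (h2 j) hj).differentiableAt (by simp)
  exact (differentiableAt_pi.2 h3).prodMk (differentiableAt_pi.2 h4)

/-- The potential in the product of the affine charts `i` and `j`. -/
noncomputable def potentialAff (i j : Fin (n + 1)) (q : Aff n × Aff n) : ℝ :=
  potentialHom (homogenize i q.1, homogenize j q.2)

theorem stenzelPotential_toCP {z w : HomVec n} (hz : z ≠ 0) (hw : w ≠ 0) :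
    stenzelPotential (toCP z, toCP w) = potentialHom (z, w) := by
  rw [stenzelPotential, exhaustion_toCP hz hw, potentialHom]

theorem stenzelPotential_comp_extChartAt_symm (q : CP n × CP n) :
    stenzelPotential ∘ (extChartAt (𝓘(ℝ, Aff n).prod 𝓘(ℝ, Aff n)) q).symm =
      potentialAff (chartIndex q.1) (chartIndex q.2) := by
  funext Q
  have h : (extChartAt (𝓘(ℝ, Aff n).prod 𝓘(ℝ, Aff n)) q).symm Q =
      (toCP (homogenize (chartIndex q.1) Q.1), toCP (homogenize (chartIndex q.2) Q.2)) := by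
    rw [toCP_of_ne_zero (homogenize_ne_zero _ _), toCP_of_ne_zero (homogenize_ne_zero _ _)]
    rfl
  rw [Function.comp_apply, h, stenzelPotential_toCP (homogenize_ne_zero _ _)
    (homogenize_ne_zero _ _), potentialAff]

theorem extChartAt_toCP (q : CP n × CP n) {z w : HomVec n} (hz : z ≠ 0) (hw : w ≠ 0) :
    extChartAt (𝓘(ℝ, Aff n).prod 𝓘(ℝ, Aff n)) q (toCP z, toCP w) =
      affineRatio (chartIndex q.1) (chartIndex q.2) (z, w) := by
  rw [toCP_of_ne_zero hz, toCP_of_ne_zero hw]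
  rfl

theorem toCP_homogenize_ratio {i : Fin (n + 1)} {z : HomVec n} (hi : z i ≠ 0) :
    toCP (homogenize i (fun l => z (i.succAbove l) / z i)) = toCP z := by
  have hz : z ≠ 0 := by rintro rfl; simp at hi
  have h := toCP_affineSection ((toCP_mem_affineDomain hz i).2 hi)
  rwa [toCP_of_ne_zero hz, affineSection, affineCoord_mk, ← toCP_of_ne_zero hz] at h

theorem inner_homogenize_ratio {i j : Fin (n + 1)} {q : HomVec n × HomVec n} (hi : q.1 i ≠ 0)
    (hj : q.2 j ≠ 0) (h : inner ℂ (conjVec q.2) q.1 ≠ 0) :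
    inner ℂ (conjVec (homogenize j (affineRatio i j q).2)) (homogenize i (affineRatio i j q).1)
      ≠ 0 := by
  obtain ⟨hz, hw⟩ := ne_zero_of_inner_conjVec h
  rw [← sum_mul_eq_inner, ← mem_stenzelDomain_iff hz hw] at h
  rw [← sum_mul_eq_inner, ← mem_stenzelDomain_iff (homogenize_ne_zero _ _)
    (homogenize_ne_zero _ _)]
  simp only [affineRatio]
  rwa [toCP_homogenize_ratio hi, toCP_homogenize_ratio hj]

theorem potentialAff_affineRatio {i j : Fin (n + 1)} {q : HomVec n × HomVec n} (hi : q.1 i ≠ 0)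
    (hj : q.2 j ≠ 0) : potentialAff i j (affineRatio i j q) = potentialHom q := by
  have hz : q.1 ≠ 0 := fun h => by simp [h] at hi
  have hw : q.2 ≠ 0 := fun h => by simp [h] at hj
  rw [potentialAff, ← stenzelPotential_toCP (homogenize_ne_zero _ _) (homogenize_ne_zero _ _)]
  simp only [affineRatio]
  rw [toCP_homogenize_ratio hi, toCP_homogenize_ratio hj, stenzelPotential_toCP hz hw]

theorem contDiffAt_potentialAff {i j : Fin (n + 1)} {q : Aff n × Aff n}
    (h : inner ℂ (conjVec (homogenize j q.2)) (homogenize i q.1) ≠ 0) :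
    ContDiffAt ℝ ∞ (potentialAff i j) q := by
  have h1 : ContDiff ℝ ∞ (fun q : Aff n × Aff n => (homogenize i q.1, homogenize j q.2)) :=
    (((contDiff_homogenize_vec i).of_le le_top).comp contDiff_fst).prodMk
      (((contDiff_homogenize_vec j).of_le le_top).comp contDiff_snd)
  exact ContDiffAt.comp q (contDiffAt_potentialHom
    (q := (homogenize i q.1, homogenize j q.2)) h) h1.contDiffAt

/-- The kernel condition for `d^c` of the potential passes from homogeneous to affine coordinates,
because `affineRatio` is holomorphic. -/
theorem fderiv_potentialAff {P : Type*} [NormedAddCommGroup P] [NormedSpace ℝ P]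
    {F : P → HomVec n × HomVec n} {t e : P} {i j : Fin (n + 1)} (hF : DifferentiableAt ℝ F t)
    (hi : (F t).1 i ≠ 0) (hj : (F t).2 j ≠ 0) (hp : inner ℂ (conjVec (F t).2) (F t).1 ≠ 0)
    (h : fderiv ℝ potentialHom (F t) (Complex.I • fderiv ℝ F t e) = 0) :
    fderiv ℝ (potentialAff i j) (affineRatio i j (F t))
      (Complex.I • fderiv ℝ (fun s => affineRatio i j (F s)) t e) = 0 := by
  have hR := (differentiableAt_affineRatio hi hj).hasFDerivAt
  have hu := ((contDiffAt_potentialAff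
    (inner_homogenize_ratio hi hj hp)).differentiableAt (by simp)).hasFDerivAt
  have h1 : HasFDerivAt (fun q => potentialAff i j (affineRatio i j q)) _ (F t) :=
    hu.comp (F t) (hR.restrictScalars ℝ)
  have h2 : (fun q => potentialAff i j (affineRatio i j q)) =ᶠ[nhds (F t)] potentialHom := by
    have c1 : Continuous fun q : HomVec n × HomVec n => q.1 i := by fun_prop
    have c2 : Continuous fun q : HomVec n × HomVec n => q.2 j := by fun_prop
    filter_upwards [c1.continuousAt.eventually_ne hi, c2.continuousAt.eventually_ne hj]
      with q hqi hqj
    exact potentialAff_affineRatio hqi hqj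
  have h3 := (h1.congr_of_eventuallyEq h2.symm).fderiv
  have h4 : HasFDerivAt (fun s => affineRatio i j (F s)) _ t :=
    (hR.restrictScalars ℝ).comp t hF.hasFDerivAt
  rw [h3] at h
  rw [h4.fderiv]
  have h5 : Complex.I • fderiv ℂ (affineRatio i j) (F t) (fderiv ℝ F t e) =
      fderiv ℂ (affineRatio i j) (F t) (Complex.I • fderiv ℝ F t e) := (map_smul _ _ _).symm
  exact (congrArg _ h5).trans h

section
variable {k : ℕ} {M : Type*} [TopologicalSpace M] [ChartedSpace (EuclideanSpace ℝ (Fin k)) M]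
  {φ : M → CP n}

/-- For a smooth family `κ` of points of the normal bundle, the horizontal representatives satisfy
the hypothesis `Re ⟨ξ, dζ⟩ = 0`, so `d^c` of the potential vanishes on the image of `szokeHat`. -/
theorem fderiv_potentialHom_normal {P : Type*} [NormedAddCommGroup P] [NormedSpace ℝ P]
    (hφ : ContMDiff 𝓘(ℝ, EuclideanSpace ℝ (Fin k)) 𝓘(ℝ, Aff n) ∞ φ)
    {κ : P → M × TCP n} (hκ : ∀ t, κ t ∈ Set.range (normalIncl k φ)) {t : P}
    (hs : ContMDiffAt 𝓘(ℝ, P) (𝓘(ℝ, EuclideanSpace ℝ (Fin k)).prod 𝓘(ℝ, Aff n).tangent) ∞ κ t)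
    {i : Fin (n + 1)} (hi : (κ t).2.proj ∈ affineDomain i) :
    ContDiffAt ℝ ∞
      (fun s => szokeHat (affineSection i (κ s).2.proj) (affineLift i (κ s).2)) t ∧
    ∀ e, fderiv ℝ potentialHom (szokeHat (affineSection i (κ t).2.proj) (affineLift i (κ t).2))
      (Complex.I • fderiv ℝ
        (fun s => szokeHat (affineSection i (κ s).2.proj) (affineLift i (κ s).2)) t e) = 0 := by
  have hκ2 : ContMDiffAt 𝓘(ℝ, P) 𝓘(ℝ, Aff n).tangent ∞ (fun s => (κ s).2) t :=
    contMDiffAt_snd.comp t hs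
  have hκ1 : ContMDiffAt 𝓘(ℝ, P) 𝓘(ℝ, EuclideanSpace ℝ (Fin k)) ∞ (fun s => (κ s).1) t :=
    contMDiffAt_fst.comp t hs
  have hproj : ∀ s, (κ s).2.proj = φ (κ s).1 := by
    intro s
    obtain ⟨y, hy⟩ := hκ s
    rw [← hy]
    rfl
  have hζ : ContDiffAt ℝ ∞ (fun s => affineSection i (κ s).2.proj) t :=
    contMDiffAt_iff_contDiffAt.1 (ContMDiffAt.comp
      (g := fun τ : TCP n => affineSection i τ.proj) t (contMDiffAt_affineSection_proj hi) hκ2)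
  have hξ : ContDiffAt ℝ ∞ (fun s => affineLift i (κ s).2) t :=
    contMDiffAt_iff_contDiffAt.1 (ContMDiffAt.comp
      (g := affineLift i) t (contMDiffAt_affineLift hi) hκ2)
  have hF : ContDiffAt ℝ ∞
      (fun s => szokeHat (affineSection i (κ s).2.proj) (affineLift i (κ s).2)) t :=
    contMDiffAt_iff_contDiffAt.1 (ContMDiffAt.comp
      (g := fun τ : TCP n => szokeHat (affineSection i τ.proj) (affineLift i τ)) t
      (contMDiffAt_szokeHat_affineLift hi) hκ2)
  refine ⟨hF, fun e => ?_⟩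
  have hline : HasDerivAt (fun r : ℝ => t + r • e) e 0 := by
    simpa using ((hasDerivAt_id' (0 : ℝ)).smul_const e).const_add t
  have hcurve : ∀ {X : Type _} [NormedAddCommGroup X] [NormedSpace ℝ X] {f : P → X},
      DifferentiableAt ℝ f t → HasDerivAt (fun r : ℝ => f (t + r • e)) (fderiv ℝ f t e) 0 :=
    fun hf => HasFDerivAt.comp_hasDerivAt_of_eq (0 : ℝ) hf.hasFDerivAt hline (by simp)
  have hζd := hζ.differentiableAt (by simp)
  have hre : (inner ℂ (affineLift i (κ t).2)
      (fderiv ℝ (fun s => affineSection i (κ s).2.proj) t e)).re = 0 := by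
    have hi' : φ (κ t).1 ∈ affineDomain i := by rw [← hproj]; exact hi
    have h1 := mfderiv_comp t ((contMDiffAt_affineSection_comp hφ hi').mdifferentiableAt (by simp))
      (hκ1.mdifferentiableAt (by simp))
    have h2 : (fun s => affineSection i (κ s).2.proj) =
        (fun y => affineSection i (φ y)) ∘ (fun s => (κ s).1) := by
      funext s
      rw [hproj]
      rfl
    rw [h2, ← mfderiv_eq_fderiv]
    have h3 := congrArg (fun L : P →L[ℝ] HomVec n => L e) h1
    exact (congrArg (fun v : HomVec n => (inner ℂ (affineLift i (κ t).2) v).re) h3).trans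
      ((mem_range_normalIncl_iff hφ hi' (hproj t)).1 (hκ t) _)
  have hcont : ContinuousAt (fun r : ℝ => (κ (t + r • e)).2) 0 := by
    have h1 : ContinuousAt (fun s => (κ s).2) (t + (0 : ℝ) • e) := by
      simpa using hκ2.continuousAt
    exact ContinuousAt.comp (f := fun r : ℝ => t + r • e) (g := fun s => (κ s).2) h1
      hline.continuousAt
  have horth : ∀ᶠ r : ℝ in nhds 0, inner ℂ (affineSection i (κ (t + r • e)).2.proj)
      (affineLift i (κ (t + r • e)).2) = 0 := by
    have h1 := hcont.preimage_mem_nhds ((isOpen_proj_mem_affineDomain i).mem_nhds (by simpa using hi))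
    filter_upwards [h1] with r hr
    exact (isHorizontalLift_affineLift hr).2.1
  have h := fderiv_potentialHom_szokeHat (hcurve hζd) (hcurve (hξ.differentiableAt (by simp)))
    (fun s => affineSection_ne_zero _ _) horth (by simpa using hre)
    (hcurve (hF.differentiableAt (by simp)))
  simpa using h

/-- The pullback of the Stenzel form by a smooth family of points of the normal bundle vanishes. -/
theorem iDelDelbar_szoke_normal {P : Type*} [NormedAddCommGroup P] [NormedSpace ℝ P]
    (hφ : ContMDiff 𝓘(ℝ, EuclideanSpace ℝ (Fin k)) 𝓘(ℝ, Aff n) ∞ φ)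
    {κ : P → M × TCP n} (hκ : ∀ t, κ t ∈ Set.range (normalIncl k φ)) {t : P}
    (hs : ∀ᶠ s in nhds t, ContMDiffAt 𝓘(ℝ, P)
      (𝓘(ℝ, EuclideanSpace ℝ (Fin k)).prod 𝓘(ℝ, Aff n).tangent) ∞ κ s)
    {q : CP n × CP n} (hq : q = szoke (κ t).2) (a b : P) :
    iDelDelbar (stenzelPotential ∘ (extChartAt (𝓘(ℝ, Aff n).prod 𝓘(ℝ, Aff n)) q).symm)
      (extChartAt (𝓘(ℝ, Aff n).prod 𝓘(ℝ, Aff n)) q q)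
      (fderiv ℝ (fun s => extChartAt (𝓘(ℝ, Aff n).prod 𝓘(ℝ, Aff n)) q (szoke (κ s).2)) t a)
      (fderiv ℝ (fun s => extChartAt (𝓘(ℝ, Aff n).prod 𝓘(ℝ, Aff n)) q (szoke (κ s).2)) t b) =
        0 := by
  obtain ⟨i, hi⟩ := exists_mem_affineDomain (κ t).2.proj
  rw [stenzelPotential_comp_extChartAt_symm]
  have hκ2 : ContMDiffAt 𝓘(ℝ, P) 𝓘(ℝ, Aff n).tangent ∞ (fun s => (κ s).2) t :=
    contMDiffAt_snd.comp t hs.self_of_nhds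
  set Fh : P → HomVec n × HomVec n :=
    fun s => szokeHat (affineSection i (κ s).2.proj) (affineLift i (κ s).2) with hFh
  set α := chartIndex q.1
  set β := chartIndex q.2
  have hF : ∀ s, (κ s).2.proj ∈ affineDomain i → (Fh s).1 ≠ 0 ∧ (Fh s).2 ≠ 0 ∧
      inner ℂ (conjVec (Fh s).2) (Fh s).1 ≠ 0 ∧
      szoke (κ s).2 = (toCP (Fh s).1, toCP (Fh s).2) := by
    intro s h
    have hl := isHorizontalLift_affineLift h
    refine ⟨szokeHat_fst_ne_zero hl.1 hl.2.1, szokeHat_snd_ne_zero hl.1 hl.2.1, ?_, szoke_eq hl⟩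
    rw [← sum_mul_eq_inner, sum_szokeHat hl.1 hl.2.1]
    exact_mod_cast pow_ne_zero 2 (norm_ne_zero_iff.2 hl.1)
  -- The locus where all the coordinates in use are defined is a neighbourhood of `t`.
  have hnear : ∀ᶠ s in nhds t, (κ s).2.proj ∈ affineDomain i :=
    hκ2.continuousAt.preimage_mem_nhds ((isOpen_proj_mem_affineDomain i).mem_nhds hi)
  have hFt := hF t hi
  have hFc : ContinuousAt Fh t :=
    (fderiv_potentialHom_normal hφ hκ hs.self_of_nhds hi).1.continuousAt
  have hα : (Fh t).1 α ≠ 0 := by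
    have := mem_affineDomain_chartIndex q.1
    rw [hq, hFt.2.2.2, toCP_mem_affineDomain hFt.1] at this
    simpa only [α, hq, hFt.2.2.2] using this
  have hβ : (Fh t).2 β ≠ 0 := by
    have := mem_affineDomain_chartIndex q.2
    rw [hq, hFt.2.2.2, toCP_mem_affineDomain hFt.2.1] at this
    simpa only [β, hq, hFt.2.2.2] using this
  have hα' : ∀ᶠ s in nhds t, (Fh s).1 α ≠ 0 := by
    have c1 : Continuous fun q : HomVec n × HomVec n => q.1 α := by fun_prop
    exact (c1.continuousAt.comp hFc).eventually_ne hα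
  have hβ' : ∀ᶠ s in nhds t, (Fh s).2 β ≠ 0 := by
    have c1 : Continuous fun q : HomVec n × HomVec n => q.2 β := by fun_prop
    exact (c1.continuousAt.comp hFc).eventually_ne hβ
  set Fa : P → Aff n × Aff n :=
    fun s => extChartAt (𝓘(ℝ, Aff n).prod 𝓘(ℝ, Aff n)) q (szoke (κ s).2) with hFa
  have hFaE : ∀ s, (κ s).2.proj ∈ affineDomain i → Fa s = affineRatio α β (Fh s) := by
    intro s h
    obtain ⟨h1, h2, -, h3⟩ := hF s h
    rw [hFa]
    simp only
    rw [h3, extChartAt_toCP q h1 h2]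
  have hpt : extChartAt (𝓘(ℝ, Aff n).prod 𝓘(ℝ, Aff n)) q q = Fa t := by
    rw [hFa]
    simp only
    rw [← hq]
  have hFaS : ContDiffAt ℝ ∞ Fa t := by
    have h1 : ContMDiffAt (𝓘(ℝ, Aff n).prod 𝓘(ℝ, Aff n)) 𝓘(ℝ, Aff n × Aff n) ∞
        (extChartAt (𝓘(ℝ, Aff n).prod 𝓘(ℝ, Aff n)) q) (szoke (κ t).2) := by
      rw [← hq]
      exact contMDiffAt_extChartAt
    exact (h1.comp t ((contMDiff_szoke.contMDiffAt).comp t hκ2)).contDiffAt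
  rw [hpt]
  refine iDelDelbar_eq_zero_of_pullback ?_ (hFaS.of_le ENat.LEInfty.out) ?_ a b
  · rw [hFaE t hi]
    exact (contDiffAt_potentialAff (inner_homogenize_ratio hα hβ hFt.2.2.1)).of_le
      ENat.LEInfty.out
  · filter_upwards [hs, hnear, eventually_eventually_nhds.2 hnear, hα', hβ'] with s h1 h2 h3 h4 h5 e
    obtain ⟨g1, g2⟩ := fderiv_potentialHom_normal hφ hκ h1 h2
    have h6 : Fa =ᶠ[nhds s] fun r => affineRatio α β (Fh r) := h3.mono hFaE
    rw [h6.fderiv_eq, hFaE s h2]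
    exact fderiv_potentialAff (g1.differentiableAt (by simp)) h4 h5 (hF s h2).2.2.1 (g2 e)

end

end

/-! ### The restriction of Szőke's map to the normal bundle -/

section
variable {n k : ℕ} {M : Type*} [TopologicalSpace M] [ChartedSpace (EuclideanSpace ℝ (Fin k)) M]
  {φ : M → CP n}

theorem injective_szokeNormal (hφ : Function.Injective φ) :
    Function.Injective (szokeNormal k φ) := by
  intro y z h
  have h1 : (normalIncl k φ y).2 = (normalIncl k φ z).2 := szoke_injective h
  refine isEmbedding_normalIncl.injective (Prod.ext (hφ ?_) h1)
  exact congrArg (fun τ : TCP n => τ.proj) h1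

theorem isEmbedding_szokeNormal (hφ : Topology.IsEmbedding φ) :
    Topology.IsEmbedding (szokeNormal k φ) := by
  refine ⟨isEmbedding_szoke.isInducing.comp (f := fun y => (normalIncl k φ y).2) ?_,
    injective_szokeNormal hφ.injective⟩
  have hproj : Continuous (fun τ : TCP n => (τ.proj, τ)) :=
    (FiberBundle.continuous_proj (Aff n) (TangentSpace 𝓘(ℝ, Aff n))).prodMk continuous_id
  -- Followed by `τ ↦ (π τ, τ)`, the map `(x, ν) ↦ ν` is `(φ × id) ∘ normalIncl`, which is inducing.
  refine Topology.IsInducing.of_comp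
    (continuous_snd.comp isEmbedding_normalIncl.continuous) hproj ?_
  exact (hφ.isInducing.prodMap Topology.IsInducing.id).comp isEmbedding_normalIncl.isInducing

/-- For any smooth structure on the normal bundle that makes its inclusion into `M × TℂP^n` a
smooth immersion, `szoke` restricts to a Lagrangian immersion. -/
theorem isLagrangianImmersion_szokeNormal
    (hφ : ContMDiff 𝓘(ℝ, EuclideanSpace ℝ (Fin k)) 𝓘(ℝ, Aff n) ∞ φ)
    (himm : ∀ x, Function.Injective
      (mfderiv 𝓘(ℝ, EuclideanSpace ℝ (Fin k)) 𝓘(ℝ, Aff n) φ x))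
    [ChartedSpace (EuclideanSpace ℝ (Fin (2 * n))) (NormalBundle k φ)]
    [IsManifold 𝓘(ℝ, EuclideanSpace ℝ (Fin (2 * n))) ∞ (NormalBundle k φ)]
    (hι : ContMDiff 𝓘(ℝ, EuclideanSpace ℝ (Fin (2 * n)))
      (𝓘(ℝ, EuclideanSpace ℝ (Fin k)).prod 𝓘(ℝ, Aff n).tangent) ∞ (normalIncl k φ))
    (hinj : ∀ y, Function.Injective (mfderiv 𝓘(ℝ, EuclideanSpace ℝ (Fin (2 * n)))
      (𝓘(ℝ, EuclideanSpace ℝ (Fin k)).prod 𝓘(ℝ, Aff n).tangent) (normalIncl k φ) y)) :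
    IsLagrangianImmersion (szokeNormal k φ) := by
  have h1 : ContMDiff 𝓘(ℝ, EuclideanSpace ℝ (Fin (2 * n))) 𝓘(ℝ, EuclideanSpace ℝ (Fin k)) ∞
      (fun y => (normalIncl k φ y).1) := contMDiff_fst.comp hι
  have h2 : ContMDiff 𝓘(ℝ, EuclideanSpace ℝ (Fin (2 * n))) 𝓘(ℝ, Aff n).tangent ∞
      (fun y => (normalIncl k φ y).2) := contMDiff_snd.comp hι
  have hF : ContMDiff 𝓘(ℝ, EuclideanSpace ℝ (Fin (2 * n))) (𝓘(ℝ, Aff n).prod 𝓘(ℝ, Aff n)) ∞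
      (szokeNormal k φ) := contMDiff_szoke.comp h2
  refine ⟨fun y => szoke_mem_stenzelDomain _, hF, fun y => ?_, fun y u v => ?_⟩
  · have d1 := (h1 y).mdifferentiableAt (by simp)
    have d2 := (h2 y).mdifferentiableAt (by simp)
    have e1 := mfderiv_comp y ((contMDiff_szoke (normalIncl k φ y).2).mdifferentiableAt
      (by simp)) d2
    have dproj : MDifferentiableAt 𝓘(ℝ, Aff n).tangent 𝓘(ℝ, Aff n)
        (fun τ : TCP n => τ.proj) (normalIncl k φ y).2 :=
      (Bundle.contMDiff_proj (n := ∞) (IB := 𝓘(ℝ, Aff n))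
        (TangentSpace 𝓘(ℝ, Aff n) : CP n → Type)).contMDiffAt.mdifferentiableAt (by simp)
    have e2 := mfderiv_comp y dproj d2
    have e3 := mfderiv_comp y ((hφ (normalIncl k φ y).1).mdifferentiableAt (by simp)) d1
    have e4 := mfderiv_prodMk d1 d2
    let D1 : EuclideanSpace ℝ (Fin (2 * n)) →L[ℝ] EuclideanSpace ℝ (Fin k) :=
      mfderiv 𝓘(ℝ, EuclideanSpace ℝ (Fin (2 * n))) 𝓘(ℝ, EuclideanSpace ℝ (Fin k))
        (fun y => (normalIncl k φ y).1) y
    let D2 : EuclideanSpace ℝ (Fin (2 * n)) →L[ℝ] Aff n × Aff n :=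
      mfderiv 𝓘(ℝ, EuclideanSpace ℝ (Fin (2 * n))) 𝓘(ℝ, Aff n).tangent
        (fun y => (normalIncl k φ y).2) y
    let DF : EuclideanSpace ℝ (Fin (2 * n)) →L[ℝ] Aff n × Aff n :=
      mfderiv 𝓘(ℝ, EuclideanSpace ℝ (Fin (2 * n))) (𝓘(ℝ, Aff n).prod 𝓘(ℝ, Aff n))
        (szokeNormal k φ) y
    let Dι : EuclideanSpace ℝ (Fin (2 * n)) →L[ℝ] EuclideanSpace ℝ (Fin k) × (Aff n × Aff n) :=
      mfderiv 𝓘(ℝ, EuclideanSpace ℝ (Fin (2 * n)))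
        (𝓘(ℝ, EuclideanSpace ℝ (Fin k)).prod 𝓘(ℝ, Aff n).tangent) (normalIncl k φ) y
    change Function.Injective DF
    rw [injective_iff_map_eq_zero]
    intro u hu
    -- The component of `u` in `TℂP^n` vanishes since `Φ` is an immersion; so the component in `M` is
    -- killed by `dφ`.
    have g2 : D2 u = 0 := by
      refine injective_mfderiv_szoke (normalIncl k φ y).2 ?_
      have := congrArg (fun L : EuclideanSpace ℝ (Fin (2 * n)) →L[ℝ] Aff n × Aff n => L u) e1
      exact (this.symm.trans hu).trans (map_zero _).symm
    have g1 : D1 u = 0 := by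
      refine himm (normalIncl k φ y).1 ?_
      have t2 := congrArg (fun L : EuclideanSpace ℝ (Fin (2 * n)) →L[ℝ] Aff n => L u) e2
      have t3 := congrArg (fun L : EuclideanSpace ℝ (Fin (2 * n)) →L[ℝ] Aff n => L u) e3
      have t4 : (mfderiv 𝓘(ℝ, Aff n).tangent 𝓘(ℝ, Aff n) (fun τ : TCP n => τ.proj)
          (normalIncl k φ y).2 : Aff n × Aff n →L[ℝ] Aff n) (D2 u) = 0 := by
        rw [g2]; exact map_zero _
      exact (t3.symm.trans (t2.trans t4)).trans (map_zero _).symm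
    have gι : Dι u = 0 := by
      have := congrArg (fun L : EuclideanSpace ℝ (Fin (2 * n)) →L[ℝ]
        EuclideanSpace ℝ (Fin k) × (Aff n × Aff n) => L u) e4
      exact this.trans (Prod.ext g1 g2)
    exact hinj y (gι.trans (map_zero Dι).symm)
  · set ψ := (extChartAt 𝓘(ℝ, EuclideanSpace ℝ (Fin (2 * n))) y).symm with hψ
    set t := extChartAt 𝓘(ℝ, EuclideanSpace ℝ (Fin (2 * n))) y y with ht
    have hψt : ψ t = y := extChartAt_to_inv y
    have hq : szokeNormal k φ y = szoke (normalIncl k φ (ψ t)).2 := by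
      rw [hψt]
      rfl
    have hs : ∀ᶠ s in nhds t, ContMDiffAt 𝓘(ℝ, EuclideanSpace ℝ (Fin (2 * n)))
        (𝓘(ℝ, EuclideanSpace ℝ (Fin k)).prod 𝓘(ℝ, Aff n).tangent) ∞
        (fun s => normalIncl k φ (ψ s)) s := by
      have ho := isOpen_extChartAt_target (I := 𝓘(ℝ, EuclideanSpace ℝ (Fin (2 * n)))) y
      filter_upwards [ho.mem_nhds (mem_extChartAt_target y)] with s hs
      exact (hι _).comp s ((contMDiffOn_extChartAt_symm y).contMDiffAt (ho.mem_nhds hs))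
    have hd : ∀ w : EuclideanSpace ℝ (Fin (2 * n)),
        mfderiv 𝓘(ℝ, EuclideanSpace ℝ (Fin (2 * n))) (𝓘(ℝ, Aff n).prod 𝓘(ℝ, Aff n))
          (szokeNormal k φ) y w =
        fderiv ℝ (fun s => extChartAt (𝓘(ℝ, Aff n).prod 𝓘(ℝ, Aff n)) (szokeNormal k φ y)
          (szoke (normalIncl k φ (ψ s)).2)) t w := by
      intro w
      rw [((hF y).mdifferentiableAt (by simp)).mfderiv, modelWithCornersSelf_coe, Set.range_id,
        fderivWithin_univ]
      rfl
    have h := iDelDelbar_szoke_normal hφ (κ := fun s => normalIncl k φ (ψ s))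
      (fun s => Set.mem_range_self _) hs hq u v
    rw [← hd u, ← hd v] at h
    exact h

end

end StenzelCP

theorem proposition1 (n k : ℕ) {M : Type*} [TopologicalSpace M]
    [ChartedSpace (EuclideanSpace ℝ (Fin k)) M]
    [IsManifold 𝓘(ℝ, EuclideanSpace ℝ (Fin k)) ∞ M]
    (φ : M → CP n)
    (hφ : ContMDiff 𝓘(ℝ, EuclideanSpace ℝ (Fin k)) 𝓘(ℝ, Aff n) ∞ φ)
    (himm : ∀ x, Function.Injective
      (mfderiv 𝓘(ℝ, EuclideanSpace ℝ (Fin k)) 𝓘(ℝ, Aff n) φ x)) :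
    Set.BijOn (szoke : TCP n → CP n × CP n) Set.univ (stenzelDomain n) ∧
    (∃ _ : ChartedSpace (EuclideanSpace ℝ (Fin (2 * n))) (NormalBundle k φ),
      IsManifold 𝓘(ℝ, EuclideanSpace ℝ (Fin (2 * n))) ∞ (NormalBundle k φ) ∧
      IsLagrangianImmersion (szokeNormal k φ)) ∧
    (Function.Injective φ → Function.Injective (szokeNormal k φ)) ∧
    (Topology.IsEmbedding φ → Topology.IsEmbedding (szokeNormal k φ)) := by
  have P := fun y : NormalBundle k φ =>
    Classical.choice (nonempty_localParam_normalIncl hφ himm y)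
  have hι := isEmbedding_normalIncl (k := k) (φ := φ)
  refine ⟨bijOn_szoke, ⟨chartedSpaceOfLocalParam P hι, isManifold_of_localParam P hι, ?_⟩,
    injective_szokeNormal, isEmbedding_szokeNormal⟩
  let := chartedSpaceOfLocalParam P hι
  have := isManifold_of_localParam P hι
  exact isLagrangianImmersion_szokeNormal hφ himm (contMDiff_of_localParam P hι)
    (injective_mfderiv_of_localParam P hι)
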